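/- **Theorem (Continuous dependence on initial data for Kirchhoff equations).** *Setting.* Let $H$ be a separable real Hilbert space and let $A$ be a nonnegative self-adjoint operator on $H$ with dense domain, realized as a multiplication operator: there are a measure space $(M,\mu)$, a measurable $\lambda:M\to[0,\infty)$ and a unitary $u\mapsto\hat u$ from $H$ onto $L^2(M,\mu)$ under which $A$ becomes multiplication by $\lambda^2$ with its maximal domain. (For an orthonormal basis of eigenvectors $Ae_k=\lambda_k^2e_k$, $\hat u$ is the sequence of components of $u$.) For $\varphi:[0,\infty)\to[1,\infty)$ with $\varphi\circ\lambda$ measurable, $r\ge 0$ and $\alpha\ge 0$, let $$|A^\alpha u|^2=\int_M\lambda^{4\alpha}\hat u^2\,d\mu,\qquad \mathcal G_{\varphi,r,\alpha}=\Big\{u\in H:\ [u]_{\varphi,r,\alpha}^2:=\int_M\lambda^{4\alpha}\hat u^2e^{r\varphi(\lambda)}\,d\mu<\infty\Big\},$$ with norm $(|u|^2+[u]^2_{\varphi,r,\alpha})^{1/2}$. For $R,T>0$ with $RT<r_0$, let $X_{R,T}$ be the space of functions $u$ such that $$u\in C^1([0,\tau];\mathcal G_{\varphi,r_0-R\tau,\alpha})\cap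 C^0([0,\tau];\mathcal G_{\varphi,r_0-R\tau,\alpha+1/2})\qquad\text{for every }\tau\in(0,T];$$ convergence in $X_{R,T}$ means convergence in the norms of these spaces for every $\tau\in(0,T]$. A solution on $[0,T]$ of the problem $$u''+m(|A^{1/2}u|^2)Au=0,\qquad u(0)=u_0,\quad u'(0)=u_1\tag{P}$$ (in $C^1([0,T];D(A^{1/4}))\cap C^0([0,T];D(A^{3/4}))$) satisfies $\frac{d}{dt}\langle u'(t),v\rangle=-m(|A^{1/2}u(t)|^2)\langle u(t),Av\rangle$ for all $v\in D(A)$ and $t\in[0,T]$, together with the initial conditions. *Assumptions.* Let $\omega:[0,\infty)\to[0,\infty)$ be continuous, nondecreasing and subadditive with $\omega(0)=0$; let $m:[0,\infty)\to[0,\infty)$ satisfy $|m(a)-m(b)|\le L\,\omega(|a-b|)$ for all $a,b\ge 0$; let $\varphi:[0,\infty)\to[1,\infty)$ be bounded in a neighbourhood of $0$. Assume that, for some constant $\Lambda$, either $\inf m>0$ and $\sigma\,\omega(1/\sigma)\le\Lambda\varphi(\sigma)$ for all $\sigma>0$, or $\inf m=0$ and $\sigma\le\Lambda\varphi\big(\sigma/\sqrt{\omega(1/\sigma)}\big)$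 for all $\sigma>0$. Let $r_0>0$, $\alpha\ge 1/4$ and $N\in\mathbb R$. *Claim.* There are $T,K,R>0$ with $RT<r_0$, depending only on $\omega,m,L,\varphi,\Lambda,r_0,\alpha,N$, such that for all $H$, $A$ (with $\hat{\ }$, $\lambda$) as above and all $(u_0,u_1)\in\mathcal G_{\varphi,r_0,\alpha+1/2}\times\mathcal G_{\varphi,r_0,\alpha}$ with norms at most $N$ the following hold. (a) (A priori estimate.) Every solution $u\in C^1([0,T];D(A^{1/4}))\cap C^0([0,T];D(A^{3/4}))$ of (P) satisfies $|A^{1/4}u'(t)|^2+|A^{3/4}u(t)|^2\le K$ for all $t\in[0,T]$, and $u\in X_{R,T}$. (b) Let $m_n:[0,\infty)\to[0,\infty)$ satisfy $|m_n(a)-m_n(b)|\le L\,\omega(|a-b|)$ for all $a,b\ge 0$ with the same $L$, and $m_n\to m$ uniformly on compact sets. Let $(u_{0n},u_{1n})\to(u_0,u_1)$ in $\mathcal G_{\varphi,r_0,\alpha+1/2}\times\mathcal G_{\varphi,r_0,\alpha}$. Let $T_1\in(0,T)$ and $R_1>R$ with $R_1T_1<r_0$. Then there is $n_0$ such that: 1.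 for every $n\ge n_0$ the problem (P) with $m_n,u_{0n},u_{1n}$ in place of $m,u_0,u_1$ has at least one solution on $[0,T_1]$ in $X_{R_1,T_1}$; 2. for every choice of such solutions $u_n\in X_{R_1,T_1}$, $n\ge n_0$, the sequence $\{u_n\}$ is relatively compact in $X_{R_1,T_1}$: every subsequence has a further subsequence which converges in $X_{R_1,T_1}$ to an element of $X_{R_1,T_1}$; 3. every limit in $X_{R_1,T_1}$ of a subsequence of $\{u_n\}$ is a solution on $[0,T_1]$ of the limit problem (P) with $m,u_0,u_1$. -/

import Mathlib

open Set Filter Topology MeasureTheory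
open scoped ENNReal

namespace Kirchhoff

/-- A continuity modulus: a continuous nondecreasing subadditive function on `[0,∞)` vanishing
at `0` (hence with values in `[0,∞)`). -/
structure IsContinuityModulus (ω : ℝ → ℝ) : Prop where
  continuousOn : ContinuousOn ω (Ici 0)
  monotoneOn : MonotoneOn ω (Ici 0)
  map_zero : ω 0 = 0
  subadditive : ∀ a b : ℝ, 0 ≤ a → 0 ≤ b → ω (a + b) ≤ ω a + ω b

/-- `m` is `ω`-continuous on `[0,∞)` with constant `L`. -/
def OmegaContinuousWith (ω m : ℝ → ℝ) (L : ℝ) : Prop :=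
  ∀ a b : ℝ, 0 ≤ a → 0 ≤ b → |m a - m b| ≤ L * ω |a - b|

/-- The infimum of `m` over `[0,∞)`. -/
noncomputable def infVal (m : ℝ → ℝ) : ℝ := sInf (m '' Ici 0)

/-- The compatibility condition between `ω` and `φ`, with constant `Λ`: the first alternative is
the strictly hyperbolic case, the second one the weakly hyperbolic case. -/
def Compatible (ω m φ : ℝ → ℝ) (Λ : ℝ) : Prop :=
  (0 < infVal m ∧ ∀ σ : ℝ, 0 < σ → σ * ω (1 / σ) ≤ Λ * φ σ) ∨
  (infVal m = 0 ∧ ∀ σ : ℝ, 0 < σ → σ ≤ Λ * φ (σ / Real.sqrt (ω (1 / σ))))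

/-- A realization of the operator `A` as a multiplication operator on some `L²(M, μ)`: a unitary
`U : H → L²(M, μ)` and a measurable function `lam ≥ 0` such that `A` becomes the multiplication by
`lam ^ 2` with its maximal domain. If `M` is a countable set with the counting measure, then
`U u` is the sequence of components of `u` along an orthonormal basis of eigenvectors of `A`, with
eigenvalues `lam k ^ 2`. -/
structure SpectralRep {H : Type*} [NormedAddCommGroup H] [InnerProductSpace ℝ H]
    (A : H →ₗ.[ℝ] H) {M : Type*} [MeasurableSpace M] (μ : Measure M) where
  lam : M → ℝ
  measurable_lam : Measurable lam
  lam_nonneg : ∀ ξ, 0 ≤ lam ξ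
  U : H ≃ₗᵢ[ℝ] Lp ℝ 2 μ
  mem_domain_iff : ∀ x : H, x ∈ A.domain ↔ MemLp (fun ξ => lam ξ ^ 2 * U x ξ) 2 μ
  apply_ae : ∀ x : A.domain, ∀ᵐ ξ ∂μ, U (A x) ξ = lam ξ ^ 2 * U (x : H) ξ

section

variable {H : Type*} [NormedAddCommGroup H] [InnerProductSpace ℝ H] {A : H →ₗ.[ℝ] H}
  {M : Type*} [MeasurableSpace M] {μ : Measure M}

/-- `|A^β u|²`, as an element of `[0,∞]`; it is finite exactly when `u ∈ D(A^β)`. -/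
noncomputable def powNormSq (S : SpectralRep A μ) (β : ℝ) (u : H) : ℝ≥0∞ :=
  ∫⁻ ξ, ENNReal.ofReal (S.lam ξ ^ (4 * β) * S.U u ξ ^ 2) ∂μ

/-- The square of the Gevrey seminorm: `∑ λ^(4α) u_λ² exp (r φ(λ))`, as an element of `[0,∞]`. -/
noncomputable def gevreySq (S : SpectralRep A μ) (φ : ℝ → ℝ) (r α : ℝ) (u : H) : ℝ≥0∞ :=
  ∫⁻ ξ, ENNReal.ofReal
    (S.lam ξ ^ (4 * α) * S.U u ξ ^ 2 * Real.exp (r * φ (S.lam ξ))) ∂μ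

/-- Membership in the generalized Gevrey space `G_{φ,r,α}(A)`. For `r = 0` this is `D(A^α)`. -/
def MemGevrey (S : SpectralRep A μ) (φ : ℝ → ℝ) (r α : ℝ) (u : H) : Prop :=
  gevreySq S φ r α u < ∞

/-- The Hilbert norm of `G_{φ,r,α}(A)` (with value `∞` outside of that space). -/
noncomputable def gevreyNorm (S : SpectralRep A μ) (φ : ℝ → ℝ) (r α : ℝ) (u : H) : ℝ≥0∞ :=
  (‖u‖ₑ ^ 2 + gevreySq S φ r α u) ^ (1 / 2 : ℝ)

/-- `u ∈ C⁰([0,τ]; G_{φ,r,α}(A))`. -/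
def ContGevrey (S : SpectralRep A μ) (φ : ℝ → ℝ) (r α τ : ℝ) (u : ℝ → H) : Prop :=
  (∀ t ∈ Icc 0 τ, MemGevrey S φ r α (u t)) ∧
  ∀ t ∈ Icc 0 τ, Tendsto (fun s => gevreyNorm S φ r α (u s - u t)) (𝓝[Icc 0 τ] t) (𝓝 0)

/-- `u ∈ C¹([0,τ]; G_{φ,r,α}(A))`: the difference quotients of `u` converge in the norm of
`G_{φ,r,α}(A)` to a function `v` which is continuous with values in that space. -/
def C1Gevrey (S : SpectralRep A μ) (φ : ℝ → ℝ) (r α τ : ℝ) (u : ℝ → H) : Prop :=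
  (∀ t ∈ Icc 0 τ, MemGevrey S φ r α (u t)) ∧
  ∃ v : ℝ → H, ContGevrey S φ r α τ v ∧
    ∀ t ∈ Icc 0 τ,
      Tendsto (fun s => gevreyNorm S φ r α ((s - t)⁻¹ • (u s - u t) - v t))
        (𝓝[Icc 0 τ \ {t}] t) (𝓝 0)

/-- `u ∈ C¹([0,T]; G_{φ,r₀-Rt,α}(A)) ∩ C⁰([0,T]; G_{φ,r₀-Rt,α+1/2}(A))`. -/
def InScale (S : SpectralRep A μ) (φ : ℝ → ℝ) (r₀ R α T : ℝ) (u : ℝ → H) : Prop :=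
  ∀ τ ∈ Ioc 0 T,
    C1Gevrey S φ (r₀ - R * τ) α τ u ∧ ContGevrey S φ (r₀ - R * τ) (α + 1 / 2) τ u

/-- Convergence of a sequence in the space `InScale`: for every `τ ∈ (0,T]`, convergence in the
norms of `C⁰([0,τ]; G_{φ,r₀-Rτ,α+1/2}(A))` and of `C¹([0,τ]; G_{φ,r₀-Rτ,α}(A))`. -/
def TendstoInScale (S : SpectralRep A μ) (φ : ℝ → ℝ) (r₀ R α T : ℝ)
    (u : ℕ → ℝ → H) (w : ℝ → H) : Prop :=
  ∀ τ ∈ Ioc 0 T,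
    Tendsto (fun n => ⨆ t ∈ Icc 0 τ, gevreyNorm S φ (r₀ - R * τ) (α + 1 / 2) (u n t - w t))
      atTop (𝓝 0) ∧
    Tendsto (fun n => ⨆ t ∈ Icc 0 τ, gevreyNorm S φ (r₀ - R * τ) α (u n t - w t))
      atTop (𝓝 0) ∧
    Tendsto (fun n => ⨆ t ∈ Icc 0 τ, gevreyNorm S φ (r₀ - R * τ) α
        (derivWithin (u n) (Icc 0 τ) t - derivWithin w (Icc 0 τ) t))
      atTop (𝓝 0)

/-- `u ∈ C¹([0,T]; D(A^{1/4})) ∩ C⁰([0,T]; D(A^{3/4}))`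
(the Gevrey spaces with `r = 0` are the spaces `D(A^α)`, whatever `φ` is). -/
def InPhaseSpace (S : SpectralRep A μ) (T : ℝ) (u : ℝ → H) : Prop :=
  C1Gevrey S (fun _ => 1) 0 (1 / 4) T u ∧ ContGevrey S (fun _ => 1) 0 (3 / 4) T u

/-- `u` solves `u'' + m(|A^{1/2} u|²) A u = 0` on `[0,T]` with `u(0) = u₀` and `u'(0) = u₁`.
Since `A u(t)` need not lie in `H` for functions in the phase space, the equation is tested
against the elements `v` of `D(A)`: `d/dt ⟨u'(t), v⟩ = - m(|A^{1/2} u(t)|²) ⟨u(t), A v⟩`.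
It is only used for functions which are at least in the class `InPhaseSpace`. -/
def IsSolution (S : SpectralRep A μ) (m : ℝ → ℝ) (u₀ u₁ : H) (T : ℝ) (u : ℝ → H) : Prop :=
  DifferentiableOn ℝ u (Icc 0 T) ∧ u 0 = u₀ ∧ derivWithin u (Icc 0 T) 0 = u₁ ∧
  ∀ v : A.domain, ∀ t ∈ Icc 0 T,
    HasDerivWithinAt (fun s => inner ℝ (derivWithin u (Icc 0 T) s) (v : H))
      (-(m (powNormSq S (1 / 2) (u t)).toReal * inner ℝ (u t) (A v))) (Icc 0 T) t

/-- The conclusion of the a priori estimate for the data `(u₀, u₁)` and the constants `T, K, R`: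
every solution in the phase space has energy at most `K`, and belongs to the scale of Gevrey
spaces. -/
def AprioriEstimate (S : SpectralRep A μ) (m φ : ℝ → ℝ) (r₀ α T K R : ℝ) (u₀ u₁ : H) : Prop :=
  ∀ u : ℝ → H, InPhaseSpace S T u → IsSolution S m u₀ u₁ T u →
    (∀ t ∈ Icc 0 T, powNormSq S (1 / 4) (derivWithin u (Icc 0 T) t) +
      powNormSq S (3 / 4) (u t) ≤ ENNReal.ofReal K) ∧
    InScale S φ r₀ R α T u

end

end Kirchhoff

open Set Filter Topology MeasureTheory
open scoped ENNReal

namespace Kirchhoff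

/-! Put c(t) = m(|A^{1/2}u(t)|²). The equation becomes the linear problem u'' + c(t)Au = 0, which
splits into one oscillator y'' + c(t)λ²y = 0 for each spectral frequency λ. The core is a bound for
these oscillators, uniform over all coefficients with a fixed ω-modulus (`energy_estimate`): the
energy of a frequency grows at most by the factor C φ(λ) exp(κφ(λ)t). To prove it, c is replaced in
the energy by a differentiable approximation e, a mean of c over a short interval. The growth rate
is then controlled by λ|e - c|/√e and |e'|/e. If c is bounded away from zero, means over length 1/λ
make both of order λω(1/λ), which is at most a multiple of φ(λ). If c may vanish, one writes λ =
σ/√ω(1/σ), averages over length 1/σ and adds ω(1/σ); both terms are then of order σ, again at most a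
multiple of φ(λ). The exponential is paid for by the shrinking Gevrey radius, and R ≥ κ + 1 leaves a
margin that also absorbs the factor φ(λ) (`exists_weight_loss`).

The linear problem and the weak formulation are linked in both directions. An integrable majorant of
the frequency energies makes the frequencywise flow a weak solution with Gevrey regularity
(`Dominated.weak_equation`, `Dominated.gevrey_regularity`). Conversely a weak solution is the flow
of its own coefficient, by pairing it with solutions of bounded spectrum (`weak_solution_eq_flow`).
Dominated convergence in λ gives continuous dependence on coefficient and data in the whole scale
(`tendstoInScale_linSol`).

The nonlinear loop closes because |A^{1/2}u|² = ⟨A^{1/4}u, A^{3/4}u⟩ is Lipschitz with constant 2K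
as long as the phase energy is at most K, so that c inherits the modulus ω. Since C does not depend
on the modulus constant of c, one can fix K first, then the modulus constant, then κ, and finally a
small T (`exists_energyConstants`). A continuity argument in time (`Admits.exists_coeff`) keeps the
energy of every solution below K and its coefficient in one fixed class. This is the a priori
estimate.

The class of coefficients is compact for uniform convergence (`exists_subseq_coeffClass`). Existence
follows by solving the problem with a delay h and letting h tend to 0 (`Admits.exists_delay`,
`Admits.exists_fixed_coeff`), with no contraction or uniqueness for the nonlinear problem. For a
sequence of perturbed problems, a subsequence of the coefficients converges, hence so do the
solutions, and the uniform convergence of m_n to m identifies the limit coefficient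
(`exists_subseq_solution`). -/

/-! ### The scalar equation `y'' + b(t) y = 0` -/

/-- `z = (y, y')` solves the first order system associated with `y'' + b(t) y = 0` on `[0,1]`. -/
def IsOscillator (b : ℝ → ℝ) (z : ℝ → ℝ × ℝ) : Prop :=
  ∀ t ∈ Icc (0 : ℝ) 1, HasDerivWithinAt z ((z t).2, -(b t * (z t).1)) (Icc 0 1) t

lemma IsOscillator.continuousOn {b : ℝ → ℝ} {z : ℝ → ℝ × ℝ} (h : IsOscillator b z) :
    ContinuousOn z (Icc 0 1) := fun t ht => (h t ht).continuousWithinAt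

lemma IsOscillator.hasDerivWithinAt_fst {b : ℝ → ℝ} {z : ℝ → ℝ × ℝ} (h : IsOscillator b z) {t : ℝ}
    (ht : t ∈ Icc (0 : ℝ) 1) : HasDerivWithinAt (fun s => (z s).1) (z t).2 (Icc 0 1) t :=
  (ContinuousLinearMap.fst ℝ ℝ ℝ).hasFDerivAt.comp_hasDerivWithinAt t (h t ht)

lemma IsOscillator.hasDerivWithinAt_snd {b : ℝ → ℝ} {z : ℝ → ℝ × ℝ} (h : IsOscillator b z) {t : ℝ}
    (ht : t ∈ Icc (0 : ℝ) 1) :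
    HasDerivWithinAt (fun s => (z s).2) (-(b t * (z t).1)) (Icc 0 1) t :=
  (ContinuousLinearMap.snd ℝ ℝ ℝ).hasFDerivAt.comp_hasDerivWithinAt t (h t ht)

lemma hasDerivWithinAt_Ici_of_Icc {E : Type*} [NormedAddCommGroup E] [NormedSpace ℝ E]
    {f : ℝ → E} {f' : E} {a b t : ℝ}
    (h : HasDerivWithinAt f f' (Icc a b) t) (ht : t ∈ Ico a b) :
    HasDerivWithinAt f f' (Ici t) t :=
  h.mono_of_mem_nhdsWithin (mem_of_superset (Icc_mem_nhdsGE ht.2) (Icc_subset_Icc_left ht.1))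

/-- Truncation of a real number to `[-r, r]`. -/
noncomputable def clamp (r x : ℝ) : ℝ := max (-r) (min r x)

lemma abs_clamp_sub_clamp_le (r x y : ℝ) : |clamp r x - clamp r y| ≤ |x - y| := by
  unfold clamp
  calc _ ≤ max |(-r) - (-r)| |min r x - min r y| := abs_max_sub_max_le_max _ _ _ _
    _ ≤ max 0 (max |r - r| |x - y|) := by
        gcongr
        · simp
        · exact abs_min_sub_min_le_max _ _ _ _
    _ = |x - y| := by simp

lemma abs_clamp_le {r : ℝ} (hr : 0 ≤ r) (x : ℝ) : |clamp r x| ≤ r := by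
  unfold clamp
  rw [abs_le]
  exact ⟨le_max_left _ _, max_le (by linarith) (min_le_left _ _)⟩

lemma clamp_of_abs_le {r x : ℝ} (h : |x| ≤ r) : clamp r x = x := by
  unfold clamp
  rw [abs_le] at h
  rw [min_eq_right h.2, max_eq_right h.1]

lemma abs_clamp_le_abs {r : ℝ} (hr : 0 ≤ r) (x : ℝ) : |clamp r x| ≤ |x| := by
  simpa [clamp_of_abs_le (show |(0 : ℝ)| ≤ r by simpa using hr)] using
    abs_clamp_sub_clamp_le r x 0

lemma exists_bound_on_unit {b : ℝ → ℝ} (hb : Continuous b) :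
    ∃ K : ℝ, 1 ≤ K ∧ ∀ t ∈ Icc (0 : ℝ) 1, |b t| ≤ K := by
  obtain ⟨K, hK⟩ := isCompact_Icc.exists_bound_of_continuousOn (s := Icc (0 : ℝ) 1) hb.continuousOn
  exact ⟨max 1 K, le_max_left _ _, fun t ht => (hK t ht).trans (le_max_right _ _)⟩

/-- The Picard–Lindelöf theorem on all of [0,1] wants a globally bounded field, so the linear field
is truncated at r = ‖x‖ exp K. The truncated field still has norm at most K‖z‖, so Gronwall keeps
its solution within r, where the truncation is inactive. -/
lemma exists_isOscillator {b : ℝ → ℝ} (hb : Continuous b) (x : ℝ × ℝ) :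
    ∃ z : ℝ → ℝ × ℝ, z 0 = x ∧ IsOscillator b z := by
  obtain ⟨K, hK1, hK⟩ := exists_bound_on_unit hb
  have hK0 : 0 ≤ K := by linarith
  set r : ℝ := ‖x‖ * Real.exp K with hr
  have hr0 : 0 ≤ r := by positivity
  let f : ℝ → ℝ × ℝ → ℝ × ℝ := fun t z => (clamp r z.2, -(b t * clamp r z.1))
  have hPL : IsPicardLindelof f (tmin := 0) (tmax := 1) ⟨0, by simp⟩ x (K * r).toNNReal 0
      (K * r).toNNReal K.toNNReal := by
    refine ⟨fun t ht => ?_, fun z _ => ?_, fun t ht z _ => ?_, ?_⟩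
    · refine LipschitzWith.lipschitzOnWith (LipschitzWith.of_dist_le_mul fun z w => ?_)
      rw [Real.coe_toNNReal _ hK0, dist_eq_norm, dist_eq_norm, Prod.norm_def, Prod.norm_def]
      refine max_le ?_ ?_
      · calc |clamp r z.2 - clamp r w.2| ≤ 1 * |z.2 - w.2| := by
              rw [one_mul]; exact abs_clamp_sub_clamp_le _ _ _
          _ ≤ K * max ‖(z - w).1‖ ‖(z - w).2‖ := by
              gcongr; exact le_max_right _ _
      · have : (f t z - f t w).2 = -(b t * (clamp r z.1 - clamp r w.1)) := by
          simp only [f, Prod.snd_sub]; ring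
        rw [this, norm_neg, norm_mul]
        calc ‖b t‖ * |clamp r z.1 - clamp r w.1| ≤ K * |z.1 - w.1| :=
              mul_le_mul (hK t ht) (abs_clamp_sub_clamp_le _ _ _) (abs_nonneg _) hK0
          _ ≤ K * max ‖(z - w).1‖ ‖(z - w).2‖ := by
              gcongr; exact le_max_left _ _
    · exact Continuous.continuousOn (by fun_prop)
    · rw [Real.coe_toNNReal _ (by positivity), Prod.norm_def]
      refine max_le ?_ ?_
      · calc |clamp r z.2| ≤ 1 * r := by rw [one_mul]; exact abs_clamp_le hr0 _
          _ ≤ K * r := by gcongr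
      · simp only [f, norm_neg, norm_mul]
        exact mul_le_mul (hK t ht) (abs_clamp_le hr0 _) (abs_nonneg _) hK0
    · simp
  obtain ⟨z, hz0, hz⟩ := hPL.exists_eq_forall_mem_Icc_hasDerivWithinAt₀
  have hz0 : z 0 = x := hz0
  have hbd : ∀ t ∈ Icc (0 : ℝ) 1, ‖z t‖ ≤ r := by
    intro t ht
    have h := norm_le_gronwallBound_of_norm_deriv_right_le (f := z) (f' := fun t => f t (z t))
      (δ := ‖x‖) (K := K) (ε := 0) (a := 0) (b := 1) (fun t ht => (hz t ht).continuousWithinAt)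
      (fun t ht => hasDerivWithinAt_Ici_of_Icc (hz t ⟨ht.1, ht.2.le⟩) ht) (by rw [hz0])
      (fun t ht => by
        rw [add_zero, Prod.norm_def]
        refine max_le ?_ ?_
        · calc |clamp r (z t).2| ≤ 1 * |(z t).2| := by
                rw [one_mul]; exact abs_clamp_le_abs hr0 _
            _ ≤ K * ‖z t‖ := by gcongr; exact norm_snd_le (z t)
        · simp only [f, norm_neg, norm_mul]
          exact mul_le_mul (hK t ⟨ht.1, ht.2.le⟩)
            ((abs_clamp_le_abs hr0 _).trans (norm_fst_le (z t))) (abs_nonneg _) hK0) t ht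
    rw [gronwallBound_ε0, sub_zero] at h
    refine h.trans ?_
    rw [hr]
    gcongr
    nlinarith [ht.2]
  refine ⟨z, hz0, fun t ht => ?_⟩
  have h := hz t ht
  simp only [f] at h
  rwa [clamp_of_abs_le ((norm_snd_le (z t)).trans (hbd t ht)),
    clamp_of_abs_le ((norm_fst_le (z t)).trans (hbd t ht))] at h

/-- Stability of the solutions of the oscillator equation. -/
lemma IsOscillator.dist_le {b b' : ℝ → ℝ} {z z' : ℝ → ℝ × ℝ} (h : IsOscillator b z)
    (h' : IsOscillator b' z') {τ K η Y δ : ℝ} (hτ : τ ≤ 1) (hK1 : 1 ≤ K)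
    (hK : ∀ t ∈ Icc 0 τ, |b t| ≤ K) (hη : ∀ t ∈ Icc 0 τ, |b t - b' t| ≤ η)
    (hY : ∀ t ∈ Icc 0 τ, ‖z' t‖ ≤ Y) (h0 : ‖z 0 - z' 0‖ ≤ δ) :
    ∀ t ∈ Icc 0 τ, ‖z t - z' t‖ ≤ gronwallBound δ K (η * Y) t := by
  have hsub : Icc 0 τ ⊆ Icc (0 : ℝ) 1 := Icc_subset_Icc_right hτ
  intro t ht
  have key := norm_le_gronwallBound_of_norm_deriv_right_le (f := fun t => z t - z' t)
    (f' := fun t => ((z t).2, -(b t * (z t).1)) - ((z' t).2, -(b' t * (z' t).1)))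
    (δ := δ) (K := K) (ε := η * Y) (a := 0) (b := τ)
    ((h.continuousOn.mono hsub).sub (h'.continuousOn.mono hsub))
    (fun t ht => by
      have ht' : t ∈ Ico (0 : ℝ) 1 := ⟨ht.1, ht.2.trans_le hτ⟩
      exact hasDerivWithinAt_Ici_of_Icc
        ((h t ⟨ht'.1, ht'.2.le⟩).sub (h' t ⟨ht'.1, ht'.2.le⟩)) ht') h0
    (fun t ht => by
      have ht1 : t ∈ Icc 0 τ := ⟨ht.1, ht.2.le⟩
      have hη0 : 0 ≤ η := (abs_nonneg _).trans (hη t ht1)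
      have hY0 : 0 ≤ Y := (norm_nonneg _).trans (hY t ht1)
      rw [Prod.norm_def]
      refine max_le ?_ ?_
      · calc ‖(z t).2 - (z' t).2‖ ≤ 1 * ‖z t - z' t‖ := by
              rw [one_mul]; exact norm_snd_le (z t - z' t)
          _ ≤ K * ‖z t - z' t‖ + η * Y := by
              have : 0 ≤ η * Y := by positivity
              have := norm_nonneg (z t - z' t)
              nlinarith
      · have : (((z t).2, -(b t * (z t).1)) - ((z' t).2, -(b' t * (z' t).1))).2
            = -(b t * ((z t).1 - (z' t).1)) - (b t - b' t) * (z' t).1 := by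
          simp only [Prod.snd_sub]; ring
        rw [this]
        refine (norm_sub_le _ _).trans ?_
        rw [norm_neg, norm_mul, norm_mul]
        refine add_le_add ?_ ?_
        · exact mul_le_mul (hK t ht1) (norm_fst_le (z t - z' t)) (norm_nonneg _) (by linarith)
        · exact mul_le_mul (hη t ht1) ((norm_fst_le (z' t)).trans (hY t ht1)) (norm_nonneg _)
            hη0) t ht
  simpa using key

/-- The flow of the oscillator equation: `oscFlow b x t = (y(t), y'(t))`, where `y'' + b y = 0` on
`[0,1]` and `(y(0), y'(0)) = x`. -/
noncomputable def oscFlow (b : ℝ → ℝ) (x : ℝ × ℝ) : ℝ → ℝ × ℝ := by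
  classical
  exact if h : ∃ z : ℝ → ℝ × ℝ, z 0 = x ∧ IsOscillator b z then h.choose else 0

lemma oscFlow_zero {b : ℝ → ℝ} (hb : Continuous b) (x : ℝ × ℝ) : oscFlow b x 0 = x := by
  rw [oscFlow, dif_pos (exists_isOscillator hb x)]
  exact (exists_isOscillator hb x).choose_spec.1

lemma isOscillator_oscFlow {b : ℝ → ℝ} (hb : Continuous b) (x : ℝ × ℝ) :
    IsOscillator b (oscFlow b x) := by
  rw [oscFlow, dif_pos (exists_isOscillator hb x)]
  exact (exists_isOscillator hb x).choose_spec.2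

lemma IsOscillator.eqOn {b b' : ℝ → ℝ} {z z' : ℝ → ℝ × ℝ} (hb : Continuous b)
    (h : IsOscillator b z) (h' : IsOscillator b' z') {τ : ℝ} (hτ : τ ≤ 1)
    (hbb : EqOn b b' (Icc 0 τ)) (h0 : z 0 = z' 0) : EqOn z z' (Icc 0 τ) := by
  have hsub : Icc 0 τ ⊆ Icc (0 : ℝ) 1 := Icc_subset_Icc_right hτ
  obtain ⟨K, hK1, hK⟩ := exists_bound_on_unit hb
  obtain ⟨Y, hY⟩ := isCompact_Icc.exists_bound_of_continuousOn h'.continuousOn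
  intro t ht
  have := h.dist_le h' (η := 0) (δ := 0) hτ hK1 (fun t ht => hK t (hsub ht))
    (fun t ht => by rw [hbb ht, sub_self, abs_zero]) (fun t ht => hY t (hsub ht))
    (by rw [h0, sub_self, norm_zero]) t ht
  rw [zero_mul, gronwallBound_ε0_δ0] at this
  exact sub_eq_zero.1 (norm_le_zero_iff.1 this)

lemma oscFlow_congr {b b' : ℝ → ℝ} (hb : Continuous b) (hb' : Continuous b') {τ : ℝ} (hτ : τ ≤ 1)
    (hbb : EqOn b b' (Icc 0 τ)) (x : ℝ × ℝ) : EqOn (oscFlow b x) (oscFlow b' x) (Icc 0 τ) :=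
  (isOscillator_oscFlow hb x).eqOn hb (isOscillator_oscFlow hb' x) hτ hbb
    (by rw [oscFlow_zero hb, oscFlow_zero hb'])

lemma oscFlow_sub {b : ℝ → ℝ} (hb : Continuous b) (x y : ℝ × ℝ) {t : ℝ} (ht : t ∈ Icc (0 : ℝ) 1) :
    oscFlow b (x - y) t = oscFlow b x t - oscFlow b y t := by
  have h : IsOscillator b (fun t => oscFlow b x t - oscFlow b y t) := by
    intro s hs
    have := (isOscillator_oscFlow hb x s hs).sub (isOscillator_oscFlow hb y s hs)
    refine this.congr_deriv (Prod.ext rfl ?_)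
    simp only [Prod.fst_sub, Prod.snd_sub]
    ring
  exact (isOscillator_oscFlow hb (x - y)).eqOn hb h le_rfl (fun _ _ => rfl)
    (by simp [oscFlow_zero hb]) ht

/-- Continuous dependence of the flow on the coefficient and on the data, uniformly in time. -/
lemma tendsto_oscFlow {ι : Type*} {l : Filter ι} {b : ι → ℝ → ℝ} {b₀ : ℝ → ℝ}
    (hb : ∀ i, Continuous (b i)) (hb₀ : Continuous b₀)
    (hlim : TendstoUniformlyOn b b₀ l (Icc 0 1)) {x : ι → ℝ × ℝ} {x₀ : ℝ × ℝ}
    (hx : Tendsto x l (𝓝 x₀)) {t : ι → ℝ} (ht : ∀ i, t i ∈ Icc (0 : ℝ) 1) :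
    Tendsto (fun i => oscFlow (b i) (x i) (t i) - oscFlow b₀ x₀ (t i)) l (𝓝 0) := by
  obtain ⟨K, hK1, hK⟩ := exists_bound_on_unit hb₀
  obtain ⟨Y, hY⟩ :=
    isCompact_Icc.exists_bound_of_continuousOn (isOscillator_oscFlow hb₀ x₀).continuousOn
  have hY0 : 0 ≤ Y := (norm_nonneg _).trans (hY 0 (by simp))
  rw [Metric.tendsto_nhds]
  intro ε hε
  -- K + 1 will bound every `b i` that is within η < 1 of `b₀`, so a single Gronwall rate serves all
  -- of them.
  have hK' : K + 1 ≠ 0 := by linarith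
  have hcont : Continuous fun η : ℝ => gronwallBound η (K + 1) (η * Y) 1 := by
    simp only [gronwallBound_of_K_ne_0 hK']
    fun_prop
  have hlim0 : Tendsto (fun η : ℝ => gronwallBound η (K + 1) (η * Y) 1) (𝓝 0) (𝓝 0) := by
    have := hcont.tendsto 0
    simpa [gronwallBound_ε0_δ0] using this
  have h1 : ∀ᶠ η : ℝ in 𝓝[>] 0, gronwallBound η (K + 1) (η * Y) 1 < ε ∧ η < 1 :=
    (((hlim0.eventually (gt_mem_nhds hε)).and (gt_mem_nhds one_pos))).filter_mono
      nhdsWithin_le_nhds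
  obtain ⟨η, ⟨hη, hη1⟩, hη0⟩ := (h1.and self_mem_nhdsWithin).exists
  have hη0 : 0 < η := hη0
  filter_upwards [Metric.tendstoUniformlyOn_iff.1 hlim η hη0, Metric.tendsto_nhds.1 hx η hη0]
    with i hi hxi
  have hdiff : ∀ s ∈ Icc (0 : ℝ) 1, |b i s - b₀ s| ≤ η := fun s hs => by
    have := (hi s hs).le
    rwa [dist_comm, Real.dist_eq] at this
  have hle := (isOscillator_oscFlow (hb i) (x i)).dist_le (isOscillator_oscFlow hb₀ x₀)
    (K := K + 1) (η := η) (Y := Y) (δ := η) le_rfl (by linarith)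
    (fun s hs => by
      have h2 := hdiff s hs
      have h3 := hK s hs
      have : b i s = (b i s - b₀ s) + b₀ s := by ring
      rw [this]
      exact (abs_add_le _ _).trans (by linarith)) hdiff hY
    (by rw [oscFlow_zero (hb i), oscFlow_zero hb₀, ← dist_eq_norm]; exact hxi.le) (t i) (ht i)
  rw [dist_zero_right]
  refine (hle.trans ?_).trans_lt hη
  exact gronwallBound_mono hη0.le (by positivity) (by linarith) (ht i).2

/-- For a fixed time, the flow depends continuously on the frequency and on the data. -/
lemma continuous_oscFlow_param {c : ℝ → ℝ} (hc : Continuous c) {t : ℝ} (ht : t ∈ Icc (0 : ℝ) 1) :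
    Continuous fun p : ℝ × ℝ × ℝ => oscFlow (fun s => c s * p.1 ^ 2) p.2 t := by
  rw [continuous_iff_continuousAt]
  intro p₀
  have hu : TendstoUniformlyOn (fun (p : ℝ × ℝ × ℝ) s => c s * p.1 ^ 2)
      (fun s => c s * p₀.1 ^ 2) (𝓝 p₀) (Icc 0 1) := by
    obtain ⟨K, hK1, hK⟩ := exists_bound_on_unit hc
    rw [Metric.tendstoUniformlyOn_iff]
    intro ε hε
    have hlim : Tendsto (fun p : ℝ × ℝ × ℝ => p.1 ^ 2) (𝓝 p₀) (𝓝 (p₀.1 ^ 2)) :=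
      (by fun_prop : Continuous fun p : ℝ × ℝ × ℝ => p.1 ^ 2).tendsto p₀
    filter_upwards [Metric.tendsto_nhds.1 hlim (ε / K) (by positivity)] with p hp s hs
    rw [dist_comm, Real.dist_eq, ← mul_sub, abs_mul]
    rw [Real.dist_eq] at hp
    calc |c s| * |p.1 ^ 2 - p₀.1 ^ 2| ≤ K * |p.1 ^ 2 - p₀.1 ^ 2| := by
          gcongr; exact hK s hs
      _ < K * (ε / K) := by gcongr
      _ = ε := by field_simp
  have := tendsto_oscFlow (fun p : ℝ × ℝ × ℝ => (by fun_prop : Continuous fun s => c s * p.1 ^ 2))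
    (by fun_prop) hu (continuous_snd.tendsto p₀) (fun _ => ht)
  have h2 := this.add_const (oscFlow (fun s => c s * p₀.1 ^ 2) p₀.2 t)
  simpa [ContinuousAt] using h2

/-! ### Continuity moduli -/

section Modulus

variable {ω : ℝ → ℝ} (hω : IsContinuityModulus ω)
include hω

lemma IsContinuityModulus.nonneg {x : ℝ} (hx : 0 ≤ x) : 0 ≤ ω x := by
  rw [← hω.map_zero]
  exact hω.monotoneOn (mem_Ici.2 le_rfl) hx hx

lemma IsContinuityModulus.mono {x y : ℝ} (hx : 0 ≤ x) (hxy : x ≤ y) : ω x ≤ ω y :=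
  hω.monotoneOn hx (hx.trans hxy) hxy

lemma IsContinuityModulus.nat_mul_le (n : ℕ) {x : ℝ} (hx : 0 ≤ x) : ω (n * x) ≤ n * ω x := by
  induction n with
  | zero => simp [hω.map_zero]
  | succ n ih =>
    push_cast
    rw [add_mul, one_mul, add_mul, one_mul]
    exact (hω.subadditive _ _ (by positivity) hx).trans (by linarith)

/-- Subadditivity is iterated ⌈k⌉ times. Composition with a Lipschitz function therefore only
multiplies a modulus by a constant, and ω cannot decay faster than linearly at 0. -/
lemma IsContinuityModulus.mul_le {k x : ℝ} (hk : 0 ≤ k) (hx : 0 ≤ x) :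
    ω (k * x) ≤ (k + 1) * ω x := by
  have h1 : ω (k * x) ≤ ω (⌈k⌉₊ * x) :=
    hω.mono (by positivity) (mul_le_mul_of_nonneg_right (Nat.le_ceil k) hx)
  have h2 := hω.nat_mul_le ⌈k⌉₊ hx
  have h3 : (⌈k⌉₊ : ℝ) ≤ k + 1 := (Nat.ceil_lt_add_one hk).le
  exact (h1.trans h2).trans (mul_le_mul_of_nonneg_right h3 (hω.nonneg hx))

lemma IsContinuityModulus.tendsto_abs_sub (t : ℝ) :
    Tendsto (fun s => ω |s - t|) (𝓝 t) (𝓝 0) := by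
  have h := hω.continuousOn 0 (mem_Ici.2 le_rfl)
  rw [ContinuousWithinAt, hω.map_zero] at h
  refine h.comp (tendsto_nhdsWithin_iff.2 ⟨?_, Eventually.of_forall fun s => abs_nonneg (s - t)⟩)
  have : Continuous fun s => |s - t| := by fun_prop
  simpa using this.tendsto t

lemma OmegaContinuousWith.continuousOn {m : ℝ → ℝ} {L : ℝ} (hm : OmegaContinuousWith ω m L) :
    ContinuousOn m (Ici 0) := by
  intro t ht
  rw [ContinuousWithinAt, tendsto_iff_norm_sub_tendsto_zero]
  have h := ((hω.tendsto_abs_sub t).const_mul L).mono_left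
    (nhdsWithin_le_nhds (s := Ici (0 : ℝ)))
  rw [mul_zero] at h
  exact squeeze_zero' (Eventually.of_forall fun _ => norm_nonneg _)
    (by filter_upwards [self_mem_nhdsWithin] with s hs using hm s t hs ht) h

end Modulus

/-- The coefficients `c` of the linear problem `u'' + c(t) A u = 0`: functions with values in
`[ν, B]` which are `ω`-continuous with constant `L`. -/
structure CoeffClass (ω : ℝ → ℝ) (ν B L : ℝ) (c : ℝ → ℝ) : Prop where
  lower : ∀ t, ν ≤ c t
  upper : ∀ t, c t ≤ B
  modulus : ∀ s t, |c s - c t| ≤ L * ω |s - t|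

lemma CoeffClass.continuous {ω : ℝ → ℝ} (hω : IsContinuityModulus ω) {ν B L : ℝ} {c : ℝ → ℝ}
    (hc : CoeffClass ω ν B L c) : Continuous c := by
  rw [continuous_iff_continuousAt]
  intro t
  rw [ContinuousAt, tendsto_iff_norm_sub_tendsto_zero]
  have h := (hω.tendsto_abs_sub t).const_mul L
  rw [mul_zero] at h
  exact squeeze_zero (fun _ => norm_nonneg _) (fun s => hc.modulus s t) h

/-! ### Mean values of the coefficient -/

/-- The mean value of `c` on `[t, t + ε]`. -/
noncomputable def forwardMean (c : ℝ → ℝ) (ε t : ℝ) : ℝ := ε⁻¹ * ∫ s in t..t + ε, c s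

section Mean

variable {c : ℝ → ℝ} (hc : Continuous c) {ε : ℝ}
include hc

/-- Averaging makes a merely ω-continuous coefficient differentiable, with derivative of size
ω(ε)/ε, while moving it by a multiple of ω(ε) only. -/
lemma hasDerivAt_forwardMean (ε t : ℝ) :
    HasDerivAt (forwardMean c ε) (ε⁻¹ * (c (t + ε) - c t)) t := by
  have h1 : HasDerivAt (fun u => ∫ s in (0 : ℝ)..u, c s) (c t) t :=
    hc.integral_hasStrictDerivAt 0 t |>.hasDerivAt
  have h2 : HasDerivAt (fun u => ∫ s in (0 : ℝ)..u + ε, c s) (c (t + ε)) t :=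
    HasDerivAt.comp_add_const t ε (hc.integral_hasStrictDerivAt 0 (t + ε)).hasDerivAt
  have h3 : forwardMean c ε =
      fun u => ε⁻¹ * ((∫ s in (0 : ℝ)..u + ε, c s) - ∫ s in (0 : ℝ)..u, c s) := by
    funext u
    rw [forwardMean, intervalIntegral.integral_interval_sub_left
      (hc.intervalIntegrable _ _) (hc.intervalIntegrable _ _)]
  rw [h3]
  exact (h2.sub h1).const_mul _

variable (hε : 0 < ε)
include hε

lemma le_forwardMean {ν : ℝ} (h : ∀ t, ν ≤ c t) (t : ℝ) : ν ≤ forwardMean c ε t := by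
  have := intervalIntegral.integral_mono_on (μ := volume) (f := fun _ => ν) (g := c)
    (by linarith : t ≤ t + ε) (by simp) (hc.intervalIntegrable _ _) (fun s _ => h s)
  simp only [intervalIntegral.integral_const, add_sub_cancel_left, smul_eq_mul] at this
  rw [forwardMean, inv_mul_eq_div, le_div_iff₀ hε]
  linarith

lemma forwardMean_le {B : ℝ} (h : ∀ t, c t ≤ B) (t : ℝ) : forwardMean c ε t ≤ B := by
  have := intervalIntegral.integral_mono_on (μ := volume) (f := c) (g := fun _ => B)
    (by linarith : t ≤ t + ε) (hc.intervalIntegrable _ _) (by simp) (fun s _ => h s)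
  simp only [intervalIntegral.integral_const, add_sub_cancel_left, smul_eq_mul] at this
  rw [forwardMean, inv_mul_eq_div, div_le_iff₀ hε]
  linarith

lemma abs_forwardMean_sub_le {η t : ℝ} (h : ∀ s ∈ Icc t (t + ε), |c s - c t| ≤ η) :
    |forwardMean c ε t - c t| ≤ η := by
  have h1 : forwardMean c ε t - c t = ε⁻¹ * ∫ s in t..t + ε, (c s - c t) := by
    rw [intervalIntegral.integral_sub (hc.intervalIntegrable _ _) (by simp), forwardMean]
    simp only [intervalIntegral.integral_const, add_sub_cancel_left, smul_eq_mul]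
    field_simp
  have h2 := intervalIntegral.norm_integral_le_of_norm_le_const (a := t) (b := t + ε)
    (f := fun s => c s - c t) (C := η) (fun s hs => by
      rw [uIoc_of_le (by linarith)] at hs
      exact h s ⟨hs.1.le, hs.2⟩)
  rw [add_sub_cancel_left, abs_of_pos hε, Real.norm_eq_abs] at h2
  rw [h1, abs_mul, abs_of_pos (inv_pos.2 hε), inv_mul_eq_div, div_le_iff₀ hε]
  exact h2

end Mean

/-! ### Energy estimates for a single frequency -/

/-- The energy of a frequency `lam`, including the lower order term. -/
def freqEnergy (lam : ℝ) (x : ℝ × ℝ) : ℝ := x.2 ^ 2 + (1 + lam ^ 2) * x.1 ^ 2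

lemma freqEnergy_nonneg (lam : ℝ) (x : ℝ × ℝ) : 0 ≤ freqEnergy lam x := by
  unfold freqEnergy; positivity

/-- The energy is built with an auxiliary coefficient e instead of b. Along the flow its derivative
is 2(e - b)yy' + e'y², and a pointwise bound on this quadratic form is all that Gronwall needs. -/
lemma IsOscillator.gronwall {b : ℝ → ℝ} {z : ℝ → ℝ × ℝ} (h : IsOscillator b z)
    {e e' : ℝ → ℝ} {k : ℝ} (he0 : ∀ t, 0 ≤ e t) (he : ∀ t, HasDerivAt e (e' t) t)
    (hk : ∀ t, ∀ y v : ℝ, |2 * (e t - b t) * y * v + e' t * y ^ 2| ≤ k * (v ^ 2 + e t * y ^ 2)) :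
    ∀ t ∈ Icc (0 : ℝ) 1, (z t).2 ^ 2 + e t * (z t).1 ^ 2 ≤
      ((z 0).2 ^ 2 + e 0 * (z 0).1 ^ 2) * Real.exp (k * t) := by
  have hE : ∀ t ∈ Icc (0 : ℝ) 1, HasDerivWithinAt (fun t => (z t).2 ^ 2 + e t * (z t).1 ^ 2)
      (2 * (e t - b t) * (z t).1 * (z t).2 + e' t * (z t).1 ^ 2) (Icc 0 1) t := by
    intro t ht
    have h1 := h.hasDerivWithinAt_fst ht
    have h2 := h.hasDerivWithinAt_snd ht
    have := (h2.pow 2).add (((he t).hasDerivWithinAt (s := Icc 0 1)).mul (h1.pow 2))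
    refine this.congr_deriv ?_
    simp only [Nat.cast_ofNat, Pi.pow_apply]
    ring
  intro t ht
  have key := norm_le_gronwallBound_of_norm_deriv_right_le (K := k) (ε := 0)
    (fun t ht => (hE t ht).continuousWithinAt)
    (fun t ht => hasDerivWithinAt_Ici_of_Icc (hE t ⟨ht.1, ht.2.le⟩) ht) le_rfl
    (fun t ht => by
      have h0 : 0 ≤ (z t).2 ^ 2 + e t * (z t).1 ^ 2 := by have := he0 t; positivity
      rw [add_zero, Real.norm_of_nonneg h0]
      exact hk t _ _) t ht
  have h0 : ∀ t, 0 ≤ (z t).2 ^ 2 + e t * (z t).1 ^ 2 := fun t => by have := he0 t; positivity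
  rw [gronwallBound_ε0, sub_zero, Real.norm_of_nonneg (h0 t), Real.norm_of_nonneg (h0 0)] at key
  exact key

/-- Writing λ|e - c| ≤ k₁√e lets Young's inequality act on the product of √e λ|y| and |v|, whose
squares are exactly the two terms of the energy. This is where the division by √e in the growth rate
originates. -/
lemma abs_cross_le {lam e c e' k₁ k₂ : ℝ} (hlam : 0 ≤ lam) (he : 0 < e)
    (h1 : lam * |e - c| ≤ k₁ * √e) (h2 : |e'| ≤ k₂ * e) (y v : ℝ) :
    |2 * (e * lam ^ 2 - c * lam ^ 2) * y * v + e' * lam ^ 2 * y ^ 2| ≤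
      (k₁ + k₂) * (v ^ 2 + e * lam ^ 2 * y ^ 2) := by
  have hs : √e ^ 2 = e := Real.sq_sqrt he.le
  have hs0 : 0 < √e := Real.sqrt_pos.2 he
  have hk1 : 0 ≤ k₁ := nonneg_of_mul_nonneg_left ((by positivity : 0 ≤ lam * |e - c|).trans h1) hs0
  have hk2 : 0 ≤ k₂ := nonneg_of_mul_nonneg_left ((abs_nonneg _).trans h2) he
  have hA : |2 * (e * lam ^ 2 - c * lam ^ 2) * y * v| ≤ k₁ * (v ^ 2 + e * lam ^ 2 * y ^ 2) := by
    have : |2 * (e * lam ^ 2 - c * lam ^ 2) * y * v| =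
        (lam * |e - c|) * (2 * (lam * |y|) * |v|) := by
      rw [show 2 * (e * lam ^ 2 - c * lam ^ 2) * y * v = 2 * (lam ^ 2 * (e - c)) * y * v by ring]
      simp only [abs_mul, abs_pow, abs_of_nonneg hlam, abs_two]
      ring
    rw [this]
    calc (lam * |e - c|) * (2 * (lam * |y|) * |v|) ≤ (k₁ * √e) * (2 * (lam * |y|) * |v|) := by
          gcongr
      _ = k₁ * (2 * (√e * (lam * |y|)) * |v|) := by ring
      _ ≤ k₁ * ((√e * (lam * |y|)) ^ 2 + |v| ^ 2) := by
          gcongr; nlinarith [sq_nonneg (√e * (lam * |y|) - |v|)]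
      _ = k₁ * (v ^ 2 + e * lam ^ 2 * y ^ 2) := by
          rw [mul_pow, mul_pow, hs, sq_abs, sq_abs]; ring
  have hB : |e' * lam ^ 2 * y ^ 2| ≤ k₂ * (e * lam ^ 2 * y ^ 2) := by
    rw [mul_assoc, abs_mul, abs_of_nonneg (by positivity : 0 ≤ lam ^ 2 * y ^ 2)]
    calc _ ≤ (k₂ * e) * (lam ^ 2 * y ^ 2) := by gcongr
      _ = _ := by ring
  refine (abs_add_le _ _).trans ?_
  nlinarith [mul_nonneg hk2 (sq_nonneg v)]

/-- The energy estimate for an approximated coefficient `e`. -/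
lemma IsOscillator.approx_energy_le {c : ℝ → ℝ} {lam : ℝ} (hlam : 0 ≤ lam) {z : ℝ → ℝ × ℝ}
    (h : IsOscillator (fun s => c s * lam ^ 2) z) {e e' : ℝ → ℝ} {k₁ k₂ k : ℝ}
    (he0 : ∀ t, 0 < e t) (he : ∀ t, HasDerivAt e (e' t) t)
    (h1 : ∀ t, lam * |e t - c t| ≤ k₁ * √(e t)) (h2 : ∀ t, |e' t| ≤ k₂ * e t) (hk : k₁ + k₂ ≤ k) :
    ∀ t ∈ Icc (0 : ℝ) 1, (z t).2 ^ 2 + e t * lam ^ 2 * (z t).1 ^ 2 ≤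
      ((z 0).2 ^ 2 + e 0 * lam ^ 2 * (z 0).1 ^ 2) * Real.exp (k * t) := by
  refine h.gronwall (e := fun t => e t * lam ^ 2) (e' := fun t => e' t * lam ^ 2)
    (fun t => by have := (he0 t).le; positivity) (fun t => (he t).mul_const _) fun t y v => ?_
  refine (abs_cross_le hlam (he0 t) (h1 t) (h2 t) y v).trans ?_
  have := (he0 t).le
  gcongr

/-- A crude energy estimate, for bounded frequencies. -/
lemma IsOscillator.low_energy_le {c : ℝ → ℝ} {lam B : ℝ} {z : ℝ → ℝ × ℝ}
    (h : IsOscillator (fun s => c s * lam ^ 2) z) (hc0 : ∀ t, 0 ≤ c t) (hcB : ∀ t, c t ≤ B) :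
    ∀ t ∈ Icc (0 : ℝ) 1, freqEnergy lam (z t) ≤
      freqEnergy lam (z 0) * Real.exp ((1 + lam ^ 2) * (1 + B) * t) := by
  refine h.gronwall (e := fun _ => 1 + lam ^ 2) (e' := fun _ => 0) (fun t => by positivity)
    (fun t => hasDerivAt_const _ _) fun t y v => ?_
  have hB := (hc0 t).trans (hcB t)
  have h1 : |1 + lam ^ 2 - c t * lam ^ 2| ≤ (1 + lam ^ 2) * (1 + B) := by
    rw [abs_le]
    constructor <;> nlinarith [hc0 t, hcB t, sq_nonneg lam, mul_nonneg (hc0 t) (sq_nonneg lam),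
      mul_nonneg hB (sq_nonneg lam), mul_le_mul_of_nonneg_right (hcB t) (sq_nonneg lam)]
  rw [zero_mul, add_zero,
    show 2 * (1 + lam ^ 2 - c t * lam ^ 2) * y * v = (1 + lam ^ 2 - c t * lam ^ 2) * (2 * y * v)
      by ring, abs_mul]
  have h2 : |2 * y * v| ≤ v ^ 2 + (1 + lam ^ 2) * y ^ 2 := by
    have h0 := mul_nonneg (sq_nonneg lam) (sq_nonneg y)
    rw [abs_le]
    constructor <;> nlinarith [sq_nonneg (y - v), sq_nonneg (y + v)]
  gcongr

/-- The compatibility condition for coefficients with values in `[ν, ∞)`. -/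
def CompatibleBound (ω φ : ℝ → ℝ) (Λ ν : ℝ) : Prop :=
  (0 < ν ∧ ∀ σ : ℝ, 0 < σ → σ * ω (1 / σ) ≤ Λ * φ σ) ∨
  (ν = 0 ∧ ∀ σ : ℝ, 0 < σ → σ ≤ Λ * φ (σ / √(ω (1 / σ))))

lemma CompatibleBound.nonneg {ω φ : ℝ → ℝ} {Λ ν : ℝ} (h : CompatibleBound ω φ Λ ν) : 0 ≤ ν := by
  rcases h with h | h
  · exact h.1.le
  · exact h.1.ge

section Estimate

variable {ω φ : ℝ → ℝ} {Λ ν B : ℝ} (hω : IsContinuityModulus ω) (hφ : ∀ σ : ℝ, 0 ≤ σ → 1 ≤ φ σ)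
include hω hφ

/-- The energy estimate in the strictly hyperbolic case, for high frequencies. -/
lemma high_energy_le_strict (hν : 0 < ν) (hcomp : ∀ σ : ℝ, 0 < σ → σ * ω (1 / σ) ≤ Λ * φ σ)
    {L : ℝ} (hL : 0 ≤ L) {c : ℝ → ℝ} (hc : CoeffClass ω ν B L c) {lam : ℝ} (hlam : 1 ≤ lam)
    {z : ℝ → ℝ × ℝ} (h : IsOscillator (fun s => c s * lam ^ 2) z) {t : ℝ}
    (ht : t ∈ Icc (0 : ℝ) 1) :
    freqEnergy lam (z t) ≤ (1 + 2 / ν) * (1 + B) * φ lam *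
      Real.exp ((L * |Λ| * (1 / √ν + 1 / ν)) * φ lam * t) * freqEnergy lam (z 0) := by
  have hlam0 : 0 < lam := by linarith
  have hε : 0 < 1 / lam := by positivity
  have hcc := hc.continuous hω
  have hφ1 := hφ lam hlam0.le
  have hB : ν ≤ B := (hc.lower 0).trans (hc.upper 0)
  have hω0 : 0 ≤ ω (1 / lam) := hω.nonneg hε.le
  -- With averaging length 1/λ, both the approximation error times λ and the derivative of the mean
  -- are bounded by λ L ω(1/λ), the quantity controlled by the compatibility condition.
  set e := forwardMean c (1 / lam)
  have heν : ∀ t, ν ≤ e t := le_forwardMean hcc hε hc.lower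
  have heB : ∀ t, e t ≤ B := forwardMean_le hcc hε hc.upper
  have hX : lam * (L * ω (1 / lam)) ≤ L * (|Λ| * φ lam) := by
    have h1 := hcomp lam hlam0
    have h2 : Λ * φ lam ≤ |Λ| * φ lam := by gcongr; exact le_abs_self _
    calc lam * (L * ω (1 / lam)) = L * (lam * ω (1 / lam)) := by ring
      _ ≤ L * (|Λ| * φ lam) := mul_le_mul_of_nonneg_left (h1.trans h2) hL
  have hclose : ∀ t, |e t - c t| ≤ L * ω (1 / lam) := fun t =>
    abs_forwardMean_sub_le hcc hε fun s hs => (hc.modulus s t).trans (by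
      gcongr
      exact hω.mono (abs_nonneg _) (by
        rw [abs_of_nonneg (by linarith [hs.1])]; linarith [hs.2]))
  have key := h.approx_energy_le hlam0.le (e := e)
    (e' := fun t => (1 / lam)⁻¹ * (c (t + 1 / lam) - c t))
    (k₁ := L * (|Λ| * φ lam) / √ν) (k₂ := L * (|Λ| * φ lam) / ν)
    (k := (L * |Λ| * (1 / √ν + 1 / ν)) * φ lam)
    (fun t => hν.trans_le (heν t)) (hasDerivAt_forwardMean hcc _)
    (fun t => by
      have hsq : √ν ≤ √(e t) := Real.sqrt_le_sqrt (heν t)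
      have hs0 : 0 < √ν := Real.sqrt_pos.2 hν
      calc lam * |e t - c t| ≤ lam * (L * ω (1 / lam)) := by gcongr; exact hclose t
        _ ≤ L * (|Λ| * φ lam) := hX
        _ = L * (|Λ| * φ lam) / √ν * √ν := by field_simp
        _ ≤ _ := by gcongr)
    (fun t => by
      rw [abs_mul, one_div, inv_inv, abs_of_pos hlam0, ← one_div]
      have h3 := hc.modulus (t + 1 / lam) t
      rw [add_sub_cancel_left, abs_of_pos hε] at h3
      calc lam * |c (t + 1 / lam) - c t| ≤ lam * (L * ω (1 / lam)) := by gcongr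
        _ ≤ L * (|Λ| * φ lam) := hX
        _ = L * (|Λ| * φ lam) / ν * ν := by field_simp
        _ ≤ _ := by gcongr; exact heν t)
    (le_of_eq (by ring)) t ht
  set X := Real.exp ((L * |Λ| * (1 / √ν + 1 / ν)) * φ lam * t)
  have hX0 : 0 < X := Real.exp_pos _
  have hlow : freqEnergy lam (z t) ≤ (1 + 2 / ν) * ((z t).2 ^ 2 + e t * lam ^ 2 * (z t).1 ^ 2) := by
    have h4 : (1 + lam ^ 2) * (z t).1 ^ 2 ≤ 2 / ν * (e t * lam ^ 2 * (z t).1 ^ 2) := by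
      calc (1 + lam ^ 2) * (z t).1 ^ 2 ≤ (2 * lam ^ 2) * (z t).1 ^ 2 := by gcongr; nlinarith
        _ = 2 / ν * (ν * lam ^ 2 * (z t).1 ^ 2) := by field_simp
        _ ≤ _ := by gcongr; exact heν t
    have h5 : 0 ≤ 2 / ν * (z t).2 ^ 2 := by positivity
    have h6 : 0 ≤ e t * lam ^ 2 * (z t).1 ^ 2 := by
      have := hν.le.trans (heν t); positivity
    unfold freqEnergy
    linarith
  have hinit : (z 0).2 ^ 2 + e 0 * lam ^ 2 * (z 0).1 ^ 2 ≤ (1 + B) * freqEnergy lam (z 0) := by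
    have h0B : 0 ≤ B := hν.le.trans hB
    unfold freqEnergy
    have h7 : e 0 * lam ^ 2 * (z 0).1 ^ 2 ≤ (1 + B) * ((1 + lam ^ 2) * (z 0).1 ^ 2) := by
      rw [← mul_assoc]
      gcongr
      · linarith [heB 0]
      · linarith
    nlinarith [mul_nonneg h0B (sq_nonneg (z 0).2)]
  have h0E := freqEnergy_nonneg lam (z 0)
  have h0B : 0 ≤ B := hν.le.trans hB
  -- No factor φ is lost in this regime. It is inserted at the end through 1 ≤ φ, so that both
  -- regimes have the same form.
  calc freqEnergy lam (z t) ≤ (1 + 2 / ν) * ((1 + B) * freqEnergy lam (z 0) * X) := by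
        refine hlow.trans ?_
        gcongr
        exact key.trans (by gcongr)
    _ = ((1 + 2 / ν) * (1 + B) * X * freqEnergy lam (z 0)) * 1 := by ring
    _ ≤ ((1 + 2 / ν) * (1 + B) * X * freqEnergy lam (z 0)) * φ lam := by gcongr
    _ = _ := by ring

/-- The energy estimate in the weakly hyperbolic case, for the frequency `σ / √(ω (1/σ))`. -/
lemma high_energy_le_weak (hcomp : ∀ σ : ℝ, 0 < σ → σ ≤ Λ * φ (σ / √(ω (1 / σ))))
    (hω0 : ∀ x, 0 < x → 0 < ω x)
    {L : ℝ} (hL : 0 ≤ L) {c : ℝ → ℝ} (hc : CoeffClass ω 0 B L c) {σ lam : ℝ} (hσ : 1 ≤ σ)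
    (hlamσ : σ / √(ω (1 / σ)) = lam) (hlam : 1 ≤ lam)
    {z : ℝ → ℝ × ℝ} (h : IsOscillator (fun s => c s * lam ^ 2) z) {t : ℝ}
    (ht : t ∈ Icc (0 : ℝ) 1) :
    freqEnergy lam (z t) ≤ (1 + 4 * |Λ| / ω 1) * (1 + (B + ω 1)) * φ lam *
      Real.exp (((2 * L + 1) * |Λ|) * φ lam * t) * freqEnergy lam (z 0) := by
  have hlam0 : 0 < lam := by linarith
  have hσ0 : 0 < σ := by linarith
  have hε : 0 < 1 / σ := by positivity
  have hcc := hc.continuous hω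
  have hφ1 := hφ lam hlam0.le
  have hB : 0 ≤ B := (hc.lower 0).trans (hc.upper 0)
  have hωσ := hω0 _ hε
  have hω1 := hω0 1 one_pos
  have hωle : ω (1 / σ) ≤ ω 1 := hω.mono hε.le (by rw [div_le_one hσ0]; exact hσ)
  have hσφ : σ ≤ |Λ| * φ lam := by
    have h1 := hcomp σ hσ0
    rw [hlamσ] at h1
    exact h1.trans (by gcongr; exact le_abs_self _)
  have hsqrt : 0 < √(ω (1 / σ)) := Real.sqrt_pos.2 hωσ
  have hσlam : σ = lam * √(ω (1 / σ)) := by rw [← hlamσ]; field_simp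
  have hσlam2 : σ ^ 2 = lam ^ 2 * ω (1 / σ) := by
    rw [← Real.sq_sqrt hωσ.le, ← mul_pow, ← hσlam]
  -- The at most linear decay of ω gives 1/ω(1/σ) ≤ 2σ/ω(1). Recovering the true energy from the
  -- approximate one thus costs a multiple of σ, hence of φ; this is the source of the factor φ in
  -- the estimate.
  have hωσ1 : ω 1 ≤ 2 * σ * ω (1 / σ) := by
    have h2 := hω.mul_le hσ0.le hε.le
    rw [mul_one_div_cancel hσ0.ne'] at h2
    exact h2.trans (by gcongr; linarith)
  -- The shift by ω(1/σ) bounds e from below where c may vanish, and is of the same order as the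
  -- averaging error. Since λ√ω(1/σ) = σ, both growth terms are multiples of σ.
  set e : ℝ → ℝ := fun t => forwardMean c (1 / σ) t + ω (1 / σ) with he
  have hm0 : ∀ t, 0 ≤ forwardMean c (1 / σ) t := le_forwardMean hcc hε hc.lower
  have heω : ∀ t, ω (1 / σ) ≤ e t := fun t => by linarith [hm0 t]
  have heB : ∀ t, e t ≤ B + ω 1 := fun t => by
    have := forwardMean_le hcc hε hc.upper t
    simp only [he]
    linarith
  have hclose : ∀ t, |e t - c t| ≤ (L + 1) * ω (1 / σ) := fun t => by
    have h1 : |forwardMean c (1 / σ) t - c t| ≤ L * ω (1 / σ) :=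
      abs_forwardMean_sub_le hcc hε fun s hs => (hc.modulus s t).trans (by
        gcongr
        exact hω.mono (abs_nonneg _) (by
          rw [abs_of_nonneg (by linarith [hs.1])]; linarith [hs.2]))
    have h2 : e t - c t = (forwardMean c (1 / σ) t - c t) + ω (1 / σ) := by simp only [he]; ring
    rw [h2]
    refine (abs_add_le _ _).trans ?_
    rw [abs_of_pos hωσ]
    linarith
  have key := h.approx_energy_le hlam0.le (e := e)
    (e' := fun t => (1 / σ)⁻¹ * (c (t + 1 / σ) - c t))
    (k₁ := (L + 1) * σ) (k₂ := L * σ)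
    (k := ((2 * L + 1) * |Λ|) * φ lam)
    (fun t => hωσ.trans_le (heω t)) (fun t => (hasDerivAt_forwardMean hcc _ t).add_const _)
    (fun t => by
      have hsq : √(ω (1 / σ)) ≤ √(e t) := Real.sqrt_le_sqrt (heω t)
      calc lam * |e t - c t| ≤ lam * ((L + 1) * ω (1 / σ)) := by gcongr; exact hclose t
        _ = (L + 1) * (lam * √(ω (1 / σ))) * √(ω (1 / σ)) := by
            nth_rw 1 [← Real.mul_self_sqrt hωσ.le]; ring
        _ = (L + 1) * σ * √(ω (1 / σ)) := by rw [← hσlam]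
        _ ≤ _ := by gcongr)
    (fun t => by
      rw [abs_mul, one_div, inv_inv, abs_of_pos hσ0, ← one_div]
      have h3 := hc.modulus (t + 1 / σ) t
      rw [add_sub_cancel_left, abs_of_pos hε] at h3
      calc σ * |c (t + 1 / σ) - c t| ≤ σ * (L * ω (1 / σ)) := by gcongr
        _ = L * σ * ω (1 / σ) := by ring
        _ ≤ _ := by gcongr; exact heω t)
    (by nlinarith [mul_le_mul_of_nonneg_left hσφ (by linarith : 0 ≤ 2 * L + 1)]) t ht
  set X := Real.exp (((2 * L + 1) * |Λ|) * φ lam * t)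
  have hX0 : 0 < X := Real.exp_pos _
  have hlow : freqEnergy lam (z t) ≤
      ((1 + 4 * |Λ| / ω 1) * φ lam) * ((z t).2 ^ 2 + e t * lam ^ 2 * (z t).1 ^ 2) := by
    have h4 : (1 + lam ^ 2) * (z t).1 ^ 2 ≤
        (4 * |Λ| / ω 1 * φ lam) * (e t * lam ^ 2 * (z t).1 ^ 2) := by
      calc (1 + lam ^ 2) * (z t).1 ^ 2 ≤ (2 * lam ^ 2) * (z t).1 ^ 2 := by gcongr; nlinarith
        _ = 2 / ω 1 * (ω 1 * lam ^ 2 * (z t).1 ^ 2) := by field_simp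
        _ ≤ 2 / ω 1 * ((2 * σ * ω (1 / σ)) * lam ^ 2 * (z t).1 ^ 2) := by gcongr
        _ = (4 * σ / ω 1) * (ω (1 / σ) * lam ^ 2 * (z t).1 ^ 2) := by ring
        _ ≤ (4 * (|Λ| * φ lam) / ω 1) * (e t * lam ^ 2 * (z t).1 ^ 2) := by
            gcongr; exact heω t
        _ = _ := by ring
    have h6 : 0 ≤ e t * lam ^ 2 * (z t).1 ^ 2 := by
      have := hωσ.le.trans (heω t); positivity
    have h5 : 0 ≤ 4 * |Λ| / ω 1 * φ lam * (z t).2 ^ 2 := by positivity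
    unfold freqEnergy
    nlinarith [sq_nonneg (z t).2]
  have hinit : (z 0).2 ^ 2 + e 0 * lam ^ 2 * (z 0).1 ^ 2 ≤
      (1 + (B + ω 1)) * freqEnergy lam (z 0) := by
    have h0B : 0 ≤ B + ω 1 := by positivity
    unfold freqEnergy
    have h7 : e 0 * lam ^ 2 * (z 0).1 ^ 2 ≤ (1 + (B + ω 1)) * ((1 + lam ^ 2) * (z 0).1 ^ 2) := by
      rw [← mul_assoc]
      gcongr
      · linarith [heB 0]
      · linarith
    nlinarith [mul_nonneg h0B (sq_nonneg (z 0).2)]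
  have h0E := freqEnergy_nonneg lam (z 0)
  calc freqEnergy lam (z t) ≤
        ((1 + 4 * |Λ| / ω 1) * φ lam) * ((1 + (B + ω 1)) * freqEnergy lam (z 0) * X) := by
        refine hlow.trans ?_
        gcongr
        exact key.trans (by gcongr)
    _ = _ := by ring

-- This is the intermediate value theorem on [1, S] with S = max 1 (λ√ω(1)): as ω(1/S) ≤ ω(1), the
-- quotient at S is at least λ.
omit hφ in
lemma exists_sigma (hω0 : ∀ x, 0 < x → 0 < ω x) {lam : ℝ} (hlam : 1 / √(ω 1) ≤ lam) :
    ∃ σ, 1 ≤ σ ∧ σ / √(ω (1 / σ)) = lam := by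
  have hω1 := hω0 1 one_pos
  have hs1 : 0 < √(ω 1) := Real.sqrt_pos.2 hω1
  set S := max 1 (lam * √(ω 1))
  have hcont : ContinuousOn (fun σ : ℝ => σ / √(ω (1 / σ))) (Icc 1 S) := by
    have h1 : ContinuousOn (fun σ : ℝ => ω (1 / σ)) (Icc 1 S) := by
      refine hω.continuousOn.comp ?_ fun σ hσ => ?_
      · exact continuousOn_const.div continuousOn_id fun σ hσ => by
          have := hσ.1
          exact (by linarith : (0 : ℝ) < σ).ne'
      · have : (0 : ℝ) ≤ σ := by linarith [hσ.1]
        exact mem_Ici.2 (by positivity)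
    refine continuousOn_id.div h1.sqrt fun σ hσ => ?_
    have : (0 : ℝ) < σ := by linarith [hσ.1]
    exact (Real.sqrt_pos.2 (hω0 _ (by positivity))).ne'
  have hmem : lam ∈ Icc (1 / √(ω (1 / 1))) (S / √(ω (1 / S))) := by
    refine ⟨by simpa using hlam, ?_⟩
    have hS1 : 1 ≤ S := le_max_left _ _
    have hS0 : 0 < S := by linarith
    have h2 : √(ω (1 / S)) ≤ √(ω 1) :=
      Real.sqrt_le_sqrt (hω.mono (by positivity) (by rw [div_le_one hS0]; exact hS1))
    rw [le_div_iff₀ (Real.sqrt_pos.2 (hω0 _ (by positivity)))]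
    have hlam0 : 0 ≤ lam := le_trans (by positivity) hlam
    calc lam * √(ω (1 / S)) ≤ lam * √(ω 1) := by gcongr
      _ ≤ S := le_max_right _ _
  obtain ⟨σ, hσ, h⟩ := intermediate_value_Icc (le_max_left _ _) hcont hmem
  exact ⟨σ, hσ.1, h⟩

-- If ω vanished at x it would vanish on [0, x]. For every σ ≥ 1/x the quotient σ/√ω(1/σ) would then
-- be a division by zero, with value 0, and the condition would read σ ≤ Λ φ(0), which fails for
-- large σ.
omit hφ in
lemma modulus_pos_of_weak (hcomp : ∀ σ : ℝ, 0 < σ → σ ≤ Λ * φ (σ / √(ω (1 / σ)))) :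
    ∀ x, 0 < x → 0 < ω x := by
  intro x hx
  by_contra hneg
  have hx0 : ω x = 0 := le_antisymm (not_lt.1 hneg) (hω.nonneg hx.le)
  set σ := max (1 / x) (Λ * φ 0 + 1)
  have hσ0 : 0 < σ := lt_of_lt_of_le (by positivity) (le_max_left _ _)
  have h1 : ω (1 / σ) = 0 := by
    refine le_antisymm ?_ (hω.nonneg (by positivity))
    rw [← hx0]
    refine hω.mono (by positivity) ?_
    rw [one_div_le hσ0 hx]
    exact le_max_left _ _
  have h2 := hcomp σ hσ0
  rw [h1, Real.sqrt_zero, div_zero] at h2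
  have h3 : Λ * φ 0 + 1 ≤ σ := le_max_right _ _
  linarith

/-- The energy estimate for the linear problem. The constant `C` does not depend on the
`ω`-continuity constant `L` of the coefficient. -/
theorem energy_estimate (hcomp : CompatibleBound ω φ Λ ν) (hB : 0 ≤ B) :
    ∃ C : ℝ, 1 ≤ C ∧ ∀ L : ℝ, 0 ≤ L → ∃ κ : ℝ, 0 ≤ κ ∧ ∀ c : ℝ → ℝ, CoeffClass ω ν B L c →
      ∀ lam : ℝ, 0 ≤ lam → ∀ z : ℝ → ℝ × ℝ, IsOscillator (fun s => c s * lam ^ 2) z →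
        ∀ t ∈ Icc (0 : ℝ) 1, freqEnergy lam (z t) ≤
          C * φ lam * Real.exp (κ * φ lam * t) * freqEnergy lam (z 0) := by
  -- For bounded frequencies the crude rate (1 + λ²)(1 + B) is itself bounded, and φ ≥ 1 lets κφ
  -- dominate it. The averaging argument is needed only above λ₀.
  have hlowfreq : ∀ lam₀ : ℝ, 0 ≤ lam₀ → ∀ (C κ L : ℝ), 1 ≤ C → (1 + lam₀ ^ 2) * (1 + B) ≤ κ →
      ∀ c : ℝ → ℝ, CoeffClass ω ν B L c → ∀ lam : ℝ, 0 ≤ lam → lam ≤ lam₀ →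
        ∀ z : ℝ → ℝ × ℝ, IsOscillator (fun s => c s * lam ^ 2) z →
        ∀ t ∈ Icc (0 : ℝ) 1, freqEnergy lam (z t) ≤
          C * φ lam * Real.exp (κ * φ lam * t) * freqEnergy lam (z 0) := by
    intro lam₀ hlam₀ C κ L hC hκ c hc lam hlam hle z hz t ht
    have h1 := hz.low_energy_le (fun t => hcomp.nonneg.trans (hc.lower t)) hc.upper t ht
    have hφ1 := hφ lam hlam
    have h0 := freqEnergy_nonneg lam (z 0)
    have hκ0 : 0 ≤ κ := le_trans (by positivity) hκ
    have h2 : (1 + lam ^ 2) * (1 + B) ≤ κ * φ lam :=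
      calc (1 + lam ^ 2) * (1 + B) ≤ (1 + lam₀ ^ 2) * (1 + B) := by gcongr
        _ ≤ κ * 1 := by linarith
        _ ≤ κ * φ lam := by gcongr
    calc freqEnergy lam (z t) ≤ freqEnergy lam (z 0) * Real.exp ((1 + lam ^ 2) * (1 + B) * t) := h1
      _ ≤ freqEnergy lam (z 0) * Real.exp (κ * φ lam * t) := by
          gcongr; exact ht.1
      _ = (1 * 1) * Real.exp (κ * φ lam * t) * freqEnergy lam (z 0) := by ring
      _ ≤ (C * φ lam) * Real.exp (κ * φ lam * t) * freqEnergy lam (z 0) := by gcongr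
  rcases hcomp with ⟨hν, hcomp⟩ | ⟨rfl, hcomp⟩
  · have hC : 1 ≤ (1 + 2 / ν) * (1 + B) :=
      one_le_mul_of_one_le_of_one_le (by linarith [div_nonneg zero_le_two hν.le]) (by linarith)
    refine ⟨(1 + 2 / ν) * (1 + B), hC, fun L hL =>
      ⟨max ((1 + 1 ^ 2) * (1 + B)) (L * |Λ| * (1 / √ν + 1 / ν)),
        le_max_of_le_left (by positivity), fun c hc lam hlam z hz t ht => ?_⟩⟩
    rcases le_total lam 1 with hle | hle
    · exact hlowfreq 1 zero_le_one _ _ L hC (le_max_left _ _) c hc lam hlam hle z hz t ht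
    · refine (high_energy_le_strict hω hφ hν hcomp hL hc hle hz ht).trans ?_
      have hφ1 := hφ lam hlam
      have := freqEnergy_nonneg lam (z 0)
      gcongr
      · exact ht.1
      · exact le_max_right _ _
  · have hω0 := modulus_pos_of_weak hω hcomp
    have hω1 := hω0 1 one_pos
    have hC : 1 ≤ (1 + 4 * |Λ| / ω 1) * (1 + (B + ω 1)) :=
      one_le_mul_of_one_le_of_one_le (by
        have : 0 ≤ 4 * |Λ| / ω 1 := by positivity
        linarith) (by linarith)
    have hM0 : (0 : ℝ) ≤ max 1 (1 / √(ω 1)) := le_max_of_le_left zero_le_one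
    refine ⟨(1 + 4 * |Λ| / ω 1) * (1 + (B + ω 1)), hC, fun L hL =>
      ⟨max ((1 + (max 1 (1 / √(ω 1))) ^ 2) * (1 + B)) ((2 * L + 1) * |Λ|),
        le_max_of_le_left (by positivity), fun c hc lam hlam z hz t ht => ?_⟩⟩
    rcases le_total lam (max 1 (1 / √(ω 1))) with hle | hle
    · exact hlowfreq _ hM0 _ _ L hC (le_max_left _ _) c hc lam hlam hle z hz t ht
    · obtain ⟨σ, hσ, hσlam⟩ := exists_sigma hω hω0 ((le_max_right _ _).trans hle)
      refine (high_energy_le_weak hω hφ hcomp hω0 hL hc hσ hσlam ((le_max_left _ _).trans hle)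
        hz ht).trans ?_
      have hφ1 := hφ lam hlam
      have := freqEnergy_nonneg lam (z 0)
      gcongr
      · exact ht.1
      · exact le_max_right _ _

end Estimate

/-! ### Weighted `L²` norms -/

section Weights

/-- The weight of the space `G_{φ,r,α}(A)` at the frequency `lam`. -/
noncomputable def gevreyWeight (φ : ℝ → ℝ) (r α lam : ℝ) : ℝ :=
  1 + lam ^ (4 * α) * Real.exp (r * φ lam)

lemma one_le_gevreyWeight (φ : ℝ → ℝ) (r α : ℝ) {lam : ℝ} (hlam : 0 ≤ lam) :
    1 ≤ gevreyWeight φ r α lam := by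
  have : 0 ≤ lam ^ (4 * α) * Real.exp (r * φ lam) := by positivity
  unfold gevreyWeight; linarith

lemma rpow_add_two {lam a : ℝ} (hlam : 0 ≤ lam) (ha : 0 < a) :
    lam ^ (a + 2) = lam ^ a * lam ^ 2 := by
  rw [Real.rpow_add' hlam (by linarith)]
  norm_cast

lemma gevreyWeight_add_half_le (φ : ℝ → ℝ) (r : ℝ) {α lam : ℝ} (hα : 0 < α) (hlam : 0 ≤ lam) :
    gevreyWeight φ r (α + 1 / 2) lam ≤ gevreyWeight φ r α lam * (1 + lam ^ 2) := by
  unfold gevreyWeight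
  rw [show 4 * (α + 1 / 2) = 4 * α + 2 by ring, rpow_add_two hlam (by linarith)]
  have h1 : 0 ≤ lam ^ (4 * α) * Real.exp (r * φ lam) := by positivity
  nlinarith [sq_nonneg lam]

/-- Used to trade a factor φ for an arbitrarily small loss of Gevrey radius. -/
lemma le_exp_div {a x : ℝ} (ha : 0 < a) : x ≤ Real.exp (a * x) / a := by
  rw [le_div_iff₀ ha]
  linarith [Real.add_one_le_exp (a * x)]

variable {φ : ℝ → ℝ} (hφ : ∀ σ : ℝ, 0 ≤ σ → 1 ≤ φ σ)
  (hφ_bdd : ∃ δ : ℝ, 0 < δ ∧ ∃ C : ℝ, ∀ σ ∈ Icc 0 δ, φ σ ≤ C)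
include hφ hφ_bdd

/-- Away from zero, λ^{4α} is at most δ⁻²λ^{4α+2}; near zero this fails, and the left side is
bounded only because φ is bounded there. The lemma serves to control the energy of the data by their
Gevrey norms. -/
lemma exists_weight_le_add_half {r α : ℝ} (hr : 0 ≤ r) (hα : 0 < α) :
    ∃ C : ℝ, 1 ≤ C ∧ ∀ lam, 0 ≤ lam →
      gevreyWeight φ r α lam * (1 + lam ^ 2) ≤ C * gevreyWeight φ r (α + 1 / 2) lam := by
  obtain ⟨δ, hδ, C, hC⟩ := hφ_bdd
  have hC1 : 1 ≤ C := (hφ 0 le_rfl).trans (hC 0 ⟨le_rfl, hδ.le⟩)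
  have hA : 0 ≤ (1 + δ ^ (4 * α) * Real.exp (r * C)) * (1 + δ ^ 2) := by positivity
  have hB : 0 ≤ 2 * (1 + 1 / δ ^ 2) + 1 := by positivity
  refine ⟨1 + (1 + δ ^ (4 * α) * Real.exp (r * C)) * (1 + δ ^ 2) + (2 * (1 + 1 / δ ^ 2) + 1),
    by linarith, fun lam hlam => ?_⟩
  have hW := one_le_gevreyWeight φ r (α + 1 / 2) hlam
  rcases le_total lam δ with hle | hle
  · have h1 : gevreyWeight φ r α lam * (1 + lam ^ 2) ≤
        (1 + δ ^ (4 * α) * Real.exp (r * C)) * (1 + δ ^ 2) := by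
      unfold gevreyWeight
      gcongr
      exact hC lam ⟨hlam, hle⟩
    nlinarith
  · have h1 : gevreyWeight φ r α lam * (1 + lam ^ 2) ≤
        (2 * (1 + 1 / δ ^ 2) + 1) * gevreyWeight φ r (α + 1 / 2) lam := by
      unfold gevreyWeight
      rw [show 4 * (α + 1 / 2) = 4 * α + 2 by ring, rpow_add_two hlam (by linarith)]
      have hX1 : 1 ≤ Real.exp (r * φ lam) := Real.one_le_exp (by
        have := hφ lam hlam; positivity)
      set X := Real.exp (r * φ lam)
      have hp : 0 ≤ lam ^ (4 * α) := by positivity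
      have h2 : 1 ≤ 1 / δ ^ 2 * lam ^ 2 := by
        rw [one_div_mul_eq_div, le_div_iff₀ (by positivity)]; nlinarith
      have h3 : lam ^ (4 * α) * X ≤ 1 / δ ^ 2 * (lam ^ (4 * α) * lam ^ 2 * X) := by
        nlinarith [mul_le_mul_of_nonneg_left h2 (by positivity : 0 ≤ lam ^ (4 * α) * X)]
      have h4 : lam ^ 2 ≤ 1 + lam ^ (4 * α) * lam ^ 2 * X := by
        rcases le_total lam 1 with h | h
        · have : lam ^ 2 ≤ 1 := by nlinarith
          have : 0 ≤ lam ^ (4 * α) * lam ^ 2 * X := by positivity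
          linarith
        · have h5 : 1 ≤ lam ^ (4 * α) := Real.one_le_rpow h (by linarith)
          have h6 : 1 ≤ lam ^ (4 * α) * X := one_le_mul_of_one_le_of_one_le h5 hX1
          nlinarith [mul_le_mul_of_nonneg_right h6 (sq_nonneg lam)]
      set Z := lam ^ (4 * α) * lam ^ 2 * X
      have hZ : 0 ≤ Z := by positivity
      have hδ2 : 0 ≤ 1 / δ ^ 2 := by positivity
      have e1 : (1 + lam ^ (4 * α) * X) * (1 + lam ^ 2) = 1 + lam ^ 2 + lam ^ (4 * α) * X + Z := by
        simp only [Z]; ring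
      rw [e1]
      nlinarith [mul_nonneg hδ2 hZ]
    nlinarith

/-- The radius given up, Rτ ≥ (κ + 1)τ, pays for exp(κφt) with κτ and for the factor φ with the
remaining τ, through φ ≤ exp(τφ)/τ. The constant depends on τ, which is why the scale asks for τ >
0. The summand 1 of the weight carries no exponential: above δ it is dominated by λ^{4α}, below δ
one uses that φ is bounded. -/
lemma exists_weight_loss {r₀ α κ R τ : ℝ} (hα : 0 < α) (hκ : 0 ≤ κ)
    (hR : κ + 1 ≤ R) (hτ : 0 < τ) (hRτ : R * τ ≤ r₀) :
    ∃ C : ℝ, 0 ≤ C ∧ ∀ t ∈ Icc 0 τ, ∀ lam, 0 ≤ lam →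
      gevreyWeight φ (r₀ - R * τ) α lam * (φ lam * Real.exp (κ * φ lam * t)) ≤
        C * gevreyWeight φ r₀ α lam := by
  obtain ⟨δ, hδ, C, hC⟩ := hφ_bdd
  have hC1 : 1 ≤ C := (hφ 0 le_rfl).trans (hC 0 ⟨le_rfl, hδ.le⟩)
  have hA : 0 ≤ C * Real.exp (κ * C * τ) := by positivity
  have hB : 0 ≤ (1 / δ ^ (4 * α) + 1) / τ := by positivity
  refine ⟨C * Real.exp (κ * C * τ) + (1 / δ ^ (4 * α) + 1) / τ, by positivity,
    fun t ht lam hlam => ?_⟩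
  have hW := one_le_gevreyWeight φ r₀ α hlam
  have hφ1 := hφ lam hlam
  have hR0 : 0 ≤ R := by linarith
  rcases le_total lam δ with hle | hle
  · have hφC := hC lam ⟨hlam, hle⟩
    have h1 : gevreyWeight φ (r₀ - R * τ) α lam ≤ gevreyWeight φ r₀ α lam := by
      unfold gevreyWeight
      gcongr
      nlinarith [mul_nonneg hR0 hτ.le]
    have h0 := one_le_gevreyWeight φ (r₀ - R * τ) α hlam
    have h2 : gevreyWeight φ (r₀ - R * τ) α lam * (φ lam * Real.exp (κ * φ lam * t)) ≤
        gevreyWeight φ r₀ α lam * (C * Real.exp (κ * C * τ)) := by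
      have := ht.1
      have := ht.2
      gcongr
    nlinarith
  · have hE : φ lam * Real.exp (κ * φ lam * t) ≤ Real.exp (R * τ * φ lam) / τ := by
      calc φ lam * Real.exp (κ * φ lam * t)
          ≤ (Real.exp (τ * φ lam) / τ) * Real.exp (κ * φ lam * τ) := by
            have := ht.2
            gcongr
            exact le_exp_div hτ
        _ = Real.exp ((κ + 1) * τ * φ lam) / τ := by
            rw [div_mul_eq_mul_div, ← Real.exp_add]; ring_nf
        _ ≤ _ := by gcongr
    have hp : 0 < δ ^ (4 * α) := by positivity
    have hpl : δ ^ (4 * α) ≤ lam ^ (4 * α) := Real.rpow_le_rpow hδ.le hle (by linarith)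
    have h2 : 1 ≤ 1 / δ ^ (4 * α) * lam ^ (4 * α) := by
      rw [one_div_mul_eq_div, le_div_iff₀ hp]; linarith
    have h3 : gevreyWeight φ (r₀ - R * τ) α lam * (φ lam * Real.exp (κ * φ lam * t)) ≤
        (1 / δ ^ (4 * α) + 1) / τ * gevreyWeight φ r₀ α lam := by
      have h0 := one_le_gevreyWeight φ (r₀ - R * τ) α hlam
      calc _ ≤ gevreyWeight φ (r₀ - R * τ) α lam * (Real.exp (R * τ * φ lam) / τ) := by gcongr
        _ = (Real.exp (R * τ * φ lam) +
              lam ^ (4 * α) * (Real.exp ((r₀ - R * τ) * φ lam) * Real.exp (R * τ * φ lam))) / τ := by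
            unfold gevreyWeight; ring
        _ = (Real.exp (R * τ * φ lam) + lam ^ (4 * α) * Real.exp (r₀ * φ lam)) / τ := by
            rw [← Real.exp_add]; ring_nf
        _ ≤ (1 / δ ^ (4 * α) * lam ^ (4 * α) * Real.exp (r₀ * φ lam) +
              lam ^ (4 * α) * Real.exp (r₀ * φ lam)) / τ := by
            gcongr
            calc Real.exp (R * τ * φ lam) ≤ 1 * Real.exp (r₀ * φ lam) := by
                  rw [one_mul]; gcongr
              _ ≤ _ := by gcongr
        _ = (1 / δ ^ (4 * α) + 1) / τ * (lam ^ (4 * α) * Real.exp (r₀ * φ lam)) := by ring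
        _ ≤ _ := by
            gcongr
            unfold gevreyWeight
            linarith
    nlinarith

/-- The phase energy needs only the weight λ, so half of the radius is left for the growth exp(κφt)
and half absorbs the factor φ. Unlike in `exists_weight_loss`, the constant involves neither κ nor a
time, so K can be chosen before κ and T. The condition α ≥ 1/4 gives λ ≤ δ^{1-4α}λ^{4α} on λ ≥ δ. -/
lemma exists_phase_weight {r₀ α : ℝ} (hr₀ : 0 < r₀) (hα : 1 / 4 ≤ α) :
    ∃ C : ℝ, 0 ≤ C ∧ ∀ lam, 0 ≤ lam →
      lam * (φ lam * Real.exp (r₀ / 2 * φ lam)) ≤ C * gevreyWeight φ r₀ α lam := by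
  obtain ⟨δ, hδ, C, hC⟩ := hφ_bdd
  have hC1 : 1 ≤ C := (hφ 0 le_rfl).trans (hC 0 ⟨le_rfl, hδ.le⟩)
  have hA : 0 ≤ δ * (C * Real.exp (r₀ / 2 * C)) := by positivity
  have hB : 0 ≤ δ ^ (1 - 4 * α) * (2 / r₀) := by positivity
  refine ⟨δ * (C * Real.exp (r₀ / 2 * C)) + δ ^ (1 - 4 * α) * (2 / r₀), by positivity,
    fun lam hlam => ?_⟩
  have hW := one_le_gevreyWeight φ r₀ α hlam
  have hφ1 := hφ lam hlam
  rcases le_total lam δ with hle | hle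
  · have hφC := hC lam ⟨hlam, hle⟩
    have h1 : lam * (φ lam * Real.exp (r₀ / 2 * φ lam)) ≤ δ * (C * Real.exp (r₀ / 2 * C)) := by
      gcongr
    nlinarith
  · have hlam0 : 0 < lam := hδ.trans_le hle
    have h1 : lam ≤ δ ^ (1 - 4 * α) * lam ^ (4 * α) := by
      calc lam = lam ^ (1 - 4 * α) * lam ^ (4 * α) := by
            rw [← Real.rpow_add hlam0, sub_add_cancel, Real.rpow_one]
        _ ≤ _ := by
            gcongr ?_ * _
            exact Real.rpow_le_rpow_of_nonpos hδ hle (by linarith)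
    have h2 : φ lam * Real.exp (r₀ / 2 * φ lam) ≤ 2 / r₀ * Real.exp (r₀ * φ lam) := by
      calc φ lam * Real.exp (r₀ / 2 * φ lam)
          ≤ (Real.exp (r₀ / 2 * φ lam) / (r₀ / 2)) * Real.exp (r₀ / 2 * φ lam) := by
            gcongr; exact le_exp_div (by positivity)
        _ = 2 / r₀ * (Real.exp (r₀ / 2 * φ lam) * Real.exp (r₀ / 2 * φ lam)) := by
            field_simp
        _ = _ := by rw [← Real.exp_add]; ring_nf
    have h3 : lam * (φ lam * Real.exp (r₀ / 2 * φ lam)) ≤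
        δ ^ (1 - 4 * α) * (2 / r₀) * gevreyWeight φ r₀ α lam := by
      calc _ ≤ (δ ^ (1 - 4 * α) * lam ^ (4 * α)) * (2 / r₀ * Real.exp (r₀ * φ lam)) := by gcongr
        _ = δ ^ (1 - 4 * α) * (2 / r₀) * (lam ^ (4 * α) * Real.exp (r₀ * φ lam)) := by ring
        _ ≤ _ := by
            gcongr
            unfold gevreyWeight
            linarith
    nlinarith

end Weights

section PhaseWeights

lemma lam_le_gevreyWeight {φ : ℝ → ℝ} {r α lam : ℝ} (hr : 0 ≤ r) (hα : 1 / 4 ≤ α) (hlam : 0 ≤ lam)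
    (hφ : 0 ≤ φ lam) : lam ≤ gevreyWeight φ r α lam := by
  unfold gevreyWeight
  have hX : 1 ≤ Real.exp (r * φ lam) := Real.one_le_exp (by positivity)
  have h0 : 0 ≤ lam ^ (4 * α) := by positivity
  rcases le_total lam 1 with h | h
  · have : 0 ≤ lam ^ (4 * α) * Real.exp (r * φ lam) := by positivity
    linarith
  · have : lam ^ (1 : ℝ) ≤ lam ^ (4 * α) := Real.rpow_le_rpow_of_exponent_le h (by linarith)
    rw [Real.rpow_one] at this
    nlinarith

lemma lam_cube_le_gevreyWeight {φ : ℝ → ℝ} {r α lam : ℝ} (hr : 0 ≤ r) (hα : 1 / 4 ≤ α)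
    (hlam : 0 ≤ lam) (hφ : 0 ≤ φ lam) : lam ^ 3 ≤ gevreyWeight φ r (α + 1 / 2) lam := by
  unfold gevreyWeight
  have hX : 1 ≤ Real.exp (r * φ lam) := Real.one_le_exp (by positivity)
  have h0 : 0 ≤ lam ^ (4 * (α + 1 / 2)) := by positivity
  rcases le_total lam 1 with h | h
  · have : 0 ≤ lam ^ (4 * (α + 1 / 2)) * Real.exp (r * φ lam) := by positivity
    have : lam ^ 3 ≤ 1 := pow_le_one₀ hlam h
    linarith
  · have : lam ^ (3 : ℝ) ≤ lam ^ (4 * (α + 1 / 2)) :=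
      Real.rpow_le_rpow_of_exponent_le h (by linarith)
    have h3 : lam ^ (3 : ℝ) = lam ^ 3 := by norm_cast
    rw [h3] at this
    nlinarith

end PhaseWeights

/-! ### Quadratic integrals and the spectral representation -/

/-- The integral of `w f²`. -/
noncomputable def wInt {M : Type*} [MeasurableSpace M] (μ : Measure M) (w f : M → ℝ) : ℝ≥0∞ :=
  ∫⁻ ξ, ENNReal.ofReal (w ξ * f ξ ^ 2) ∂μ

section WInt

variable {M : Type*} [MeasurableSpace M] {μ : Measure M}

lemma wInt_congr {w f g : M → ℝ} (h : f =ᵐ[μ] g) : wInt μ w f = wInt μ w g :=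
  lintegral_congr_ae (by filter_upwards [h] with ξ hξ; simp only [hξ])

lemma wInt_le {w w' f : M → ℝ} {C : ℝ} (h : ∀ ξ, w ξ ≤ C * w' ξ) (hC : 0 ≤ C) :
    wInt μ w f ≤ ENNReal.ofReal C * wInt μ w' f := by
  rw [wInt, wInt, ← lintegral_const_mul' _ _ ENNReal.ofReal_ne_top]
  refine lintegral_mono fun ξ => ?_
  rw [← ENNReal.ofReal_mul hC, ← mul_assoc]
  exact ENNReal.ofReal_le_ofReal (mul_le_mul_of_nonneg_right (h ξ) (sq_nonneg _))

lemma memLp_two_of_wInt {f : M → ℝ} (hf : AEStronglyMeasurable f μ)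
    (h : ∫⁻ ξ, ENNReal.ofReal (f ξ ^ 2) ∂μ < ∞) : MemLp f 2 μ := by
  rw [memLp_two_iff_integrable_sq hf]
  refine ⟨hf.pow 2, ?_⟩
  rw [hasFiniteIntegral_iff_ofReal (Eventually.of_forall fun ξ => sq_nonneg (f ξ))]
  exact h

end WInt

section Spectral

variable {H : Type*} [NormedAddCommGroup H] [InnerProductSpace ℝ H] {A : H →ₗ.[ℝ] H}
  {M : Type*} [MeasurableSpace M] {μ : Measure M} (S : SpectralRep A μ)

lemma aestronglyMeasurable_U (u : H) : AEStronglyMeasurable (S.U u) μ :=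
  Lp.aestronglyMeasurable _

lemma U_sub_ae (u v : H) : S.U (u - v) =ᵐ[μ] fun ξ => S.U u ξ - S.U v ξ := by
  rw [map_sub]
  exact Lp.coeFn_sub _ _

lemma U_smul_ae (a : ℝ) (u : H) : S.U (a • u) =ᵐ[μ] fun ξ => a * S.U u ξ := by
  rw [map_smul]
  exact Lp.coeFn_smul _ _

lemma inner_eq_integral (u v : H) : inner ℝ u v = ∫ ξ, S.U u ξ * S.U v ξ ∂μ := by
  rw [← S.U.inner_map_map, L2.inner_def]
  refine integral_congr_ae (Eventually.of_forall fun ξ => ?_)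
  simp [mul_comm]

lemma enorm_sq_eq (u : H) : ‖u‖ₑ ^ 2 = ∫⁻ ξ, ENNReal.ofReal (S.U u ξ ^ 2) ∂μ := by
  have h1 : ‖u‖ₑ ^ 2 = ENNReal.ofReal (‖u‖ ^ 2) := by
    rw [← ofReal_norm, ENNReal.ofReal_pow (norm_nonneg _)]
  rw [h1, ← real_inner_self_eq_norm_sq, inner_eq_integral S,
    ofReal_integral_eq_lintegral_ofReal]
  · simp only [sq]
  · simpa only [sq] using (Lp.memLp (S.U u)).integrable_sq
  · exact Eventually.of_forall fun ξ => mul_self_nonneg _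

lemma gevreySq_eq (φ : ℝ → ℝ) (r α : ℝ) (u : H) : gevreySq S φ r α u =
    wInt μ (fun ξ => S.lam ξ ^ (4 * α) * Real.exp (r * φ (S.lam ξ))) (S.U u) :=
  lintegral_congr fun ξ => by congr 1; ring

lemma enorm_sq_add_gevreySq (φ : ℝ → ℝ) (r α : ℝ) (u : H) :
    ‖u‖ₑ ^ 2 + gevreySq S φ r α u =
      wInt μ (fun ξ => gevreyWeight φ r α (S.lam ξ)) (S.U u) := by
  rw [enorm_sq_eq S, gevreySq_eq, wInt, wInt, ← lintegral_add_left']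
  · refine lintegral_congr fun ξ => ?_
    rw [← ENNReal.ofReal_add (sq_nonneg _)
      (by have := S.lam_nonneg ξ; positivity), gevreyWeight]
    congr 1; ring
  · exact ((aestronglyMeasurable_U S u).aemeasurable.pow_const 2).ennreal_ofReal

lemma gevreyNorm_eq (φ : ℝ → ℝ) (r α : ℝ) (u : H) : gevreyNorm S φ r α u =
    wInt μ (fun ξ => gevreyWeight φ r α (S.lam ξ)) (S.U u) ^ (1 / 2 : ℝ) := by
  rw [gevreyNorm, enorm_sq_add_gevreySq]

lemma memGevrey_iff {φ : ℝ → ℝ} {r α : ℝ} {u : H} : MemGevrey S φ r α u ↔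
    wInt μ (fun ξ => gevreyWeight φ r α (S.lam ξ)) (S.U u) < ∞ := by
  rw [← enorm_sq_add_gevreySq, ENNReal.add_lt_top, MemGevrey]
  exact ⟨fun h => ⟨ENNReal.pow_lt_top enorm_lt_top, h⟩, fun h => h.2⟩

lemma tendsto_rpow_half_iff {ι : Type*} {l : Filter ι} {f : ι → ℝ≥0∞} :
    Tendsto (fun i => f i ^ (1 / 2 : ℝ)) l (𝓝 0) ↔ Tendsto f l (𝓝 0) := by
  constructor
  · intro h
    have := (ENNReal.continuous_rpow_const (y := 2)).tendsto 0 |>.comp h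
    simp only [Function.comp_def, ← ENNReal.rpow_mul] at this
    simpa using this
  · intro h
    have := (ENNReal.continuous_rpow_const (y := (1 / 2 : ℝ))).tendsto 0 |>.comp h
    simpa [Function.comp_def] using this

lemma tendsto_gevreyNorm_iff {ι : Type*} {l : Filter ι} {φ : ℝ → ℝ} {r α : ℝ} {u : ι → H} :
    Tendsto (fun i => gevreyNorm S φ r α (u i)) l (𝓝 0) ↔
      Tendsto (fun i => wInt μ (fun ξ => gevreyWeight φ r α (S.lam ξ)) (S.U (u i))) l (𝓝 0) := by
  simp only [gevreyNorm_eq]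
  exact tendsto_rpow_half_iff

lemma enorm_le_gevreyNorm (φ : ℝ → ℝ) (r α : ℝ) (u : H) : ‖u‖ₑ ≤ gevreyNorm S φ r α u := by
  rw [gevreyNorm]
  calc ‖u‖ₑ = (‖u‖ₑ ^ 2) ^ (1 / 2 : ℝ) := by
        rw [← ENNReal.rpow_natCast, ← ENNReal.rpow_mul]; norm_num
    _ ≤ _ := ENNReal.rpow_le_rpow (le_self_add) (by norm_num)

lemma tendsto_of_gevreyNorm {ι : Type*} {l : Filter ι} {φ : ℝ → ℝ} {r α : ℝ} {u : ι → H} {v : H}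
    (h : Tendsto (fun i => gevreyNorm S φ r α (u i - v)) l (𝓝 0)) : Tendsto u l (𝓝 v) := by
  rw [tendsto_iff_edist_tendsto_0]
  refine tendsto_of_tendsto_of_tendsto_of_le_of_le tendsto_const_nhds h (fun _ => zero_le)
    fun i => ?_
  simp only [edist_eq_enorm_sub]
  exact enorm_le_gevreyNorm S φ r α _

/-- The element of `H` corresponding to the function `f` (`0` if `f` is not in `L²`). -/
noncomputable def lift (f : M → ℝ) : H := by
  classical
  exact if h : MemLp f 2 μ then S.U.symm (h.toLp f) else 0

variable {S} in
lemma U_lift {f : M → ℝ} (h : MemLp f 2 μ) : S.U (lift S f) =ᵐ[μ] f := by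
  rw [lift, dif_pos h, LinearIsometryEquiv.apply_symm_apply]
  exact h.coeFn_toLp

lemma eq_of_U_ae {u v : H} (h : S.U u =ᵐ[μ] S.U v) : u = v :=
  S.U.injective (Lp.ext h)

variable {S} in
lemma inner_lift {f g : M → ℝ} (hf : MemLp f 2 μ) (hg : MemLp g 2 μ) :
    inner ℝ (lift S f) (lift S g) = ∫ ξ, f ξ * g ξ ∂μ := by
  rw [inner_eq_integral S]
  refine integral_congr_ae ?_
  filter_upwards [U_lift (S := S) hf, U_lift (S := S) hg] with ξ h1 h2
  rw [h1, h2]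

variable {S} in
lemma enorm_lift_sq {f : M → ℝ} (hf : MemLp f 2 μ) :
    ‖lift S f‖ₑ ^ 2 = ∫⁻ ξ, ENNReal.ofReal (f ξ ^ 2) ∂μ := by
  rw [enorm_sq_eq S]
  refine lintegral_congr_ae ?_
  filter_upwards [U_lift (S := S) hf] with ξ h1
  rw [h1]

end Spectral

section Phase

variable {H : Type*} [NormedAddCommGroup H] [InnerProductSpace ℝ H] {A : H →ₗ.[ℝ] H}
  {M : Type*} [MeasurableSpace M] {μ : Measure M} (S : SpectralRep A μ)

/-! ### Fractional powers of `A` -/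

/-- The vector `A ^ β u`. -/
noncomputable def powLift (β : ℝ) (u : H) : H := lift S fun ξ => S.lam ξ ^ (2 * β) * S.U u ξ

lemma aestronglyMeasurable_pow_mul (β : ℝ) (u : H) :
    AEStronglyMeasurable (fun ξ => S.lam ξ ^ (2 * β) * S.U u ξ) μ :=
  ((S.measurable_lam.pow_const _).aestronglyMeasurable).mul (aestronglyMeasurable_U S u)

lemma sq_pow_mul (β : ℝ) (u : H) (ξ : M) :
    (S.lam ξ ^ (2 * β) * S.U u ξ) ^ 2 = S.lam ξ ^ (4 * β) * S.U u ξ ^ 2 := by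
  rw [mul_pow, ← Real.rpow_natCast (S.lam ξ ^ (2 * β)), ← Real.rpow_mul (S.lam_nonneg ξ)]
  congr 2
  push_cast
  ring

variable {S}

lemma memLp_pow_mul {β : ℝ} {u : H} (h : powNormSq S β u < ∞) :
    MemLp (fun ξ => S.lam ξ ^ (2 * β) * S.U u ξ) 2 μ := by
  refine memLp_two_of_wInt (aestronglyMeasurable_pow_mul S β u) ?_
  simp only [sq_pow_mul]
  exact h

lemma enorm_powLift_sq {β : ℝ} {u : H} (h : powNormSq S β u < ∞) :
    ‖powLift S β u‖ₑ ^ 2 = powNormSq S β u := by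
  rw [powLift, enorm_lift_sq (memLp_pow_mul h)]
  simp only [sq_pow_mul]
  rfl

lemma norm_powLift_sq {β : ℝ} {u : H} (h : powNormSq S β u < ∞) :
    ‖powLift S β u‖ ^ 2 = (powNormSq S β u).toReal := by
  rw [← enorm_powLift_sq h, ENNReal.toReal_pow, toReal_enorm]

lemma gevreySq_zero (φ : ℝ → ℝ) (β : ℝ) (u : H) : gevreySq S φ 0 β u = powNormSq S β u := by
  simp [gevreySq, powNormSq]

lemma memGevrey_zero {φ : ℝ → ℝ} {β : ℝ} {u : H} :
    MemGevrey S φ 0 β u ↔ powNormSq S β u < ∞ := by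
  rw [MemGevrey, gevreySq_zero]

lemma enorm_powLift_le {φ : ℝ → ℝ} {β : ℝ} {u : H} (h : powNormSq S β u < ∞) :
    ‖powLift S β u‖ₑ ≤ gevreyNorm S φ 0 β u := by
  rw [gevreyNorm, gevreySq_zero]
  calc ‖powLift S β u‖ₑ = (‖powLift S β u‖ₑ ^ 2) ^ (1 / 2 : ℝ) := by
        rw [← ENNReal.rpow_natCast, ← ENNReal.rpow_mul]; norm_num
    _ ≤ _ := ENNReal.rpow_le_rpow (by rw [enorm_powLift_sq h]; exact le_add_self) (by norm_num)

lemma powLift_sub {β : ℝ} {u v : H} (hu : powNormSq S β u < ∞) (hv : powNormSq S β v < ∞) :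
    powNormSq S β (u - v) < ∞ ∧ powLift S β (u - v) = powLift S β u - powLift S β v := by
  have h1 : (fun ξ => S.lam ξ ^ (2 * β) * S.U (u - v) ξ) =ᵐ[μ]
      fun ξ => S.lam ξ ^ (2 * β) * S.U u ξ - S.lam ξ ^ (2 * β) * S.U v ξ := by
    filter_upwards [U_sub_ae S u v] with ξ h
    rw [h, mul_sub]
  have hL : MemLp (fun ξ => S.lam ξ ^ (2 * β) * S.U (u - v) ξ) 2 μ :=
    (memLp_congr_ae h1).2 ((memLp_pow_mul hu).sub (memLp_pow_mul hv))
  refine ⟨?_, eq_of_U_ae S ?_⟩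
  · have := hL.integrable_sq.2
    rw [hasFiniteIntegral_iff_ofReal (Eventually.of_forall fun ξ => sq_nonneg _)] at this
    simp only [sq_pow_mul] at this
    exact this
  · filter_upwards [U_lift (S := S) hL, U_lift (S := S) (memLp_pow_mul hu),
      U_lift (S := S) (memLp_pow_mul hv), h1, U_sub_ae S (powLift S β u) (powLift S β v)]
      with ξ e1 e2 e3 e4 e5
    rw [e5, powLift, powLift, powLift, e1, e4, e2, e3]

lemma powLift_smul {β : ℝ} (a : ℝ) {u : H} (hu : powNormSq S β u < ∞) :
    powNormSq S β (a • u) < ∞ ∧ powLift S β (a • u) = a • powLift S β u := by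
  have h1 : (fun ξ => S.lam ξ ^ (2 * β) * S.U (a • u) ξ) =ᵐ[μ]
      fun ξ => a * (S.lam ξ ^ (2 * β) * S.U u ξ) := by
    filter_upwards [U_smul_ae S a u] with ξ h
    rw [h]; ring
  have hL : MemLp (fun ξ => S.lam ξ ^ (2 * β) * S.U (a • u) ξ) 2 μ :=
    (memLp_congr_ae h1).2 ((memLp_pow_mul hu).const_mul a)
  refine ⟨?_, eq_of_U_ae S ?_⟩
  · have := hL.integrable_sq.2
    rw [hasFiniteIntegral_iff_ofReal (Eventually.of_forall fun ξ => sq_nonneg _)] at this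
    simp only [sq_pow_mul] at this
    exact this
  · filter_upwards [U_lift (S := S) hL, U_lift (S := S) (memLp_pow_mul hu), h1,
      U_smul_ae S a (powLift S β u)] with ξ e1 e2 e4 e5
    rw [e5, powLift, powLift, e1, e4, e2]

/-- Since λ² = λ^{1/2}λ^{3/2}, the argument of the nonlinearity is an inner product of two vectors
that are continuous in time on the phase space. -/
lemma powNormSq_half {u : H} (h1 : powNormSq S (1 / 4) u < ∞) (h3 : powNormSq S (3 / 4) u < ∞) :
    powNormSq S (1 / 2) u < ∞ ∧
      (powNormSq S (1 / 2) u).toReal = inner ℝ (powLift S (1 / 4) u) (powLift S (3 / 4) u) := by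
  have hint := (memLp_pow_mul h1).integrable_mul (memLp_pow_mul h3)
  have he : ∀ ξ, S.lam ξ ^ (2 * (1 / 4 : ℝ)) * S.U u ξ * (S.lam ξ ^ (2 * (3 / 4 : ℝ)) * S.U u ξ) =
      S.lam ξ ^ (4 * (1 / 2 : ℝ)) * S.U u ξ ^ 2 := by
    intro ξ
    rw [show (4 * (1 / 2 : ℝ)) = 2 * (1 / 4) + 2 * (3 / 4) by norm_num,
      Real.rpow_add' (S.lam_nonneg ξ) (by norm_num)]
    ring
  have hint' : Integrable (fun ξ => S.lam ξ ^ (4 * (1 / 2 : ℝ)) * S.U u ξ ^ 2) μ := by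
    refine hint.congr (Eventually.of_forall fun ξ => ?_)
    simp only [Pi.mul_apply]
    exact he ξ
  have hnn : ∀ ξ, 0 ≤ S.lam ξ ^ (4 * (1 / 2 : ℝ)) * S.U u ξ ^ 2 := fun ξ => by
    have := S.lam_nonneg ξ; positivity
  have hnn' := Eventually.of_forall (f := ae μ) hnn
  rw [powNormSq, ← ofReal_integral_eq_lintegral_ofReal hint' hnn']
  refine ⟨ENNReal.ofReal_lt_top, ?_⟩
  rw [ENNReal.toReal_ofReal (integral_nonneg hnn), powLift, powLift,
    inner_lift (memLp_pow_mul h1) (memLp_pow_mul h3)]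
  simp only [he]

/-! ### Functions with values in Gevrey spaces -/

lemma hasDerivWithinAt_of_gevreyNorm {φ : ℝ → ℝ} {r α t : ℝ} {u : ℝ → H} {v : H} {s : Set ℝ}
    (h : Tendsto (fun s => gevreyNorm S φ r α ((s - t)⁻¹ • (u s - u t) - v)) (𝓝[s \ {t}] t) (𝓝 0)) :
    HasDerivWithinAt u v s t := by
  rw [hasDerivWithinAt_iff_tendsto_slope]
  exact tendsto_of_gevreyNorm S h

/-- The derivative in `C¹([0,τ]; G_{φ,r,α}(A))` is the derivative in `H`. -/
lemma C1Gevrey.derivWithin_spec {φ : ℝ → ℝ} {r α τ : ℝ} {u : ℝ → H} (hτ : 0 < τ)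
    (h : C1Gevrey S φ r α τ u) :
    (∀ t ∈ Icc 0 τ, HasDerivWithinAt u (derivWithin u (Icc 0 τ) t) (Icc 0 τ) t) ∧
    ContGevrey S φ r α τ (derivWithin u (Icc 0 τ)) ∧
    ∀ t ∈ Icc 0 τ, Tendsto (fun s => gevreyNorm S φ r α
      ((s - t)⁻¹ • (u s - u t) - derivWithin u (Icc 0 τ) t)) (𝓝[Icc 0 τ \ {t}] t) (𝓝 0) := by
  obtain ⟨-, v, hv, hs⟩ := h
  have hd : ∀ t ∈ Icc 0 τ, HasDerivWithinAt u (v t) (Icc 0 τ) t := fun t ht =>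
    hasDerivWithinAt_of_gevreyNorm (hs t ht)
  have he : ∀ t ∈ Icc 0 τ, derivWithin u (Icc 0 τ) t = v t := fun t ht =>
    (hd t ht).derivWithin (uniqueDiffOn_Icc hτ t ht)
  refine ⟨fun t ht => by rw [he t ht]; exact hd t ht, ⟨fun t ht => by rw [he t ht]; exact hv.1 t ht,
    fun t ht => ?_⟩, fun t ht => by rw [he t ht]; exact hs t ht⟩
  refine (hv.2 t ht).congr' ?_
  filter_upwards [self_mem_nhdsWithin] with s hs
  rw [he t ht, he s hs]

lemma ContGevrey.continuousOn {φ : ℝ → ℝ} {r α τ : ℝ} {u : ℝ → H}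
    (h : ContGevrey S φ r α τ u) : ContinuousOn u (Icc 0 τ) := fun t ht =>
  tendsto_of_gevreyNorm S (h.2 t ht)

lemma ContGevrey.congr {φ : ℝ → ℝ} {r α τ : ℝ} {u v : ℝ → H} (h : ContGevrey S φ r α τ u)
    (huv : EqOn v u (Icc 0 τ)) : ContGevrey S φ r α τ v := by
  refine ⟨fun t ht => by rw [huv ht]; exact h.1 t ht, fun t ht => (h.2 t ht).congr' ?_⟩
  filter_upwards [self_mem_nhdsWithin] with s hs
  rw [huv ht, huv hs]

lemma C1Gevrey.congr {φ : ℝ → ℝ} {r α τ : ℝ} {u v : ℝ → H} (h : C1Gevrey S φ r α τ u)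
    (huv : EqOn v u (Icc 0 τ)) : C1Gevrey S φ r α τ v := by
  obtain ⟨h1, w, hw, hs⟩ := h
  refine ⟨fun t ht => by rw [huv ht]; exact h1 t ht, w, hw, fun t ht => (hs t ht).congr' ?_⟩
  filter_upwards [self_mem_nhdsWithin] with s hs
  rw [huv ht, huv hs.1]

/-- Comparison of two Gevrey norms whose weights are ordered. -/
lemma wInt_gevrey_mono {φ φ' : ℝ → ℝ} {r r' α α' C : ℝ} (hC : 0 ≤ C)
    (hw : ∀ lam, 0 ≤ lam → gevreyWeight φ' r' α' lam ≤ C * gevreyWeight φ r α lam) (u : H) :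
    wInt μ (fun ξ => gevreyWeight φ' r' α' (S.lam ξ)) (S.U u) ≤
      ENNReal.ofReal C * wInt μ (fun ξ => gevreyWeight φ r α (S.lam ξ)) (S.U u) :=
  wInt_le (fun ξ => hw _ (S.lam_nonneg ξ)) hC

lemma tendsto_gevreyNorm_mono {ι : Type*} {l : Filter ι} {φ φ' : ℝ → ℝ} {r r' α α' C : ℝ}
    (hC : 0 ≤ C)
    (hw : ∀ lam, 0 ≤ lam → gevreyWeight φ' r' α' lam ≤ C * gevreyWeight φ r α lam) {u : ι → H}
    (h : Tendsto (fun i => gevreyNorm S φ r α (u i)) l (𝓝 0)) :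
    Tendsto (fun i => gevreyNorm S φ' r' α' (u i)) l (𝓝 0) := by
  rw [tendsto_gevreyNorm_iff] at h ⊢
  have h2 := ENNReal.Tendsto.const_mul (a := ENNReal.ofReal C) h (Or.inr ENNReal.ofReal_ne_top)
  rw [mul_zero] at h2
  exact tendsto_of_tendsto_of_tendsto_of_le_of_le tendsto_const_nhds h2 (fun _ => zero_le)
    fun i => wInt_gevrey_mono hC hw (u i)

lemma MemGevrey.mono {φ φ' : ℝ → ℝ} {r r' α α' C : ℝ} (hC : 0 ≤ C)
    (hw : ∀ lam, 0 ≤ lam → gevreyWeight φ' r' α' lam ≤ C * gevreyWeight φ r α lam) {u : H}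
    (h : MemGevrey S φ r α u) : MemGevrey S φ' r' α' u := by
  rw [memGevrey_iff] at h ⊢
  exact (wInt_gevrey_mono hC hw u).trans_lt (ENNReal.mul_lt_top ENNReal.ofReal_lt_top h)

lemma ContGevrey.mono {φ φ' : ℝ → ℝ} {r r' α α' C τ : ℝ} (hC : 0 ≤ C)
    (hw : ∀ lam, 0 ≤ lam → gevreyWeight φ' r' α' lam ≤ C * gevreyWeight φ r α lam) {u : ℝ → H}
    (h : ContGevrey S φ r α τ u) : ContGevrey S φ' r' α' τ u :=
  ⟨fun t ht => (h.1 t ht).mono hC hw, fun t ht => tendsto_gevreyNorm_mono hC hw (h.2 t ht)⟩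

lemma C1Gevrey.mono {φ φ' : ℝ → ℝ} {r r' α α' C τ : ℝ} (hC : 0 ≤ C)
    (hw : ∀ lam, 0 ≤ lam → gevreyWeight φ' r' α' lam ≤ C * gevreyWeight φ r α lam) {u : ℝ → H}
    (h : C1Gevrey S φ r α τ u) : C1Gevrey S φ' r' α' τ u := by
  obtain ⟨h1, w, hw', hs⟩ := h
  exact ⟨fun t ht => (h1 t ht).mono hC hw, w, hw'.mono hC hw, fun t ht =>
    tendsto_gevreyNorm_mono hC hw (hs t ht)⟩

lemma gevreyWeight_quarter (lam : ℝ) :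
    gevreyWeight (fun _ => 1) 0 (1 / 4) lam = 1 + lam := by
  simp [gevreyWeight]

lemma gevreyWeight_three_quarter (lam : ℝ) :
    gevreyWeight (fun _ => 1) 0 (3 / 4) lam = 1 + lam ^ 3 := by
  rw [gevreyWeight, show (4 * (3 / 4) : ℝ) = (3 : ℕ) by norm_num, Real.rpow_natCast]
  simp

lemma gevreyWeight_quarter_le {φ : ℝ → ℝ} (hφ : ∀ σ : ℝ, 0 ≤ σ → 1 ≤ φ σ) {r α lam : ℝ}
    (hα : 1 / 4 ≤ α) (hr : 0 ≤ r) (hlam : 0 ≤ lam) :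
    gevreyWeight (fun _ => 1) 0 (1 / 4) lam ≤ 2 * gevreyWeight φ r α lam := by
  rw [gevreyWeight_quarter]
  have a := one_le_gevreyWeight φ r α hlam
  have b := lam_le_gevreyWeight (φ := φ) hr hα hlam (zero_le_one.trans (hφ lam hlam))
  linarith

lemma gevreyWeight_three_quarter_le {φ : ℝ → ℝ} (hφ : ∀ σ : ℝ, 0 ≤ σ → 1 ≤ φ σ) {r α lam : ℝ}
    (hα : 1 / 4 ≤ α) (hr : 0 ≤ r) (hlam : 0 ≤ lam) :
    gevreyWeight (fun _ => 1) 0 (3 / 4) lam ≤ 2 * gevreyWeight φ r (α + 1 / 2) lam := by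
  rw [gevreyWeight_three_quarter]
  have a := one_le_gevreyWeight φ r (α + 1 / 2) hlam
  have b := lam_cube_le_gevreyWeight (φ := φ) hr hα hlam (zero_le_one.trans (hφ lam hlam))
  linarith

/-- The scale of Gevrey spaces is contained in the phase space. -/
lemma InScale.inPhaseSpace {φ : ℝ → ℝ} (hφ : ∀ σ : ℝ, 0 ≤ σ → 1 ≤ φ σ) {r₀ R α T : ℝ}
    (hα : 1 / 4 ≤ α) (hT : 0 < T) (hr : R * T ≤ r₀) {u : ℝ → H}
    (h : InScale S φ r₀ R α T u) : InPhaseSpace S T u := by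
  obtain ⟨h1, h2⟩ := h T ⟨hT, le_rfl⟩
  exact ⟨h1.mono zero_le_two fun lam hlam =>
      gevreyWeight_quarter_le hφ hα (sub_nonneg.2 hr) hlam,
    h2.mono zero_le_two fun lam hlam =>
      gevreyWeight_three_quarter_le hφ hα (sub_nonneg.2 hr) hlam⟩

/-! ### Functions in the phase space -/

variable (S) in
/-- `|A^{1/2} u(t)|²` as a real number. -/
noncomputable def halfSq (u : ℝ → H) (t : ℝ) : ℝ := (powNormSq S (1 / 2) (u t)).toReal

variable (S) in
/-- The energy `|A^{1/4} u'(t)|² + |A^{3/4} u(t)|²`. -/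
noncomputable def phaseEnergy (T : ℝ) (u : ℝ → H) (t : ℝ) : ℝ≥0∞ :=
  powNormSq S (1 / 4) (derivWithin u (Icc 0 T) t) + powNormSq S (3 / 4) (u t)

lemma ContGevrey.continuousOn_powLift {φ : ℝ → ℝ} {β τ : ℝ} {u : ℝ → H}
    (h : ContGevrey S φ 0 β τ u) : ContinuousOn (fun t => powLift S β (u t)) (Icc 0 τ) := by
  intro t ht
  rw [ContinuousWithinAt, tendsto_iff_edist_tendsto_0]
  refine tendsto_of_tendsto_of_tendsto_of_le_of_le' tendsto_const_nhds (h.2 t ht)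
    (Eventually.of_forall fun _ => zero_le) ?_
  filter_upwards [self_mem_nhdsWithin] with s hs
  obtain ⟨h1, h2⟩ := powLift_sub (memGevrey_zero.1 (h.1 s hs)) (memGevrey_zero.1 (h.1 t ht))
  rw [edist_eq_enorm_sub, ← h2]
  exact enorm_powLift_le h1

section

variable {T : ℝ} {u : ℝ → H} (hu : InPhaseSpace S T u)
include hu

lemma InPhaseSpace.quarter_lt_top {t : ℝ} (ht : t ∈ Icc 0 T) : powNormSq S (1 / 4) (u t) < ∞ :=
  memGevrey_zero.1 (hu.1.1 t ht)

lemma InPhaseSpace.three_quarter_lt_top {t : ℝ} (ht : t ∈ Icc 0 T) :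
    powNormSq S (3 / 4) (u t) < ∞ :=
  memGevrey_zero.1 (hu.2.1 t ht)

lemma InPhaseSpace.halfSq_eq {t : ℝ} (ht : t ∈ Icc 0 T) :
    halfSq S u t = inner ℝ (powLift S (1 / 4) (u t)) (powLift S (3 / 4) (u t)) :=
  (powNormSq_half (hu.quarter_lt_top ht) (hu.three_quarter_lt_top ht)).2

variable (hT : 0 < T)
include hT

lemma InPhaseSpace.deriv_lt_top {t : ℝ} (ht : t ∈ Icc 0 T) :
    powNormSq S (1 / 4) (derivWithin u (Icc 0 T) t) < ∞ :=
  memGevrey_zero.1 ((hu.1.derivWithin_spec hT).2.1.1 t ht)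

lemma InPhaseSpace.hasDerivWithinAt_powLift {t : ℝ} (ht : t ∈ Icc 0 T) :
    HasDerivWithinAt (fun s => powLift S (1 / 4) (u s))
      (powLift S (1 / 4) (derivWithin u (Icc 0 T) t)) (Icc 0 T) t := by
  obtain ⟨-, h2, h3⟩ := hu.1.derivWithin_spec hT
  rw [hasDerivWithinAt_iff_tendsto_slope, tendsto_iff_edist_tendsto_0]
  refine tendsto_of_tendsto_of_tendsto_of_le_of_le' tendsto_const_nhds (h3 t ht)
    (Eventually.of_forall fun _ => zero_le) ?_
  filter_upwards [self_mem_nhdsWithin] with s hs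
  obtain ⟨a1, a2⟩ := powLift_sub (hu.quarter_lt_top hs.1) (hu.quarter_lt_top ht)
  obtain ⟨b1, b2⟩ := powLift_smul (s - t)⁻¹ a1
  obtain ⟨c1, c2⟩ := powLift_sub b1 (hu.deriv_lt_top hT ht)
  rw [edist_eq_enorm_sub, slope_def_module, ← a2, ← b2, ← c2]
  exact enorm_powLift_le c1

lemma InPhaseSpace.continuousOn_halfSq : ContinuousOn (halfSq S u) (Icc 0 T) := by
  have h1 : ContinuousOn (fun t => powLift S (1 / 4) (u t)) (Icc 0 T) := fun t ht =>
    (hu.hasDerivWithinAt_powLift hT ht).continuousWithinAt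
  exact (h1.inner hu.2.continuousOn_powLift).congr fun t ht => hu.halfSq_eq ht

lemma InPhaseSpace.continuousOn_phaseEnergy :
    ContinuousOn (phaseEnergy S T u) (Icc 0 T) := by
  have h1 := ((hu.1.derivWithin_spec hT).2.1.continuousOn_powLift (β := 1 / 4))
  have h2 := hu.2.continuousOn_powLift
  have h3 : ContinuousOn (fun t => ENNReal.ofReal (‖powLift S (1 / 4) (derivWithin u (Icc 0 T) t)‖ ^ 2
      + ‖powLift S (3 / 4) (u t)‖ ^ 2)) (Icc 0 T) :=
    ENNReal.continuous_ofReal.comp_continuousOn ((h1.norm.pow 2).add (h2.norm.pow 2))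
  refine h3.congr fun t ht => ?_
  beta_reduce
  rw [norm_powLift_sq (hu.deriv_lt_top hT ht), norm_powLift_sq (hu.three_quarter_lt_top ht),
    ENNReal.ofReal_add ENNReal.toReal_nonneg ENNReal.toReal_nonneg,
    ENNReal.ofReal_toReal (hu.deriv_lt_top hT ht).ne,
    ENNReal.ofReal_toReal (hu.three_quarter_lt_top ht).ne, phaseEnergy]

/-- If the energy is bounded by `K`, then `|A^{1/2} u|²` is Lipschitz continuous. -/
lemma InPhaseSpace.abs_halfSq_sub_le {τ K : ℝ} (hτ : τ ≤ T) (hK : 0 ≤ K)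
    (hE : ∀ t ∈ Icc 0 τ, phaseEnergy S T u t ≤ ENNReal.ofReal K) {s t : ℝ}
    (hs : s ∈ Icc 0 τ) (ht : t ∈ Icc 0 τ) : |halfSq S u s - halfSq S u t| ≤ 2 * K * |s - t| := by
  have hsub : Icc 0 τ ⊆ Icc 0 T := Icc_subset_Icc_right hτ
  have hd : ∀ t ∈ Icc 0 τ, ‖powLift S (1 / 4) (derivWithin u (Icc 0 T) t)‖ ≤ √K := fun t ht => by
    refine Real.le_sqrt_of_sq_le ?_
    rw [norm_powLift_sq (hu.deriv_lt_top hT (hsub ht))]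
    exact ENNReal.toReal_le_of_le_ofReal hK (le_self_add.trans (hE t ht))
  have ha : ∀ t ∈ Icc 0 τ, ‖powLift S (3 / 4) (u t)‖ ≤ √K := fun t ht => by
    refine Real.le_sqrt_of_sq_le ?_
    rw [norm_powLift_sq (hu.three_quarter_lt_top (hsub ht))]
    exact ENNReal.toReal_le_of_le_ofReal hK (le_add_self.trans (hE t ht))
  have hL : ‖powLift S (1 / 4) (u s) - powLift S (1 / 4) (u t)‖ ≤ √K * ‖s - t‖ :=
    (convex_Icc 0 τ).norm_image_sub_le_of_norm_hasDerivWithin_le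
      (fun x hx => (hu.hasDerivWithinAt_powLift hT (hsub hx)).mono hsub) hd ht hs
  -- Both sides are the integral of λ^{1/2}λ^{3/2} û(s)û(t).
  have hsym : inner ℝ (powLift S (1 / 4) (u s)) (powLift S (3 / 4) (u t)) =
      (inner ℝ (powLift S (1 / 4) (u t)) (powLift S (3 / 4) (u s)) : ℝ) := by
    rw [powLift, powLift, powLift, powLift,
      inner_lift (memLp_pow_mul (hu.quarter_lt_top (hsub hs)))
        (memLp_pow_mul (hu.three_quarter_lt_top (hsub ht))),
      inner_lift (memLp_pow_mul (hu.quarter_lt_top (hsub ht)))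
        (memLp_pow_mul (hu.three_quarter_lt_top (hsub hs)))]
    refine integral_congr_ae (Eventually.of_forall fun ξ => ?_)
    simp only
    ring
  -- For a symmetric form b one has b(x,x) - b(y,y) = b(x - y, x + y). Only A^{1/4}u has to be
  -- Lipschitz in time; A^{3/4}u just has to be bounded.
  have hkey : halfSq S u s - halfSq S u t = inner ℝ
      (powLift S (1 / 4) (u s) - powLift S (1 / 4) (u t))
      (powLift S (3 / 4) (u s) + powLift S (3 / 4) (u t)) := by
    rw [hu.halfSq_eq (hsub hs), hu.halfSq_eq (hsub ht), inner_sub_left, inner_add_right,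
      inner_add_right, hsym]
    ring
  rw [hkey]
  calc _ ≤ ‖powLift S (1 / 4) (u s) - powLift S (1 / 4) (u t)‖ *
        ‖powLift S (3 / 4) (u s) + powLift S (3 / 4) (u t)‖ := abs_real_inner_le_norm _ _
    _ ≤ (√K * ‖s - t‖) * (√K + √K) := by
        gcongr
        exact (norm_add_le _ _).trans (add_le_add (ha s hs) (ha t ht))
    _ = 2 * (√K * √K) * |s - t| := by rw [Real.norm_eq_abs]; ring
    _ = 2 * K * |s - t| := by rw [Real.mul_self_sqrt hK]

end

end Phase

lemma freqEnergy_sub_le (lam : ℝ) (x y : ℝ × ℝ) :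
    freqEnergy lam (x - y) ≤ 2 * freqEnergy lam x + 2 * freqEnergy lam y := by
  unfold freqEnergy
  simp only [Prod.fst_sub, Prod.snd_sub]
  have h1 : (x.2 - y.2) ^ 2 ≤ 2 * x.2 ^ 2 + 2 * y.2 ^ 2 := by nlinarith [sq_nonneg (x.2 + y.2)]
  have h2 : (x.1 - y.1) ^ 2 ≤ 2 * x.1 ^ 2 + 2 * y.1 ^ 2 := by nlinarith [sq_nonneg (x.1 + y.1)]
  nlinarith [mul_le_mul_of_nonneg_left h2 (by positivity : 0 ≤ 1 + lam ^ 2)]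

lemma sq_fst_le_freqEnergy (lam : ℝ) (x : ℝ × ℝ) : x.1 ^ 2 ≤ freqEnergy lam x := by
  unfold freqEnergy; nlinarith [sq_nonneg x.2, mul_nonneg (sq_nonneg lam) (sq_nonneg x.1)]

lemma weighted_fst_le_freqEnergy (lam : ℝ) (x : ℝ × ℝ) :
    (1 + lam ^ 2) * x.1 ^ 2 ≤ freqEnergy lam x := by
  unfold freqEnergy; nlinarith [sq_nonneg x.2]

lemma sq_snd_le_freqEnergy (lam : ℝ) (x : ℝ × ℝ) : x.2 ^ 2 ≤ freqEnergy lam x := by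
  unfold freqEnergy; nlinarith [mul_nonneg (by positivity : 0 ≤ 1 + lam ^ 2) (sq_nonneg x.1)]

lemma freqEnergy_zero (lam : ℝ) : freqEnergy lam 0 = 0 := by simp [freqEnergy]

lemma continuous_freqEnergy (lam : ℝ) : Continuous (freqEnergy lam) := by
  unfold freqEnergy; fun_prop

section Linear

variable {H : Type*} [NormedAddCommGroup H] [InnerProductSpace ℝ H] {A : H →ₗ.[ℝ] H}
  {M : Type*} [MeasurableSpace M] {μ : Measure M} (S : SpectralRep A μ)

/-! ### The linear problem `u'' + c(t) A u = 0` -/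

/-- The pair of the values at `ξ` of `u(t)` and `u'(t)`, where `u` solves `u'' + c(t) A u = 0`. -/
noncomputable def flowField (c : ℝ → ℝ) (u₀ u₁ : H) (t : ℝ) (ξ : M) : ℝ × ℝ :=
  oscFlow (fun s => c s * S.lam ξ ^ 2) (S.U u₀ ξ, S.U u₁ ξ) t

/-- The solution of the linear problem `u'' + c(t) A u = 0`. -/
noncomputable def linSol (c : ℝ → ℝ) (u₀ u₁ : H) (t : ℝ) : H :=
  lift S fun ξ => (flowField S c u₀ u₁ t ξ).1

/-- The time derivative of the solution of the linear problem `u'' + c(t) A u = 0`. -/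
noncomputable def linVel (c : ℝ → ℝ) (u₀ u₁ : H) (t : ℝ) : H :=
  lift S fun ξ => (flowField S c u₀ u₁ t ξ).2

/-- The integral of the energy of the frequencies, with a weight. -/
noncomputable def totalEnergy (W : M → ℝ) (X : M → ℝ × ℝ) : ℝ≥0∞ :=
  ∫⁻ ξ, ENNReal.ofReal (W ξ * freqEnergy (S.lam ξ) (X ξ)) ∂μ

/-- Domination of the weighted energies of the solution up to the time `τ`. -/
def Dominated (c : ℝ → ℝ) (u₀ u₁ : H) (W : M → ℝ) (τ : ℝ) (D : M → ℝ) : Prop :=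
  Integrable D μ ∧ ∀ t ∈ Icc 0 τ, ∀ ξ, W ξ * freqEnergy (S.lam ξ) (flowField S c u₀ u₁ t ξ) ≤ D ξ

variable {S}

lemma aemeasurable_freqEnergy {X : M → ℝ × ℝ} (hX : AEMeasurable X μ) :
    AEMeasurable (fun ξ => freqEnergy (S.lam ξ) (X ξ)) μ := by
  have := S.measurable_lam
  unfold freqEnergy
  have h1 : AEMeasurable (fun ξ => (X ξ).1) μ := measurable_fst.comp_aemeasurable hX
  have h2 : AEMeasurable (fun ξ => (X ξ).2) μ := measurable_snd.comp_aemeasurable hX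
  fun_prop

lemma aemeasurable_flowField {c : ℝ → ℝ} (hc : Continuous c) (u₀ u₁ : H) {t : ℝ}
    (ht : t ∈ Icc (0 : ℝ) 1) : AEMeasurable (flowField S c u₀ u₁ t) μ := by
  have h : AEMeasurable (fun ξ => (S.lam ξ, S.U u₀ ξ, S.U u₁ ξ)) μ :=
    S.measurable_lam.aemeasurable.prodMk
      ((aestronglyMeasurable_U S u₀).aemeasurable.prodMk (aestronglyMeasurable_U S u₁).aemeasurable)
  exact (continuous_oscFlow_param hc ht).measurable.comp_aemeasurable h

lemma isOscillator_flowField {c : ℝ → ℝ} (hc : Continuous c) (u₀ u₁ : H) (ξ : M) :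
    IsOscillator (fun s => c s * S.lam ξ ^ 2) (fun t => flowField S c u₀ u₁ t ξ) :=
  isOscillator_oscFlow (by fun_prop) _

lemma flowField_zero {c : ℝ → ℝ} (hc : Continuous c) (u₀ u₁ : H) (ξ : M) :
    flowField S c u₀ u₁ 0 ξ = (S.U u₀ ξ, S.U u₁ ξ) :=
  oscFlow_zero (by fun_prop) _

/-- Dominated convergence for weighted energies. -/
lemma tendsto_totalEnergy_zero {ι : Type*} {l : Filter ι} [l.IsCountablyGenerated] {W D : M → ℝ}
    (hW : AEMeasurable W μ) (hD : Integrable D μ) {X : ι → M → ℝ × ℝ}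
    (hX : ∀ᶠ i in l, AEMeasurable (X i) μ)
    (hb : ∀ᶠ i in l, ∀ ξ, W ξ * freqEnergy (S.lam ξ) (X i ξ) ≤ D ξ)
    (hlim : ∀ ξ, Tendsto (fun i => X i ξ) l (𝓝 0)) :
    Tendsto (fun i => totalEnergy S W (X i)) l (𝓝 0) := by
  have h := tendsto_lintegral_filter_of_dominated_convergence' (μ := μ) (l := l)
    (F := fun i ξ => ENNReal.ofReal (W ξ * freqEnergy (S.lam ξ) (X i ξ))) (f := fun _ => 0)
    (fun ξ => ENNReal.ofReal (D ξ))
    (hX.mono fun i hi => (hW.mul (aemeasurable_freqEnergy hi)).ennreal_ofReal)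
    (hb.mono fun i hi => Eventually.of_forall fun ξ => ENNReal.ofReal_le_ofReal (hi ξ))
    (by
      refine (lt_of_le_of_lt ?_ hD.2).ne
      exact lintegral_mono fun ξ => by
        rw [← ofReal_norm]; exact ENNReal.ofReal_le_ofReal (le_abs_self _))
    (Eventually.of_forall fun ξ => by
      have h1 := ((continuous_freqEnergy (S.lam ξ)).tendsto 0).comp (hlim ξ)
      rw [freqEnergy_zero] at h1
      have h2 := ENNReal.tendsto_ofReal (h1.const_mul (W ξ))
      rwa [mul_zero, ENNReal.ofReal_zero] at h2)
  simpa [totalEnergy] using h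

lemma wInt_fst_le {W W' : M → ℝ} (hW' : ∀ ξ, W' ξ ≤ W ξ * (1 + S.lam ξ ^ 2)) (hW0 : ∀ ξ, 0 ≤ W ξ)
    (X : M → ℝ × ℝ) : wInt μ W' (fun ξ => (X ξ).1) ≤ totalEnergy S W X :=
  lintegral_mono fun ξ => ENNReal.ofReal_le_ofReal <|
    calc W' ξ * (X ξ).1 ^ 2 ≤ (W ξ * (1 + S.lam ξ ^ 2)) * (X ξ).1 ^ 2 := by
          gcongr; exact hW' ξ
      _ = W ξ * ((1 + S.lam ξ ^ 2) * (X ξ).1 ^ 2) := by ring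
      _ ≤ _ := mul_le_mul_of_nonneg_left (weighted_fst_le_freqEnergy _ _) (hW0 ξ)

lemma wInt_snd_le {W : M → ℝ} (hW0 : ∀ ξ, 0 ≤ W ξ) (X : M → ℝ × ℝ) :
    wInt μ W (fun ξ => (X ξ).2) ≤ totalEnergy S W X :=
  lintegral_mono fun ξ => ENNReal.ofReal_le_ofReal <|
    mul_le_mul_of_nonneg_left (sq_snd_le_freqEnergy _ _) (hW0 ξ)

section

variable {c : ℝ → ℝ} (hc : Continuous c) {u₀ u₁ : H} {W D : M → ℝ} (hW1 : ∀ ξ, 1 ≤ W ξ)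
  {τ : ℝ} (hτ : τ ≤ 1) (hdom : Dominated S c u₀ u₁ W τ D)
include hW1 hdom

lemma Dominated.sq_fst_le {t : ℝ} (ht : t ∈ Icc 0 τ) (ξ : M) :
    (flowField S c u₀ u₁ t ξ).1 ^ 2 ≤ D ξ := by
  have h1 := hdom.2 t ht ξ
  have h2 := sq_fst_le_freqEnergy (S.lam ξ) (flowField S c u₀ u₁ t ξ)
  have h3 := freqEnergy_nonneg (S.lam ξ) (flowField S c u₀ u₁ t ξ)
  nlinarith [hW1 ξ]

lemma Dominated.weighted_sq_snd_le {t : ℝ} (ht : t ∈ Icc 0 τ) (ξ : M) :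
    W ξ * (flowField S c u₀ u₁ t ξ).2 ^ 2 ≤ D ξ :=
  (mul_le_mul_of_nonneg_left (sq_snd_le_freqEnergy _ _) (by linarith [hW1 ξ])).trans
    (hdom.2 t ht ξ)

lemma Dominated.sq_snd_le {t : ℝ} (ht : t ∈ Icc 0 τ) (ξ : M) :
    (flowField S c u₀ u₁ t ξ).2 ^ 2 ≤ D ξ := by
  have := hdom.weighted_sq_snd_le hW1 ht ξ
  nlinarith [hW1 ξ, sq_nonneg (flowField S c u₀ u₁ t ξ).2]

include hc hτ

lemma Dominated.memLp_fst {t : ℝ} (ht : t ∈ Icc 0 τ) :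
    MemLp (fun ξ => (flowField S c u₀ u₁ t ξ).1) 2 μ := by
  have hm : AEStronglyMeasurable (fun ξ => (flowField S c u₀ u₁ t ξ).1) μ :=
    (measurable_fst.comp_aemeasurable
      (aemeasurable_flowField hc u₀ u₁ ⟨ht.1, ht.2.trans hτ⟩)).aestronglyMeasurable
  rw [memLp_two_iff_integrable_sq hm]
  refine hdom.1.mono' (hm.pow 2) (Eventually.of_forall fun ξ => ?_)
  rw [Real.norm_of_nonneg (sq_nonneg _)]
  exact hdom.sq_fst_le hW1 ht ξ

lemma Dominated.memLp_snd {t : ℝ} (ht : t ∈ Icc 0 τ) :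
    MemLp (fun ξ => (flowField S c u₀ u₁ t ξ).2) 2 μ := by
  have hm : AEStronglyMeasurable (fun ξ => (flowField S c u₀ u₁ t ξ).2) μ :=
    (measurable_snd.comp_aemeasurable
      (aemeasurable_flowField hc u₀ u₁ ⟨ht.1, ht.2.trans hτ⟩)).aestronglyMeasurable
  rw [memLp_two_iff_integrable_sq hm]
  refine hdom.1.mono' (hm.pow 2) (Eventually.of_forall fun ξ => ?_)
  rw [Real.norm_of_nonneg (sq_nonneg _)]
  exact hdom.sq_snd_le hW1 ht ξ

lemma Dominated.U_linSol {t : ℝ} (ht : t ∈ Icc 0 τ) :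
    S.U (linSol S c u₀ u₁ t) =ᵐ[μ] fun ξ => (flowField S c u₀ u₁ t ξ).1 :=
  U_lift (hdom.memLp_fst hc hW1 hτ ht)

lemma Dominated.U_linVel {t : ℝ} (ht : t ∈ Icc 0 τ) :
    S.U (linVel S c u₀ u₁ t) =ᵐ[μ] fun ξ => (flowField S c u₀ u₁ t ξ).2 :=
  U_lift (hdom.memLp_snd hc hW1 hτ ht)

lemma Dominated.linSol_zero (hτ0 : 0 ≤ τ) : linSol S c u₀ u₁ 0 = u₀ := by
  refine eq_of_U_ae S ?_
  filter_upwards [hdom.U_linSol hc hW1 hτ ⟨le_rfl, hτ0⟩] with ξ h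
  rw [h, flowField_zero hc]

lemma Dominated.linVel_zero (hτ0 : 0 ≤ τ) : linVel S c u₀ u₁ 0 = u₁ := by
  refine eq_of_U_ae S ?_
  filter_upwards [hdom.U_linVel hc hW1 hτ ⟨le_rfl, hτ0⟩] with ξ h
  rw [h, flowField_zero hc]

/-- Each frequency is continuous in time, and the energy of a difference is at most twice the sum of
the energies, so 4D is an integrable majorant. -/
lemma Dominated.tendsto_sub (hW : AEMeasurable W μ) {t : ℝ} (ht : t ∈ Icc 0 τ) :
    Tendsto (fun s => totalEnergy S W
      (fun ξ => flowField S c u₀ u₁ s ξ - flowField S c u₀ u₁ t ξ)) (𝓝[Icc 0 τ] t) (𝓝 0) := by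
  have hsub : Icc 0 τ ⊆ Icc (0 : ℝ) 1 := Icc_subset_Icc_right hτ
  refine tendsto_totalEnergy_zero (D := fun ξ => 4 * D ξ) hW (hdom.1.const_mul 4) ?_ ?_ fun ξ => ?_
  · filter_upwards [self_mem_nhdsWithin] with s hs
    exact (aemeasurable_flowField hc u₀ u₁ (hsub hs)).sub
      (aemeasurable_flowField hc u₀ u₁ (hsub ht))
  · filter_upwards [self_mem_nhdsWithin] with s hs ξ
    have h1 := hdom.2 s hs ξ
    have h2 := hdom.2 t ht ξ
    have h3 := mul_le_mul_of_nonneg_left (freqEnergy_sub_le (S.lam ξ) (flowField S c u₀ u₁ s ξ)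
      (flowField S c u₀ u₁ t ξ)) (by linarith [hW1 ξ] : 0 ≤ W ξ)
    linarith
  · have := ((isOscillator_flowField (S := S) hc u₀ u₁ ξ).continuousOn.mono hsub) t ht
    rw [ContinuousWithinAt] at this
    simpa using this.sub_const (flowField S c u₀ u₁ t ξ)

/-- By the mean value inequality a difference quotient of the first component never exceeds the
supremum of the second one. Hence the same D dominates it, with no extra power of λ. -/
lemma Dominated.tendsto_slope (hW : AEMeasurable W μ) {t : ℝ} (ht : t ∈ Icc 0 τ) :
    Tendsto (fun s => wInt μ W (fun ξ => (s - t)⁻¹ * ((flowField S c u₀ u₁ s ξ).1 -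
      (flowField S c u₀ u₁ t ξ).1) - (flowField S c u₀ u₁ t ξ).2)) (𝓝[Icc 0 τ \ {t}] t)
      (𝓝 0) := by
  have hsub : Icc 0 τ ⊆ Icc (0 : ℝ) 1 := Icc_subset_Icc_right hτ
  -- With first component zero the frequency energy is the square of the second, so the statement
  -- about energies covers a scalar quantity.
  have key := tendsto_totalEnergy_zero (S := S) (l := 𝓝[Icc 0 τ \ {t}] t) (W := W)
    (D := fun ξ => 4 * D ξ) (X := fun s ξ => ((0 : ℝ), (s - t)⁻¹ * ((flowField S c u₀ u₁ s ξ).1 -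
      (flowField S c u₀ u₁ t ξ).1) - (flowField S c u₀ u₁ t ξ).2)) hW (hdom.1.const_mul 4) ?_ ?_
      fun ξ => ?_
  · refine key.congr fun s => lintegral_congr fun ξ => ?_
    simp [freqEnergy]
  · filter_upwards [self_mem_nhdsWithin] with s hs
    have h1 := aemeasurable_flowField (S := S) hc u₀ u₁ (hsub hs.1)
    have h2 := aemeasurable_flowField (S := S) hc u₀ u₁ (hsub ht)
    exact aemeasurable_const.prodMk ((((measurable_fst.comp_aemeasurable h1).sub
      (measurable_fst.comp_aemeasurable h2)).const_mul _).sub (measurable_snd.comp_aemeasurable h2))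
  · filter_upwards [self_mem_nhdsWithin] with s hs ξ
    have hWξ : 0 < W ξ := by linarith [hW1 ξ]
    have hD0 : 0 ≤ D ξ := (sq_nonneg _).trans (hdom.sq_fst_le hW1 ht ξ)
    have hv : ∀ r ∈ Icc 0 τ, ‖(flowField S c u₀ u₁ r ξ).2‖ ≤ √(D ξ / W ξ) := fun r hr => by
      refine Real.le_sqrt_of_sq_le ?_
      rw [Real.norm_eq_abs, sq_abs, le_div_iff₀ hWξ, mul_comm]
      exact hdom.weighted_sq_snd_le hW1 hr ξ
    have hmv := (convex_Icc 0 τ).norm_image_sub_le_of_norm_hasDerivWithin_le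
      (fun x hx => ((isOscillator_flowField (S := S) hc u₀ u₁ ξ).hasDerivWithinAt_fst
        (hsub hx)).mono hsub) hv ht hs.1
    have hst : 0 < ‖s - t‖ := norm_pos_iff.2 (sub_ne_zero.2 hs.2)
    have h1 : ‖(s - t)⁻¹ * ((flowField S c u₀ u₁ s ξ).1 - (flowField S c u₀ u₁ t ξ).1)‖ ≤
        √(D ξ / W ξ) := by
      rw [norm_mul, norm_inv, inv_mul_le_iff₀ hst, mul_comm]
      exact hmv
    have h3 : W ξ * ((s - t)⁻¹ * ((flowField S c u₀ u₁ s ξ).1 -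
        (flowField S c u₀ u₁ t ξ).1)) ^ 2 ≤ D ξ := by
      have := pow_le_pow_left₀ (norm_nonneg _) h1 2
      rw [Real.sq_sqrt (by positivity), Real.norm_eq_abs, sq_abs, le_div_iff₀ hWξ, mul_comm] at this
      exact this
    have h4 := hdom.weighted_sq_snd_le hW1 ht ξ
    have h5 := mul_le_mul_of_nonneg_left (freqEnergy_sub_le (S.lam ξ)
      (0, (s - t)⁻¹ * ((flowField S c u₀ u₁ s ξ).1 - (flowField S c u₀ u₁ t ξ).1))
      (0, (flowField S c u₀ u₁ t ξ).2)) hWξ.le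
    simp only [freqEnergy, Prod.mk_sub_mk] at h5 ⊢
    simp only [sub_zero] at h5
    nlinarith
  · have h1 := (isOscillator_flowField (S := S) hc u₀ u₁ ξ).hasDerivWithinAt_fst (hsub ht)
    have h2 := hasDerivWithinAt_iff_tendsto_slope.1 (h1.mono hsub)
    have h3 : Tendsto (fun s => (s - t)⁻¹ * ((flowField S c u₀ u₁ s ξ).1 -
      (flowField S c u₀ u₁ t ξ).1) - (flowField S c u₀ u₁ t ξ).2) (𝓝[Icc 0 τ \ {t}] t) (𝓝 0) := by
      have := h2.sub_const (flowField S c u₀ u₁ t ξ).2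
      simpa [slope_def_module] using this
    exact (tendsto_const_nhds (x := (0 : ℝ))).prodMk_nhds h3

lemma Dominated.hasDerivWithinAt_linSol (hW : AEMeasurable W μ) {t : ℝ} (ht : t ∈ Icc 0 τ) :
    HasDerivWithinAt (linSol S c u₀ u₁) (linVel S c u₀ u₁ t) (Icc 0 τ) t := by
  -- For r = 0 and α = 0 the weight is the constant 2, which yields convergence in H itself and
  -- explains the factor 2 below.
  refine hasDerivWithinAt_of_gevreyNorm (S := S) (φ := fun _ => 0) (r := 0) (α := 0) ?_
  rw [tendsto_gevreyNorm_iff]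
  have h := ENNReal.Tendsto.const_mul (a := ENNReal.ofReal 2) (hdom.tendsto_slope hc hW1 hτ hW ht)
    (Or.inr ENNReal.ofReal_ne_top)
  rw [mul_zero] at h
  refine tendsto_of_tendsto_of_tendsto_of_le_of_le' tendsto_const_nhds h
    (Eventually.of_forall fun _ => zero_le) ?_
  filter_upwards [self_mem_nhdsWithin] with s hs
  rw [wInt_congr (g := fun ξ => (s - t)⁻¹ * ((flowField S c u₀ u₁ s ξ).1 -
      (flowField S c u₀ u₁ t ξ).1) - (flowField S c u₀ u₁ t ξ).2)]
  · refine wInt_le (fun ξ => ?_) zero_le_two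
    simp only [gevreyWeight, mul_zero, Real.rpow_zero, Real.exp_zero]
    linarith [hW1 ξ]
  · filter_upwards [U_sub_ae S ((s - t)⁻¹ • (linSol S c u₀ u₁ s - linSol S c u₀ u₁ t))
      (linVel S c u₀ u₁ t), U_smul_ae S (s - t)⁻¹ (linSol S c u₀ u₁ s - linSol S c u₀ u₁ t),
      U_sub_ae S (linSol S c u₀ u₁ s) (linSol S c u₀ u₁ t), hdom.U_linSol hc hW1 hτ hs.1,
      hdom.U_linSol hc hW1 hτ ht, hdom.U_linVel hc hW1 hτ ht] with ξ e1 e2 e3 e4 e5 e6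
    rw [e1, e2, e3, e4, e5, e6]

lemma Dominated.continuousOn_linVel (hW : AEMeasurable W μ) :
    ContinuousOn (linVel S c u₀ u₁) (Icc 0 τ) := by
  intro t ht
  refine tendsto_of_gevreyNorm S (φ := fun _ => 0) (r := 0) (α := 0) ?_
  rw [tendsto_gevreyNorm_iff]
  have h := ENNReal.Tendsto.const_mul (a := ENNReal.ofReal 2) (hdom.tendsto_sub hc hW1 hτ hW ht)
    (Or.inr ENNReal.ofReal_ne_top)
  rw [mul_zero] at h
  refine tendsto_of_tendsto_of_tendsto_of_le_of_le' tendsto_const_nhds h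
    (Eventually.of_forall fun _ => zero_le) ?_
  filter_upwards [self_mem_nhdsWithin] with s hs
  rw [wInt_congr (g := fun ξ => (flowField S c u₀ u₁ s ξ - flowField S c u₀ u₁ t ξ).2)]
  · refine (wInt_le (w' := W) (fun ξ => ?_) zero_le_two).trans ?_
    · simp only [gevreyWeight, mul_zero, Real.rpow_zero, Real.exp_zero]
      linarith [hW1 ξ]
    · gcongr
      exact wInt_snd_le (fun ξ => by linarith [hW1 ξ]) _
  · filter_upwards [U_sub_ae S (linVel S c u₀ u₁ s) (linVel S c u₀ u₁ t),
      hdom.U_linVel hc hW1 hτ hs, hdom.U_linVel hc hW1 hτ ht] with ξ e1 e2 e3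
    rw [e1, e2, e3, Prod.snd_sub]

/-- The linear problem in weak form. -/
lemma Dominated.weak_equation (v : A.domain) {t : ℝ} (ht : t ∈ Icc 0 τ) :
    HasDerivWithinAt (fun s => inner ℝ (linVel S c u₀ u₁ s) (v : H))
      (-(c t * inner ℝ (linSol S c u₀ u₁ t) (A v))) (Icc 0 τ) t := by
  have hsub : Icc 0 τ ⊆ Icc (0 : ℝ) 1 := Icc_subset_Icc_right hτ
  obtain ⟨K, hK1, hK⟩ := exists_bound_on_unit hc
  have hv := S.mem_domain_iff v |>.1 v.2
  have hvm := aestronglyMeasurable_U S (v : H)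
  have hinner : ∀ s ∈ Icc 0 τ, inner ℝ (linVel S c u₀ u₁ s) (v : H) =
      ∫ ξ, (flowField S c u₀ u₁ s ξ).2 * S.U (v : H) ξ ∂μ := fun s hs => by
    rw [inner_eq_integral S]
    refine integral_congr_ae ?_
    filter_upwards [hdom.U_linVel hc hW1 hτ hs] with ξ e
    rw [e]
  have hlim : -(c t * inner ℝ (linSol S c u₀ u₁ t) (A v)) =
      ∫ ξ, -(c t * S.lam ξ ^ 2 * (flowField S c u₀ u₁ t ξ).1) * S.U (v : H) ξ ∂μ := by
    rw [inner_eq_integral S, ← integral_const_mul, ← integral_neg]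
    refine integral_congr_ae ?_
    filter_upwards [hdom.U_linSol hc hW1 hτ ht, S.apply_ae v] with ξ e1 e2
    rw [e1, e2]; ring
  rw [hasDerivWithinAt_iff_tendsto_slope, hlim]
  have hint : ∀ s ∈ Icc 0 τ, Integrable (fun ξ => (flowField S c u₀ u₁ s ξ).2 * S.U (v : H) ξ) μ :=
    fun s hs => (hdom.memLp_snd hc hW1 hτ hs).integrable_mul (Lp.memLp (S.U (v : H)))
  have hslope : (slope (fun s => inner ℝ (linVel S c u₀ u₁ s) (v : H)) t) =ᶠ[𝓝[Icc 0 τ \ {t}] t]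
      fun s => ∫ ξ, (s - t)⁻¹ * ((flowField S c u₀ u₁ s ξ).2 - (flowField S c u₀ u₁ t ξ).2) *
        S.U (v : H) ξ ∂μ := by
    filter_upwards [self_mem_nhdsWithin] with s hs
    rw [slope_def_module, hinner s hs.1, hinner t ht, ← integral_sub (hint s hs.1) (hint t ht),
      smul_eq_mul, ← integral_const_mul]
    refine integral_congr_ae (Eventually.of_forall fun ξ => ?_)
    simp only
    ring
  rw [tendsto_congr' hslope]
  -- The velocity has difference quotients of size Kλ²√D. The factor λ² is moved onto the test
  -- vector, which lies in D(A), and Young's inequality gives the majorant.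
  refine tendsto_integral_filter_of_dominated_convergence
    (fun ξ => K * (D ξ + (S.lam ξ ^ 2 * S.U (v : H) ξ) ^ 2)) ?_ ?_
    ((hdom.1.add hv.integrable_sq).const_mul K) (Eventually.of_forall fun ξ => ?_)
  · filter_upwards [self_mem_nhdsWithin] with s hs
    have h1 := (hdom.memLp_snd hc hW1 hτ hs.1).1
    have h2 := (hdom.memLp_snd hc hW1 hτ ht).1
    exact (((h1.sub h2).const_mul _)).mul hvm
  · filter_upwards [self_mem_nhdsWithin] with s hs
    refine Eventually.of_forall fun ξ => ?_
    have hD0 : 0 ≤ D ξ := (sq_nonneg _).trans (hdom.sq_fst_le hW1 ht ξ)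
    have hy : ∀ r ∈ Icc 0 τ, ‖-(c r * S.lam ξ ^ 2 * (flowField S c u₀ u₁ r ξ).1)‖ ≤
        K * (S.lam ξ ^ 2 * √(D ξ)) := fun r hr => by
      rw [norm_neg, mul_assoc, norm_mul, norm_mul, norm_pow, Real.norm_eq_abs (S.lam ξ), sq_abs]
      have e1 : ‖c r‖ ≤ K := hK r (hsub hr)
      have e2 : ‖(flowField S c u₀ u₁ r ξ).1‖ ≤ √(D ξ) := by
        refine Real.le_sqrt_of_sq_le ?_
        rw [Real.norm_eq_abs, sq_abs]
        exact hdom.sq_fst_le hW1 hr ξ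
      gcongr
    have hmv := (convex_Icc 0 τ).norm_image_sub_le_of_norm_hasDerivWithin_le
      (fun x hx => ((isOscillator_flowField (S := S) hc u₀ u₁ ξ).hasDerivWithinAt_snd
        (hsub hx)).mono hsub) hy ht hs.1
    have hst : 0 < ‖s - t‖ := norm_pos_iff.2 (sub_ne_zero.2 hs.2)
    have h1 : ‖(s - t)⁻¹ * ((flowField S c u₀ u₁ s ξ).2 - (flowField S c u₀ u₁ t ξ).2)‖ ≤
        K * (S.lam ξ ^ 2 * √(D ξ)) := by
      rw [norm_mul, norm_inv, inv_mul_le_iff₀ hst, mul_comm ‖s - t‖]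
      exact hmv
    rw [norm_mul]
    calc _ ≤ K * (S.lam ξ ^ 2 * √(D ξ)) * ‖S.U (v : H) ξ‖ := by gcongr
      _ = K * (√(D ξ) * (S.lam ξ ^ 2 * |S.U (v : H) ξ|)) := by rw [Real.norm_eq_abs]; ring
      _ ≤ K * (√(D ξ) ^ 2 + (S.lam ξ ^ 2 * |S.U (v : H) ξ|) ^ 2) := by
          gcongr
          nlinarith [sq_nonneg (√(D ξ) - S.lam ξ ^ 2 * |S.U (v : H) ξ|), Real.sqrt_nonneg (D ξ),
            (by positivity : 0 ≤ S.lam ξ ^ 2 * |S.U (v : H) ξ|)]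
      _ = _ := by rw [Real.sq_sqrt hD0, mul_pow, sq_abs, ← mul_pow]
  · have h1 := (isOscillator_flowField (S := S) hc u₀ u₁ ξ).hasDerivWithinAt_snd (hsub ht)
    have h2 := hasDerivWithinAt_iff_tendsto_slope.1 (h1.mono hsub)
    have := h2.mul_const (S.U (v : H) ξ)
    simpa [slope_def_module] using this

end

/-- Regularity of the solution of the linear problem in Gevrey spaces. -/
lemma Dominated.gevrey_regularity {φ : ℝ → ℝ} {r α τ : ℝ} (hα : 0 < α)
    (hφm : AEMeasurable (fun ξ => φ (S.lam ξ)) μ) {c : ℝ → ℝ} (hc : Continuous c) {u₀ u₁ : H}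
    {D : M → ℝ} (hτ : τ ≤ 1)
    (hdom : Dominated S c u₀ u₁ (fun ξ => gevreyWeight φ r α (S.lam ξ)) τ D) :
    C1Gevrey S φ r α τ (linSol S c u₀ u₁) ∧ ContGevrey S φ r (α + 1 / 2) τ (linSol S c u₀ u₁) := by
  set W : M → ℝ := fun ξ => gevreyWeight φ r α (S.lam ξ) with hWdef
  have hW1 : ∀ ξ, 1 ≤ W ξ := fun ξ => one_le_gevreyWeight φ r α (S.lam_nonneg ξ)
  have hW0 : ∀ ξ, 0 ≤ W ξ := fun ξ => by linarith [hW1 ξ]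
  have hW : AEMeasurable W μ := by
    have h1 := S.measurable_lam
    exact (aemeasurable_const.add ((h1.pow_const _).aemeasurable.mul
      ((hφm.const_mul r).exp)))
  have hWh : ∀ ξ, gevreyWeight φ r (α + 1 / 2) (S.lam ξ) ≤ W ξ * (1 + S.lam ξ ^ 2) := fun ξ =>
    gevreyWeight_add_half_le φ r hα (S.lam_nonneg ξ)
  have hWa : ∀ ξ, W ξ ≤ W ξ * (1 + S.lam ξ ^ 2) := fun ξ => by
    nlinarith [hW0 ξ, sq_nonneg (S.lam ξ)]
  have hfin : ∀ t ∈ Icc 0 τ, totalEnergy S W (flowField S c u₀ u₁ t) < ∞ := fun t ht => by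
    refine lt_of_le_of_lt (lintegral_mono fun ξ => ENNReal.ofReal_le_ofReal (hdom.2 t ht ξ)) ?_
    refine lt_of_le_of_lt (lintegral_mono fun ξ => ?_) hdom.1.2
    rw [← ofReal_norm]; exact ENNReal.ofReal_le_ofReal (le_abs_self _)
  have hcont_sol : ∀ t ∈ Icc 0 τ, ∀ s ∈ Icc 0 τ, S.U (linSol S c u₀ u₁ s - linSol S c u₀ u₁ t)
      =ᵐ[μ] fun ξ => (flowField S c u₀ u₁ s ξ - flowField S c u₀ u₁ t ξ).1 := fun t ht s hs => by
    filter_upwards [U_sub_ae S (linSol S c u₀ u₁ s) (linSol S c u₀ u₁ t),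
      hdom.U_linSol hc hW1 hτ hs, hdom.U_linSol hc hW1 hτ ht] with ξ e1 e2 e3
    rw [e1, e2, e3, Prod.fst_sub]
  have hcont_vel : ∀ t ∈ Icc 0 τ, ∀ s ∈ Icc 0 τ, S.U (linVel S c u₀ u₁ s - linVel S c u₀ u₁ t)
      =ᵐ[μ] fun ξ => (flowField S c u₀ u₁ s ξ - flowField S c u₀ u₁ t ξ).2 := fun t ht s hs => by
    filter_upwards [U_sub_ae S (linVel S c u₀ u₁ s) (linVel S c u₀ u₁ t),
      hdom.U_linVel hc hW1 hτ hs, hdom.U_linVel hc hW1 hτ ht] with ξ e1 e2 e3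
    rw [e1, e2, e3, Prod.snd_sub]
  refine ⟨⟨fun t ht => ?_, linVel S c u₀ u₁, ⟨fun t ht => ?_, fun t ht => ?_⟩, fun t ht => ?_⟩,
    fun t ht => ?_, fun t ht => ?_⟩
  · rw [memGevrey_iff, wInt_congr (hdom.U_linSol hc hW1 hτ ht)]
    exact (wInt_fst_le hWa hW0 _).trans_lt (hfin t ht)
  · rw [memGevrey_iff, wInt_congr (hdom.U_linVel hc hW1 hτ ht)]
    exact (wInt_snd_le hW0 _).trans_lt (hfin t ht)
  · rw [tendsto_gevreyNorm_iff]
    refine tendsto_of_tendsto_of_tendsto_of_le_of_le' tendsto_const_nhds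
      (hdom.tendsto_sub hc hW1 hτ hW ht) (Eventually.of_forall fun _ => zero_le) ?_
    filter_upwards [self_mem_nhdsWithin] with s hs
    rw [wInt_congr (hcont_vel t ht s hs)]
    exact wInt_snd_le hW0 _
  · rw [tendsto_gevreyNorm_iff]
    refine (hdom.tendsto_slope hc hW1 hτ hW ht).congr' ?_
    filter_upwards [self_mem_nhdsWithin] with s hs
    refine wInt_congr ?_
    filter_upwards [U_sub_ae S ((s - t)⁻¹ • (linSol S c u₀ u₁ s - linSol S c u₀ u₁ t))
      (linVel S c u₀ u₁ t), U_smul_ae S (s - t)⁻¹ (linSol S c u₀ u₁ s - linSol S c u₀ u₁ t),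
      U_sub_ae S (linSol S c u₀ u₁ s) (linSol S c u₀ u₁ t), hdom.U_linSol hc hW1 hτ hs.1,
      hdom.U_linSol hc hW1 hτ ht, hdom.U_linVel hc hW1 hτ ht] with ξ e1 e2 e3 e4 e5 e6
    rw [e1, e2, e3, e4, e5, e6]
  · rw [memGevrey_iff, wInt_congr (hdom.U_linSol hc hW1 hτ ht)]
    exact (wInt_fst_le hWh hW0 _).trans_lt (hfin t ht)
  · rw [tendsto_gevreyNorm_iff]
    refine tendsto_of_tendsto_of_tendsto_of_le_of_le' tendsto_const_nhds
      (hdom.tendsto_sub hc hW1 hτ hW ht) (Eventually.of_forall fun _ => zero_le) ?_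
    filter_upwards [self_mem_nhdsWithin] with s hs
    rw [wInt_congr (hcont_sol t ht s hs)]
    exact wInt_fst_le hWh hW0 _

end Linear

/-! ### Linearity and Wronskian of the scalar flow -/

lemma oscFlow_smul {b : ℝ → ℝ} (hb : Continuous b) (a : ℝ) (x : ℝ × ℝ) {t : ℝ}
    (ht : t ∈ Icc (0 : ℝ) 1) : oscFlow b (a • x) t = a • oscFlow b x t := by
  have h : IsOscillator b (fun t => a • oscFlow b x t) := by
    intro s hs
    refine ((isOscillator_oscFlow hb x s hs).const_smul a).congr_deriv (Prod.ext rfl ?_)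
    simp only [Prod.smul_snd, Prod.smul_fst, smul_eq_mul]
    ring
  exact (isOscillator_oscFlow hb (a • x)).eqOn hb h le_rfl (fun _ _ => rfl)
    (by simp [oscFlow_zero hb]) ht

lemma oscFlow_add {b : ℝ → ℝ} (hb : Continuous b) (x y : ℝ × ℝ) {t : ℝ} (ht : t ∈ Icc (0 : ℝ) 1) :
    oscFlow b (x + y) t = oscFlow b x t + oscFlow b y t := by
  have h := oscFlow_sub hb x ((-1 : ℝ) • y) ht
  rw [oscFlow_smul hb _ _ ht] at h
  simpa using h

/-- The Wronskian of the two fundamental solutions is constant. -/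
lemma oscFlow_wronskian {b : ℝ → ℝ} (hb : Continuous b) {t : ℝ} (ht : t ∈ Icc (0 : ℝ) 1) :
    (oscFlow b (1, 0) t).1 * (oscFlow b (0, 1) t).2 -
      (oscFlow b (0, 1) t).1 * (oscFlow b (1, 0) t).2 = 1 := by
  have hd : ∀ s ∈ Icc (0 : ℝ) 1, HasDerivWithinAt (fun s => (oscFlow b (1, 0) s).1 *
      (oscFlow b (0, 1) s).2 - (oscFlow b (0, 1) s).1 * (oscFlow b (1, 0) s).2) 0 (Icc 0 1) s := by
    intro s hs
    have h1 := isOscillator_oscFlow hb (1, 0)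
    have h2 := isOscillator_oscFlow hb (0, 1)
    refine (((h1.hasDerivWithinAt_fst hs).mul (h2.hasDerivWithinAt_snd hs)).sub
      ((h2.hasDerivWithinAt_fst hs).mul (h1.hasDerivWithinAt_snd hs))).congr_deriv ?_
    ring
  have h := (convex_Icc (0 : ℝ) 1).norm_image_sub_le_of_norm_hasDerivWithin_le (C := 0) hd
    (fun s _ => by simp) ⟨le_rfl, zero_le_one⟩ ht
  rw [zero_mul, norm_le_zero_iff, sub_eq_zero] at h
  rw [h]
  simp [oscFlow_zero hb]

/-- Product rule for `⟨f, v⟩`, where `f` is continuous and weakly differentiable. -/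
lemma hasDerivWithinAt_inner_of_weak {H : Type*} [NormedAddCommGroup H] [InnerProductSpace ℝ H]
    {f v : ℝ → H} {v' : H} {a t : ℝ} {s : Set ℝ} (hf : ContinuousWithinAt f s t)
    (hw : HasDerivWithinAt (fun r => inner ℝ (f r) (v t)) a s t) (hv : HasDerivWithinAt v v' s t) :
    HasDerivWithinAt (fun r => inner ℝ (f r) (v r)) (a + inner ℝ (f t) v') s t := by
  rw [hasDerivWithinAt_iff_tendsto_slope] at hw hv ⊢
  have h1 : Tendsto (fun r => (inner ℝ (f r) (slope v t r) : ℝ)) (𝓝[s \ {t}] t)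
      (𝓝 (inner ℝ (f t) v')) := (hf.mono_left (nhdsWithin_mono _ sdiff_subset)).inner hv
  refine (hw.add h1).congr fun r => ?_
  simp only [slope_def_module, inner_smul_right, inner_sub_right, smul_eq_mul]
  ring

section Representation

variable {H : Type*} [NormedAddCommGroup H] [InnerProductSpace ℝ H] {A : H →ₗ.[ℝ] H}
  {M : Type*} [MeasurableSpace M] {μ : Measure M} {S : SpectralRep A μ}

/-! ### Weak solutions are given by the flow of the single frequencies -/

variable (S) in
/-- `h` is concentrated on the frequencies in `E`. -/
def SupportedOn (E : Set M) (h : H) : Prop := ∀ᵐ ξ ∂μ, ξ ∉ E → S.U h ξ = 0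

lemma memLp_lam_sq_mul {E : Set M} {k : ℝ} (hE : ∀ ξ ∈ E, S.lam ξ ≤ k) {h : H}
    (hs : SupportedOn S E h) : MemLp (fun ξ => S.lam ξ ^ 2 * S.U h ξ) 2 μ := by
  refine (Lp.memLp (S.U h)).of_le_mul (c := k ^ 2)
    (((S.measurable_lam.pow_const 2).aestronglyMeasurable).mul (aestronglyMeasurable_U S h)) ?_
  filter_upwards [hs] with ξ hξ
  rw [norm_mul, norm_pow, Real.norm_of_nonneg (S.lam_nonneg ξ)]
  by_cases h1 : ξ ∈ E
  · have := hE ξ h1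
    have := S.lam_nonneg ξ
    gcongr
  · rw [hξ h1]; simp

/-- On bounded frequencies the crude exponential growth is bounded, so no modulus of continuity of c
is used. This matters because the coefficient of a given weak solution is not yet known to be
admissible. -/
lemma exists_dominated_of_supportedOn {c : ℝ → ℝ} (hc : Continuous c) (hc0 : ∀ t, 0 ≤ c t) {B : ℝ}
    (hcB : ∀ t, c t ≤ B) {E : Set M} {k : ℝ} (hE : ∀ ξ ∈ E, S.lam ξ ≤ k) {g₀ g₁ : H}
    (h0 : SupportedOn S E g₀) (h1 : SupportedOn S E g₁) :
    ∃ D, Dominated S c g₀ g₁ (fun _ => 1) 1 D := by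
  have hB : 0 ≤ B := (hc0 0).trans (hcB 0)
  refine ⟨fun ξ => freqEnergy (S.lam ξ) (S.U g₀ ξ, S.U g₁ ξ) *
    Real.exp ((1 + S.lam ξ ^ 2) * (1 + B)), ?_, fun t ht ξ => ?_⟩
  · have hm : AEMeasurable (fun ξ => freqEnergy (S.lam ξ) (S.U g₀ ξ, S.U g₁ ξ)) μ :=
      aemeasurable_freqEnergy ((aestronglyMeasurable_U S g₀).aemeasurable.prodMk
        (aestronglyMeasurable_U S g₁).aemeasurable)
    have hl := S.measurable_lam
    have hm2 : Measurable fun ξ => Real.exp ((1 + S.lam ξ ^ 2) * (1 + B)) := by fun_prop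
    refine Integrable.mono' (((Lp.memLp (S.U g₁)).integrable_sq.add
      ((Lp.memLp (S.U g₀)).integrable_sq.const_mul (1 + k ^ 2))).mul_const
      (Real.exp ((1 + k ^ 2) * (1 + B)))) (hm.mul hm2.aemeasurable).aestronglyMeasurable ?_
    filter_upwards [h0, h1] with ξ e0 e1
    rw [Real.norm_of_nonneg (mul_nonneg (freqEnergy_nonneg _ _) (Real.exp_pos _).le)]
    by_cases hξ : ξ ∈ E
    · have := hE ξ hξ
      have := S.lam_nonneg ξ
      simp only [freqEnergy, Pi.add_apply]
      gcongr
    · simp [freqEnergy, e0 hξ, e1 hξ]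
  · have h2 := (isOscillator_flowField (S := S) hc g₀ g₁ ξ).low_energy_le hc0 hcB t ht
    rw [one_mul]
    rw [flowField_zero hc] at h2
    refine h2.trans ?_
    have h3 := freqEnergy_nonneg (S.lam ξ) (S.U g₀ ξ, S.U g₁ ξ)
    refine mul_le_mul_of_nonneg_left (Real.exp_le_exp.2 ?_) h3
    nlinarith [ht.2, (by positivity : 0 ≤ (1 + S.lam ξ ^ 2) * (1 + B))]

lemma oscFlow_data_zero {b : ℝ → ℝ} (hb : Continuous b) {t : ℝ} (ht : t ∈ Icc (0 : ℝ) 1) :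
    oscFlow b (0, 0) t = 0 := by
  have := oscFlow_smul hb 0 (0, 0) ht
  rw [zero_smul, zero_smul] at this
  exact this

variable {c : ℝ → ℝ} (hc : Continuous c) (hc0 : ∀ t, 0 ≤ c t) {B : ℝ} (hcB : ∀ t, c t ≤ B)
  {T : ℝ} (hT0 : 0 < T) (hT : T ≤ 1) {u u' : ℝ → H}
  (hd : ∀ t ∈ Icc 0 T, HasDerivWithinAt u (u' t) (Icc 0 T) t)
  (hcont : ContinuousOn u' (Icc 0 T))
  (hweak : ∀ v : A.domain, ∀ t ∈ Icc 0 T, HasDerivWithinAt (fun s => inner ℝ (u' s) (v : H))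
    (-(c t * inner ℝ (u t) (A v))) (Icc 0 T) t)
include hc hc0 hcB hT0 hT hd hcont hweak

/-- Green's identity between the weak solution and a linear solution of bounded spectrum. The latter
lies in D(A), so it may be used as a test vector, and the two terms containing A cancel by symmetry.
-/
lemma weak_wronskian_const {E : Set M} (hEm : MeasurableSet E) {k : ℝ}
    (hE : ∀ ξ ∈ E, S.lam ξ ≤ k) {g₀ g₁ : H}
    (h0 : SupportedOn S E g₀) (h1 : SupportedOn S E g₁) {t : ℝ} (ht : t ∈ Icc 0 T) :
    inner ℝ (u' t) (linSol S c g₀ g₁ t) - inner ℝ (u t) (linVel S c g₀ g₁ t) =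
      inner ℝ (u' 0) g₀ - (inner ℝ (u 0) g₁ : ℝ) := by
  obtain ⟨D, hD⟩ := exists_dominated_of_supportedOn hc hc0 hcB hE h0 h1
  have hW1 : ∀ ξ : M, (1 : ℝ) ≤ (fun _ => 1 : M → ℝ) ξ := fun _ => le_rfl
  have hsub : Icc 0 T ⊆ Icc (0 : ℝ) 1 := Icc_subset_Icc_right hT
  set v := linSol S c g₀ g₁ with hv
  set v' := linVel S c g₀ g₁ with hv'
  have hzero : ∀ s ∈ Icc (0 : ℝ) 1, ∀ᵐ ξ ∂μ, ξ ∉ E → flowField S c g₀ g₁ s ξ = 0 := by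
    intro s hs
    filter_upwards [h0, h1] with ξ e0 e1 hξ
    rw [flowField, e0 hξ, e1 hξ]
    exact oscFlow_data_zero (by fun_prop) hs
  have hsv : ∀ s ∈ Icc (0 : ℝ) 1, SupportedOn S E (v s) := fun s hs => by
    filter_upwards [hD.U_linSol hc hW1 le_rfl hs, hzero s hs] with ξ e1 e2 hξ
    rw [e1, e2 hξ]; rfl
  have hsv' : ∀ s ∈ Icc (0 : ℝ) 1, SupportedOn S E (v' s) := fun s hs => by
    filter_upwards [hD.U_linVel hc hW1 le_rfl hs, hzero s hs] with ξ e1 e2 hξ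
    rw [e1, e2 hξ]; rfl
  have hderiv : ∀ s ∈ Icc 0 T, HasDerivWithinAt
      (fun r => inner ℝ (u' r) (v r) - (inner ℝ (u r) (v' r) : ℝ)) 0 (Icc 0 T) s := by
    intro s hs
    have hvd : HasDerivWithinAt v (v' s) (Icc 0 T) s :=
      (hD.hasDerivWithinAt_linSol hc hW1 le_rfl aemeasurable_const (hsub hs)).mono hsub
    let vs : A.domain := ⟨v s, (S.mem_domain_iff _).2 (memLp_lam_sq_mul hE (hsv s (hsub hs)))⟩
    have e1 := hasDerivWithinAt_inner_of_weak (hcont s hs) (hweak vs s hs) hvd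
    -- the projection of `u s` on the frequencies in `E`
    set p : H := lift S (E.indicator (S.U (u s))) with hp
    have hpL : MemLp (E.indicator (S.U (u s))) 2 μ := (Lp.memLp (S.U (u s))).indicator hEm
    have hpU : S.U p =ᵐ[μ] E.indicator (S.U (u s)) := U_lift hpL
    have hps : SupportedOn S E p := by
      filter_upwards [hpU] with ξ e hξ
      rw [e, indicator_of_notMem hξ]
    let ps : A.domain := ⟨p, (S.mem_domain_iff _).2 (memLp_lam_sq_mul hE hps)⟩
    have e2 := (hD.weak_equation hc hW1 le_rfl ps (hsub hs)).mono hsub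
    have e3 : HasDerivWithinAt (fun r => inner ℝ (v' r) (u s))
        (-(c s * inner ℝ (v s) (A ps))) (Icc 0 T) s := by
      refine e2.congr_of_mem (fun r hr => ?_) hs
      rw [inner_eq_integral S, inner_eq_integral S]
      refine integral_congr_ae ?_
      filter_upwards [hpU, hsv' r (hsub hr)] with ξ a1 a2
      change S.U (v' r) ξ * S.U (u s) ξ = S.U (v' r) ξ * S.U p ξ
      by_cases hξ : ξ ∈ E
      · rw [a1, indicator_of_mem hξ]
      · rw [a2 hξ]; simp
    have e4 := hasDerivWithinAt_inner_of_weak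
      ((hD.continuousOn_linVel hc hW1 le_rfl aemeasurable_const).mono hsub s hs) e3 (hd s hs)
    have e5 := e1.sub e4
    -- Replacing u(s) by its projection changes nothing, because v(s) vanishes outside E.
    have e6 : (inner ℝ (v s) (A ps) : ℝ) = inner ℝ (u s) (A vs) := by
      rw [inner_eq_integral S, inner_eq_integral S]
      refine integral_congr_ae ?_
      filter_upwards [hpU, hsv s (hsub hs), S.apply_ae ps, S.apply_ae vs] with ξ a1 a2 a3 a4
      rw [a3, a4]
      change S.U (v s) ξ * (S.lam ξ ^ 2 * S.U p ξ) = S.U (u s) ξ * (S.lam ξ ^ 2 * S.U (v s) ξ)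
      by_cases hξ : ξ ∈ E
      · rw [a1, indicator_of_mem hξ]; ring
      · rw [a2 hξ]; simp
    refine (e5.congr_deriv ?_).congr_of_mem (fun r _ => ?_) hs
    · rw [e6, real_inner_comm (v' s) (u' s)]; ring
    · simp only [Pi.sub_apply]
      rw [real_inner_comm (v' r) (u r)]
  have h := (convex_Icc 0 T).norm_image_sub_le_of_norm_hasDerivWithin_le (C := 0) hderiv
    (fun s _ => by simp) ⟨le_rfl, hT0.le⟩ ht
  rw [zero_mul, norm_le_zero_iff, sub_eq_zero] at h
  rw [h, hv, hv', hD.linSol_zero hc hW1 le_rfl zero_le_one, hD.linVel_zero hc hW1 le_rfl zero_le_one]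

/-- The integrated identity is localised by a special choice of data. With a the pointwise defect
and g = a restricted to a set of bounded frequencies, the data (p g, q g) turn the identity into the
vanishing of the integral of a² over that set. -/
lemma weak_wronskian_ae (p q : ℝ) {t : ℝ} (ht : t ∈ Icc 0 T) :
    ∀ᵐ ξ ∂μ, S.U (u' t) ξ * (oscFlow (fun s => c s * S.lam ξ ^ 2) (p, q) t).1 -
      S.U (u t) ξ * (oscFlow (fun s => c s * S.lam ξ ^ 2) (p, q) t).2 =
      p * S.U (u' 0) ξ - q * S.U (u 0) ξ := by
  have hT1 : t ∈ Icc (0 : ℝ) 1 := ⟨ht.1, ht.2.trans hT⟩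
  have hW1 : ∀ ξ : M, (1 : ℝ) ≤ (fun _ => 1 : M → ℝ) ξ := fun _ => le_rfl
  set Z : M → ℝ × ℝ := fun ξ => oscFlow (fun s => c s * S.lam ξ ^ 2) (p, q) t with hZ
  have hZm : Measurable Z :=
    (continuous_oscFlow_param hc hT1).measurable.comp
      (S.measurable_lam.prodMk (measurable_const (a := (p, q))))
  set a : M → ℝ := fun ξ => S.U (u' t) ξ * (Z ξ).1 - S.U (u t) ξ * (Z ξ).2 -
    (p * S.U (u' 0) ξ - q * S.U (u 0) ξ) with ha
  have ham : AEStronglyMeasurable a μ := by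
    have h1 := (measurable_fst.comp hZm).aestronglyMeasurable (μ := μ)
    have h2 := (measurable_snd.comp hZm).aestronglyMeasurable (μ := μ)
    exact (((aestronglyMeasurable_U S _).mul h1).sub ((aestronglyMeasurable_U S _).mul h2)).sub
      (((aestronglyMeasurable_U S _).const_mul p).sub ((aestronglyMeasurable_U S _).const_mul q))
  -- These sets exhaust M. The bound on λ allows spectrally bounded testing, the bound on Z makes
  -- the truncated defect square integrable.
  let E : ℕ → Set M := fun k => {ξ | S.lam ξ ≤ k ∧ ‖Z ξ‖ ≤ k}
  have hEm : ∀ k, MeasurableSet (E k) := fun k =>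
    (measurableSet_le S.measurable_lam measurable_const).inter
      (measurableSet_le hZm.norm measurable_const)
  have hzero : ∀ k, ∀ᵐ ξ ∂μ, ξ ∈ E k → a ξ = 0 := by
    intro k
    have hgL : MemLp ((E k).indicator a) 2 μ := by
      have hbound : MemLp (fun ξ => (k : ℝ) * |S.U (u' t) ξ| + k * |S.U (u t) ξ| +
          (|p| * |S.U (u' 0) ξ| + |q| * |S.U (u 0) ξ|)) 2 μ :=
        (((Lp.memLp (S.U (u' t))).abs.const_mul _).add ((Lp.memLp (S.U (u t))).abs.const_mul _)).add
          (((Lp.memLp (S.U (u' 0))).abs.const_mul _).add ((Lp.memLp (S.U (u 0))).abs.const_mul _))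
      refine hbound.of_le (ham.indicator (hEm k)) (Eventually.of_forall fun ξ => ?_)
      refine le_trans ?_ (le_abs_self _)
      by_cases hξ : ξ ∈ E k
      · rw [indicator_of_mem hξ, Real.norm_eq_abs]
        have z1 : |(Z ξ).1| ≤ k := (norm_fst_le (Z ξ)).trans hξ.2
        have z2 : |(Z ξ).2| ≤ k := (norm_snd_le (Z ξ)).trans hξ.2
        have t1 : |S.U (u' t) ξ * (Z ξ).1| ≤ k * |S.U (u' t) ξ| := by
          rw [abs_mul, mul_comm]; gcongr
        have t2 : |S.U (u t) ξ * (Z ξ).2| ≤ k * |S.U (u t) ξ| := by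
          rw [abs_mul, mul_comm]; gcongr
        calc |a ξ| ≤ |S.U (u' t) ξ * (Z ξ).1| + |S.U (u t) ξ * (Z ξ).2| +
              (|p * S.U (u' 0) ξ| + |q * S.U (u 0) ξ|) :=
              (abs_sub _ _).trans (add_le_add (abs_sub _ _) (abs_sub _ _))
          _ ≤ _ := by rw [abs_mul p, abs_mul q]; gcongr
      · rw [indicator_of_notMem hξ, norm_zero]
        positivity
    set g : H := lift S ((E k).indicator a) with hg
    have hgU : S.U g =ᵐ[μ] (E k).indicator a := U_lift hgL
    have hgs : SupportedOn S (E k) g := by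
      filter_upwards [hgU] with ξ e hξ
      rw [e, indicator_of_notMem hξ]
    have hgsm : ∀ r : ℝ, SupportedOn S (E k) (r • g) := fun r => by
      filter_upwards [hgs, U_smul_ae S r g] with ξ e1 e2 hξ
      rw [e2, e1 hξ, mul_zero]
    have hEk : ∀ ξ ∈ E k, S.lam ξ ≤ k := fun ξ hξ => hξ.1
    have hw := weak_wronskian_const hc hc0 hcB hT0 hT hd hcont hweak (hEm k) hEk (hgsm p) (hgsm q) ht
    obtain ⟨D, hD⟩ := exists_dominated_of_supportedOn hc hc0 hcB hEk (hgsm p) (hgsm q)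
    have hflow : flowField S c (p • g) (q • g) t =ᵐ[μ] fun ξ => S.U g ξ • Z ξ := by
      filter_upwards [U_smul_ae S p g, U_smul_ae S q g] with ξ e1 e2
      rw [flowField, e1, e2, hZ]
      simp only
      rw [← oscFlow_smul (by fun_prop) _ _ hT1]
      congr 1
      simp [mul_comm]
    have hi : ∀ x y : H, Integrable (fun ξ => S.U x ξ * S.U y ξ) μ := fun x y =>
      (Lp.memLp (S.U x)).integrable_mul (Lp.memLp (S.U y))
    have hi2 : ∀ x y z w : H, Integrable (fun ξ => S.U x ξ * S.U y ξ - S.U z ξ * S.U w ξ) μ :=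
      fun x y z w => (hi x y).sub (hi z w)
    have hint : ∫ ξ, (E k).indicator a ξ ^ 2 ∂μ = 0 := by
      rw [inner_eq_integral S, inner_eq_integral S, inner_eq_integral S, inner_eq_integral S,
        ← integral_sub (hi _ _) (hi _ _), ← integral_sub (hi _ _) (hi _ _), ← sub_eq_zero,
        ← integral_sub (hi2 _ _ _ _) (hi2 _ _ _ _)] at hw
      rw [← hw]
      refine integral_congr_ae ?_
      filter_upwards [hgU, hflow, hD.U_linSol hc hW1 le_rfl hT1, hD.U_linVel hc hW1 le_rfl hT1,
        U_smul_ae S p g, U_smul_ae S q g] with ξ e1 e2 e3 e4 e5 e6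
      rw [e3, e4, e2, e5, e6, e1]
      by_cases hξ : ξ ∈ E k
      · rw [indicator_of_mem hξ]
        simp only [Prod.smul_fst, Prod.smul_snd, smul_eq_mul, ha]
        ring
      · simp [indicator_of_notMem hξ]
    have h0 := (integral_eq_zero_iff_of_nonneg (fun ξ => sq_nonneg _) hgL.integrable_sq).1 hint
    filter_upwards [h0] with ξ e hξ
    rw [indicator_of_mem hξ] at e
    simpa using e
  filter_upwards [ae_all_iff.2 hzero] with ξ h
  obtain ⟨k, hk⟩ := exists_nat_ge (max (S.lam ξ) ‖Z ξ‖)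
  have := h k ⟨(le_max_left _ _).trans hk, (le_max_right _ _).trans hk⟩
  exact sub_eq_zero.1 this

/-- A weak solution of the linear problem is given by the flow of the single frequencies. -/
theorem weak_solution_eq_flow {t : ℝ} (ht : t ∈ Icc 0 T) :
    ∀ᵐ ξ ∂μ, flowField S c (u 0) (u' 0) t ξ = (S.U (u t) ξ, S.U (u' t) ξ) := by
  have hT1 : t ∈ Icc (0 : ℝ) 1 := ⟨ht.1, ht.2.trans hT⟩
  filter_upwards [weak_wronskian_ae hc hc0 hcB hT0 hT hd hcont hweak 1 0 ht,
    weak_wronskian_ae hc hc0 hcB hT0 hT hd hcont hweak 0 1 ht] with ξ h1 h2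
  have hb : Continuous fun s => c s * S.lam ξ ^ 2 := by fun_prop
  have hw := oscFlow_wronskian hb hT1
  have hlin : flowField S c (u 0) (u' 0) t ξ =
      S.U (u 0) ξ • oscFlow (fun s => c s * S.lam ξ ^ 2) (1, 0) t +
      S.U (u' 0) ξ • oscFlow (fun s => c s * S.lam ξ ^ 2) (0, 1) t := by
    rw [flowField, ← oscFlow_smul hb _ _ hT1, ← oscFlow_smul hb _ _ hT1, ← oscFlow_add hb _ _ hT1]
    simp
  rw [hlin]
  set P := oscFlow (fun s => c s * S.lam ξ ^ 2) (1, 0) t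
  set Q := oscFlow (fun s => c s * S.lam ξ ^ 2) (0, 1) t
  -- The two Wronskian identities express the initial values through the values at t; as the
  -- fundamental matrix has determinant 1, they can be inverted.
  have e1 : S.U (u' 0) ξ = S.U (u' t) ξ * P.1 - S.U (u t) ξ * P.2 := by linarith
  have e0 : S.U (u 0) ξ = S.U (u t) ξ * Q.2 - S.U (u' t) ξ * Q.1 := by linarith
  ext
  · simp only [Prod.fst_add, Prod.smul_fst, smul_eq_mul]
    rw [e0, e1]
    linear_combination S.U (u t) ξ * hw
  · simp only [Prod.snd_add, Prod.smul_snd, smul_eq_mul]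
    rw [e0, e1]
    linear_combination S.U (u' t) ξ * hw

end Representation

/-! ### Uniform constants and estimates for the linear problem -/

/-- A choice of constants for which the energy estimate of the linear problem provides a uniform
control of the nonlinear problem: `D₀` bounds the data, `B` bounds `|A^{1/2} u|²`, the coefficient
takes its values in `[ν, cmax]`, `K` bounds the energy, `T` is the life span. -/
structure EnergyConstants (ω φ : ℝ → ℝ) (ν L r₀ α : ℝ) where
  (cmax D₀ B C C₁ K L' κ T : ℝ)
  hω : IsContinuityModulus ω
  hφ : ∀ σ : ℝ, 0 ≤ σ → 1 ≤ φ σ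
  hφ_bdd : ∃ δ : ℝ, 0 < δ ∧ ∃ C : ℝ, ∀ σ ∈ Icc 0 δ, φ σ ≤ C
  hα : 1 / 4 ≤ α
  ν_le : ν ≤ cmax
  D₀_nonneg : 0 ≤ D₀
  one_le_C : 1 ≤ C
  C₁_nonneg : 0 ≤ C₁
  K_gt : C * C₁ * D₀ < K
  le_L' : |L| * (2 * K + 1) ≤ L'
  κ_nonneg : 0 ≤ κ
  T_pos : 0 < T
  T_le : T ≤ 1
  κ_mul_T : κ * T ≤ r₀ / 2
  R_mul_T : (κ + 1) * T < r₀
  B_ge : D₀ + 2 * K * T ≤ B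
  energy : ∀ c : ℝ → ℝ, CoeffClass ω ν cmax L' c →
      ∀ lam : ℝ, 0 ≤ lam → ∀ z : ℝ → ℝ × ℝ, IsOscillator (fun s => c s * lam ^ 2) z →
        ∀ t ∈ Icc (0 : ℝ) 1, freqEnergy lam (z t) ≤
          C * φ lam * Real.exp (κ * φ lam * t) * freqEnergy lam (z 0)
  phase : ∀ lam, 0 ≤ lam →
      lam * (φ lam * Real.exp (r₀ / 2 * φ lam)) ≤ C₁ * gevreyWeight φ r₀ α lam

lemma freqEnergy_add_le (lam : ℝ) (x y : ℝ × ℝ) :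
    freqEnergy lam (x + y) ≤ 2 * freqEnergy lam x + 2 * freqEnergy lam y := by
  have h := freqEnergy_sub_le lam x (-y)
  have h2 : freqEnergy lam (-y) = freqEnergy lam y := by simp [freqEnergy]
  rwa [sub_neg_eq_add, h2] at h

/-- Whenever the supremum exceeds ε, a time where ε is exceeded can be selected. Uniformity in time
thus reduces to convergence along an arbitrary sequence of times, where dominated convergence
applies. -/
lemma tendsto_biSup_zero {ι : Type*} {s : Set ι} (hs : s.Nonempty) {f : ℕ → ι → ℝ≥0∞}
    (h : ∀ t : ℕ → ι, (∀ n, t n ∈ s) → Tendsto (fun n => f n (t n)) atTop (𝓝 0)) :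
    Tendsto (fun n => ⨆ t ∈ s, f n t) atTop (𝓝 0) := by
  classical
  rw [ENNReal.tendsto_nhds_zero]
  intro ε hε
  let t : ℕ → ι := fun n => if H : ∃ x ∈ s, ε < f n x then H.choose else hs.some
  have ht : ∀ n, t n ∈ s := fun n => by
    simp only [t]
    split_ifs with H
    · exact H.choose_spec.1
    · exact hs.some_mem
  filter_upwards [(ENNReal.tendsto_nhds_zero.1 (h t ht)) ε hε] with n hn
  refine iSup₂_le fun x hx => ?_
  by_contra hlt
  have H : ∃ x ∈ s, ε < f n x := ⟨x, hx, not_le.1 hlt⟩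
  have h2 : ε < f n (t n) := by
    simp only [t, dif_pos H]
    exact H.choose_spec.2
  exact absurd hn (not_le.2 h2)

section

variable {H : Type*} [NormedAddCommGroup H] [InnerProductSpace ℝ H] {A : H →ₗ.[ℝ] H}
  {M : Type*} [MeasurableSpace M] {μ : Measure M}

/-- The square of the norm of the data `(u₀, u₁)` in `G_{φ,r,α+1/2}(A) × G_{φ,r,α}(A)`, up to
equivalence. -/
noncomputable def dataEnergy (S : SpectralRep A μ) (φ : ℝ → ℝ) (r α : ℝ) (u₀ u₁ : H) : ℝ≥0∞ :=
  totalEnergy S (fun ξ => gevreyWeight φ r α (S.lam ξ)) fun ξ => (S.U u₀ ξ, S.U u₁ ξ)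

variable {S : SpectralRep A μ}

lemma totalEnergy_le {W W' : M → ℝ} {C : ℝ} (hC : 0 ≤ C) {X X' : M → ℝ × ℝ}
    (h : ∀ ξ, W ξ * freqEnergy (S.lam ξ) (X ξ) ≤ C * (W' ξ * freqEnergy (S.lam ξ) (X' ξ))) :
    totalEnergy S W X ≤ ENNReal.ofReal C * totalEnergy S W' X' := by
  rw [totalEnergy, totalEnergy, ← lintegral_const_mul' _ _ ENNReal.ofReal_ne_top]
  refine lintegral_mono fun ξ => ?_
  rw [← ENNReal.ofReal_mul hC]
  exact ENNReal.ofReal_le_ofReal (h ξ)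

lemma totalEnergy_congr {W : M → ℝ} {X Y : M → ℝ × ℝ} (h : X =ᵐ[μ] Y) :
    totalEnergy S W X = totalEnergy S W Y :=
  lintegral_congr_ae (by filter_upwards [h] with ξ hξ; simp only [hξ])

lemma totalEnergy_add_le {W : M → ℝ} (hW : AEMeasurable W μ) (hW0 : ∀ ξ, 0 ≤ W ξ)
    {X Y : M → ℝ × ℝ} (hX : AEMeasurable X μ) :
    totalEnergy S W (fun ξ => X ξ + Y ξ) ≤ 2 * totalEnergy S W X + 2 * totalEnergy S W Y := by
  have h2 : (2 : ℝ≥0∞) = ENNReal.ofReal 2 := by simp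
  rw [totalEnergy, totalEnergy, totalEnergy, h2, ← lintegral_const_mul' _ _ ENNReal.ofReal_ne_top,
    ← lintegral_const_mul' _ _ ENNReal.ofReal_ne_top, ← lintegral_add_left']
  · refine lintegral_mono fun ξ => ?_
    have a := mul_nonneg (hW0 ξ) (freqEnergy_nonneg (S.lam ξ) (X ξ))
    have b := mul_nonneg (hW0 ξ) (freqEnergy_nonneg (S.lam ξ) (Y ξ))
    rw [← ENNReal.ofReal_mul zero_le_two, ← ENNReal.ofReal_mul zero_le_two,
      ← ENNReal.ofReal_add (by positivity) (by positivity)]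
    refine ENNReal.ofReal_le_ofReal ?_
    have := mul_le_mul_of_nonneg_left (freqEnergy_add_le (S.lam ξ) (X ξ) (Y ξ)) (hW0 ξ)
    linarith
  · exact ((hW.mul (aemeasurable_freqEnergy hX)).ennreal_ofReal).const_mul _

lemma integrable_of_totalEnergy {W : M → ℝ} (hW : AEMeasurable W μ) (hW0 : ∀ ξ, 0 ≤ W ξ)
    {X : M → ℝ × ℝ} (hX : AEMeasurable X μ) (h : totalEnergy S W X < ∞) :
    Integrable (fun ξ => W ξ * freqEnergy (S.lam ξ) (X ξ)) μ := by
  refine ⟨(hW.mul (aemeasurable_freqEnergy hX)).aestronglyMeasurable, ?_⟩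
  rwa [hasFiniteIntegral_iff_ofReal
    (Eventually.of_forall fun ξ => mul_nonneg (hW0 ξ) (freqEnergy_nonneg _ _))]

lemma aemeasurable_data (u₀ u₁ : H) : AEMeasurable (fun ξ => (S.U u₀ ξ, S.U u₁ ξ)) μ :=
  (aestronglyMeasurable_U S u₀).aemeasurable.prodMk (aestronglyMeasurable_U S u₁).aemeasurable

lemma aemeasurable_gevreyWeight {φ : ℝ → ℝ} (hφm : AEMeasurable (fun ξ => φ (S.lam ξ)) μ)
    (r α : ℝ) : AEMeasurable (fun ξ => gevreyWeight φ r α (S.lam ξ)) μ :=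
  aemeasurable_const.add ((S.measurable_lam.pow_const _).aemeasurable.mul ((hφm.const_mul r).exp))

lemma gevreyWeight_nonneg (φ : ℝ → ℝ) (r α : ℝ) (ξ : M) :
    0 ≤ gevreyWeight φ r α (S.lam ξ) :=
  zero_le_one.trans (one_le_gevreyWeight φ r α (S.lam_nonneg ξ))

lemma powNormSq_half_le_dataEnergy {φ : ℝ → ℝ} (r α : ℝ) (u₀ u₁ : H) :
    powNormSq S (1 / 2) u₀ ≤ dataEnergy S φ r α u₀ u₁ := by
  refine lintegral_mono fun ξ => ENNReal.ofReal_le_ofReal ?_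
  have h1 := one_le_gevreyWeight φ r α (S.lam_nonneg ξ)
  have h2 := freqEnergy_nonneg (S.lam ξ) (S.U u₀ ξ, S.U u₁ ξ)
  have h3 : S.lam ξ ^ (4 * (1 / 2 : ℝ)) = S.lam ξ ^ 2 := by
    rw [show (4 * (1 / 2 : ℝ)) = (2 : ℕ) by norm_num, Real.rpow_natCast]
  rw [h3]
  have h4 : S.lam ξ ^ 2 * S.U u₀ ξ ^ 2 ≤ freqEnergy (S.lam ξ) (S.U u₀ ξ, S.U u₁ ξ) := by
    simp only [freqEnergy]
    nlinarith [sq_nonneg (S.U u₀ ξ), sq_nonneg (S.U u₁ ξ)]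
  simp only
  nlinarith

namespace EnergyConstants

variable {ω φ : ℝ → ℝ} {ν L r₀ α : ℝ} (k : EnergyConstants ω φ ν L r₀ α)

/-- The coefficients that are controlled by the constants. -/
abbrev Coeff (c : ℝ → ℝ) : Prop := CoeffClass ω ν k.cmax k.L' c

/-- The nonlinearities that are controlled by the constants. -/
structure Admits (m : ℝ → ℝ) : Prop where
  nonneg : ∀ σ : ℝ, 0 ≤ σ → 0 ≤ m σ
  modulus : OmegaContinuousWith ω m L
  lower : ∀ σ ∈ Icc 0 k.B, ν ≤ m σ
  upper : ∀ σ ∈ Icc 0 k.B, m σ ≤ k.cmax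

include k in
lemma α_pos : 0 < α := by linarith [k.hα]

lemma K_pos : 0 < k.K :=
  (mul_nonneg (mul_nonneg (zero_le_one.trans k.one_le_C) k.C₁_nonneg) k.D₀_nonneg).trans_lt k.K_gt

lemma coeff_continuous {c : ℝ → ℝ} (hc : k.Coeff c) : Continuous c := hc.continuous k.hω

/-- The energy estimate in the scale of Gevrey spaces. -/
lemma exists_scale_bound {R τ : ℝ} (hR : k.κ + 1 ≤ R) (hτ : 0 < τ) (hτ1 : τ ≤ 1)
    (hRτ : R * τ ≤ r₀) :
    ∃ C, 0 ≤ C ∧ ∀ c, k.Coeff c → ∀ u₀ u₁ : H, ∀ t ∈ Icc 0 τ, ∀ ξ,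
      gevreyWeight φ (r₀ - R * τ) α (S.lam ξ) *
        freqEnergy (S.lam ξ) (flowField S c u₀ u₁ t ξ) ≤
      C * (gevreyWeight φ r₀ α (S.lam ξ) * freqEnergy (S.lam ξ) (S.U u₀ ξ, S.U u₁ ξ)) := by
  obtain ⟨C, hC, h⟩ := exists_weight_loss k.hφ k.hφ_bdd k.α_pos k.κ_nonneg hR hτ hRτ
  have hC1 := k.one_le_C
  refine ⟨k.C * C, by positivity, fun c hc u₀ u₁ t ht ξ => ?_⟩
  have hcc := k.coeff_continuous hc
  have h1 := k.energy c hc (S.lam ξ) (S.lam_nonneg ξ) _ (isOscillator_flowField hcc u₀ u₁ ξ) t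
    ⟨ht.1, ht.2.trans hτ1⟩
  rw [flowField_zero hcc] at h1
  have h2 := h t ht (S.lam ξ) (S.lam_nonneg ξ)
  have hE := freqEnergy_nonneg (S.lam ξ) (S.U u₀ ξ, S.U u₁ ξ)
  have hW := gevreyWeight_nonneg (S := S) φ (r₀ - R * τ) α ξ
  calc _ ≤ gevreyWeight φ (r₀ - R * τ) α (S.lam ξ) *
        (k.C * φ (S.lam ξ) * Real.exp (k.κ * φ (S.lam ξ) * t) *
          freqEnergy (S.lam ξ) (S.U u₀ ξ, S.U u₁ ξ)) := by gcongr
    _ = k.C * (gevreyWeight φ (r₀ - R * τ) α (S.lam ξ) *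
        (φ (S.lam ξ) * Real.exp (k.κ * φ (S.lam ξ) * t))) *
          freqEnergy (S.lam ξ) (S.U u₀ ξ, S.U u₁ ξ) := by ring
    _ ≤ k.C * (C * gevreyWeight φ r₀ α (S.lam ξ)) *
          freqEnergy (S.lam ξ) (S.U u₀ ξ, S.U u₁ ξ) := by gcongr
    _ = _ := by ring

variable (hφm : AEMeasurable (fun ξ => φ (S.lam ξ)) μ)
include hφm

lemma exists_dominated {R τ : ℝ} (hR : k.κ + 1 ≤ R) (hτ : 0 < τ) (hτ1 : τ ≤ 1)
    (hRτ : R * τ ≤ r₀) {c : ℝ → ℝ} (hc : k.Coeff c) {u₀ u₁ : H}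
    (hdata : dataEnergy S φ r₀ α u₀ u₁ < ∞) :
    ∃ D, Dominated S c u₀ u₁ (fun ξ => gevreyWeight φ (r₀ - R * τ) α (S.lam ξ)) τ D := by
  obtain ⟨C, hC, h⟩ := k.exists_scale_bound (S := S) hR hτ hτ1 hRτ
  exact ⟨_, (integrable_of_totalEnergy (aemeasurable_gevreyWeight hφm r₀ α)
    (gevreyWeight_nonneg φ r₀ α) (aemeasurable_data u₀ u₁) hdata).const_mul C,
    fun t ht ξ => h c hc u₀ u₁ t ht ξ⟩

lemma inScale_linSol {R T : ℝ} (hR : k.κ + 1 ≤ R) (hT1 : T ≤ 1) (hRT : R * T ≤ r₀)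
    {c : ℝ → ℝ} (hc : k.Coeff c) {u₀ u₁ : H} (hdata : dataEnergy S φ r₀ α u₀ u₁ < ∞) :
    InScale S φ r₀ R α T (linSol S c u₀ u₁) := by
  intro τ hτ
  have hR0 : 0 ≤ R := by linarith [k.κ_nonneg]
  obtain ⟨D, hD⟩ := k.exists_dominated hφm hR hτ.1 (hτ.2.trans hT1)
    ((mul_le_mul_of_nonneg_left hτ.2 hR0).trans hRT) hc hdata
  exact hD.gevrey_regularity k.α_pos hφm (k.coeff_continuous hc) (hτ.2.trans hT1)

omit hφm in
/-- The energy estimate in the phase space. -/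
lemma lam_energy_le {c : ℝ → ℝ} (hc : k.Coeff c) {u₀ u₁ : H}
    (hdata : dataEnergy S φ r₀ α u₀ u₁ ≤ ENNReal.ofReal k.D₀) {t : ℝ} (ht : t ∈ Icc 0 k.T) :
    totalEnergy S S.lam (flowField S c u₀ u₁ t) ≤ ENNReal.ofReal (k.C * k.C₁ * k.D₀) := by
  have hC1 := k.one_le_C
  have hC₁ := k.C₁_nonneg
  have hcc := k.coeff_continuous hc
  have hCC : 0 ≤ k.C * k.C₁ := by positivity
  rw [ENNReal.ofReal_mul hCC]
  refine le_trans ?_ (mul_le_mul_right hdata _)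
  refine totalEnergy_le hCC fun ξ => ?_
  have h1 := k.energy c hc (S.lam ξ) (S.lam_nonneg ξ) _ (isOscillator_flowField hcc u₀ u₁ ξ) t
    ⟨ht.1, ht.2.trans k.T_le⟩
  rw [flowField_zero hcc] at h1
  have h2 := k.phase (S.lam ξ) (S.lam_nonneg ξ)
  have hE := freqEnergy_nonneg (S.lam ξ) (S.U u₀ ξ, S.U u₁ ξ)
  have hl := S.lam_nonneg ξ
  have hφ1 := k.hφ (S.lam ξ) hl
  have hκt : k.κ * t ≤ r₀ / 2 := (mul_le_mul_of_nonneg_left ht.2 k.κ_nonneg).trans k.κ_mul_T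
  have hexp : Real.exp (k.κ * φ (S.lam ξ) * t) ≤ Real.exp (r₀ / 2 * φ (S.lam ξ)) :=
    Real.exp_le_exp.2 (by nlinarith)
  calc S.lam ξ * freqEnergy (S.lam ξ) (flowField S c u₀ u₁ t ξ)
      ≤ S.lam ξ * (k.C * φ (S.lam ξ) * Real.exp (r₀ / 2 * φ (S.lam ξ)) *
          freqEnergy (S.lam ξ) (S.U u₀ ξ, S.U u₁ ξ)) := by
        gcongr
        exact h1.trans (mul_le_mul_of_nonneg_right
          (mul_le_mul_of_nonneg_left hexp (by positivity)) hE)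
    _ = k.C * (S.lam ξ * (φ (S.lam ξ) * Real.exp (r₀ / 2 * φ (S.lam ξ)))) *
          freqEnergy (S.lam ξ) (S.U u₀ ξ, S.U u₁ ξ) := by ring
    _ ≤ k.C * (k.C₁ * gevreyWeight φ r₀ α (S.lam ξ)) *
          freqEnergy (S.lam ξ) (S.U u₀ ξ, S.U u₁ ξ) := by gcongr
    _ = _ := by ring

-- Multiplied by λ, the frequency energy contains λy'² + λ³y², which are the densities of the two
-- terms of the phase energy.
omit hφm in
lemma powNormSq_add_le_totalEnergy {X : M → ℝ × ℝ} (hX : AEMeasurable X μ) {u v : H}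
    (hu : S.U u =ᵐ[μ] fun ξ => (X ξ).1) (hv : S.U v =ᵐ[μ] fun ξ => (X ξ).2) :
    powNormSq S (1 / 4) v + powNormSq S (3 / 4) u ≤ totalEnergy S S.lam X := by
  have e1 : powNormSq S (1 / 4) v = ∫⁻ ξ, ENNReal.ofReal (S.lam ξ * (X ξ).2 ^ 2) ∂μ := by
    refine lintegral_congr_ae ?_
    filter_upwards [hv] with ξ h
    rw [h, show (4 * (1 / 4) : ℝ) = 1 by norm_num, Real.rpow_one]
  have e2 : powNormSq S (3 / 4) u = ∫⁻ ξ, ENNReal.ofReal (S.lam ξ ^ 3 * (X ξ).1 ^ 2) ∂μ := by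
    refine lintegral_congr_ae ?_
    filter_upwards [hu] with ξ h
    rw [h, show (4 * (3 / 4) : ℝ) = (3 : ℕ) by norm_num, Real.rpow_natCast]
  have hm : AEMeasurable (fun ξ => ENNReal.ofReal (S.lam ξ * (X ξ).2 ^ 2)) μ :=
    (S.measurable_lam.aemeasurable.mul
      ((measurable_snd.comp_aemeasurable hX).pow_const 2)).ennreal_ofReal
  rw [e1, e2, ← lintegral_add_left' hm]
  refine lintegral_mono fun ξ => ?_
  have hl := S.lam_nonneg ξ
  rw [← ENNReal.ofReal_add (by positivity) (by positivity)]
  refine ENNReal.ofReal_le_ofReal ?_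
  simp only [freqEnergy]
  nlinarith [mul_nonneg hl (sq_nonneg (X ξ).1)]

lemma dominated_of_le_T {c : ℝ → ℝ} (hc : k.Coeff c) {u₀ u₁ : H}
    (hdata : dataEnergy S φ r₀ α u₀ u₁ < ∞) :
    ∃ D, Dominated S c u₀ u₁ (fun ξ => gevreyWeight φ (r₀ - (k.κ + 1) * k.T) α (S.lam ξ)) k.T D :=
  k.exists_dominated hφm le_rfl k.T_pos k.T_le k.R_mul_T.le hc hdata

lemma U_linSol {c : ℝ → ℝ} (hc : k.Coeff c) {u₀ u₁ : H}
    (hdata : dataEnergy S φ r₀ α u₀ u₁ < ∞) {t : ℝ} (ht : t ∈ Icc 0 k.T) :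
    S.U (linSol S c u₀ u₁ t) =ᵐ[μ] fun ξ => (flowField S c u₀ u₁ t ξ).1 := by
  obtain ⟨D, hD⟩ := k.dominated_of_le_T hφm hc hdata
  exact hD.U_linSol (k.coeff_continuous hc)
    (fun ξ => one_le_gevreyWeight _ _ _ (S.lam_nonneg ξ)) k.T_le ht

lemma U_linVel {c : ℝ → ℝ} (hc : k.Coeff c) {u₀ u₁ : H}
    (hdata : dataEnergy S φ r₀ α u₀ u₁ < ∞) {t : ℝ} (ht : t ∈ Icc 0 k.T) :
    S.U (linVel S c u₀ u₁ t) =ᵐ[μ] fun ξ => (flowField S c u₀ u₁ t ξ).2 := by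
  obtain ⟨D, hD⟩ := k.dominated_of_le_T hφm hc hdata
  exact hD.U_linVel (k.coeff_continuous hc)
    (fun ξ => one_le_gevreyWeight _ _ _ (S.lam_nonneg ξ)) k.T_le ht

lemma linSol_zero {c : ℝ → ℝ} (hc : k.Coeff c) {u₀ u₁ : H}
    (hdata : dataEnergy S φ r₀ α u₀ u₁ < ∞) : linSol S c u₀ u₁ 0 = u₀ := by
  obtain ⟨D, hD⟩ := k.dominated_of_le_T hφm hc hdata
  exact hD.linSol_zero (k.coeff_continuous hc)
    (fun ξ => one_le_gevreyWeight _ _ _ (S.lam_nonneg ξ)) k.T_le k.T_pos.le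

lemma linVel_zero {c : ℝ → ℝ} (hc : k.Coeff c) {u₀ u₁ : H}
    (hdata : dataEnergy S φ r₀ α u₀ u₁ < ∞) : linVel S c u₀ u₁ 0 = u₁ := by
  obtain ⟨D, hD⟩ := k.dominated_of_le_T hφm hc hdata
  exact hD.linVel_zero (k.coeff_continuous hc)
    (fun ξ => one_le_gevreyWeight _ _ _ (S.lam_nonneg ξ)) k.T_le k.T_pos.le

lemma hasDerivWithinAt_linSol {c : ℝ → ℝ} (hc : k.Coeff c) {u₀ u₁ : H}
    (hdata : dataEnergy S φ r₀ α u₀ u₁ < ∞) {τ : ℝ} (hτ : τ ≤ k.T) {t : ℝ} (ht : t ∈ Icc 0 τ) :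
    HasDerivWithinAt (linSol S c u₀ u₁) (linVel S c u₀ u₁ t) (Icc 0 τ) t := by
  obtain ⟨D, hD⟩ := k.dominated_of_le_T hφm hc hdata
  exact (hD.hasDerivWithinAt_linSol (k.coeff_continuous hc)
    (fun ξ => one_le_gevreyWeight _ _ _ (S.lam_nonneg ξ)) k.T_le
    (aemeasurable_gevreyWeight hφm _ _) (Icc_subset_Icc_right hτ ht)).mono
      (Icc_subset_Icc_right hτ)

lemma derivWithin_linSol {c : ℝ → ℝ} (hc : k.Coeff c) {u₀ u₁ : H}
    (hdata : dataEnergy S φ r₀ α u₀ u₁ < ∞) {τ : ℝ} (hτ0 : 0 < τ) (hτ : τ ≤ k.T) {t : ℝ}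
    (ht : t ∈ Icc 0 τ) :
    derivWithin (linSol S c u₀ u₁) (Icc 0 τ) t = linVel S c u₀ u₁ t :=
  (k.hasDerivWithinAt_linSol hφm hc hdata hτ ht).derivWithin (uniqueDiffOn_Icc hτ0 t ht)

lemma inPhaseSpace_linSol {τ : ℝ} (hτ0 : 0 < τ) (hτ : τ ≤ k.T) {c : ℝ → ℝ} (hc : k.Coeff c)
    {u₀ u₁ : H} (hdata : dataEnergy S φ r₀ α u₀ u₁ < ∞) :
    InPhaseSpace S τ (linSol S c u₀ u₁) := by
  have hRτ : (k.κ + 1) * τ ≤ r₀ :=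
    (mul_le_mul_of_nonneg_left hτ (by linarith [k.κ_nonneg])).trans k.R_mul_T.le
  exact (k.inScale_linSol hφm le_rfl (hτ.trans k.T_le) hRτ hc hdata).inPhaseSpace k.hφ k.hα hτ0 hRτ

lemma phaseEnergy_linSol_le {τ : ℝ} (hτ0 : 0 < τ) (hτ : τ ≤ k.T) {c : ℝ → ℝ} (hc : k.Coeff c)
    {u₀ u₁ : H} (hdata : dataEnergy S φ r₀ α u₀ u₁ ≤ ENNReal.ofReal k.D₀) {t : ℝ}
    (ht : t ∈ Icc 0 τ) :
    phaseEnergy S τ (linSol S c u₀ u₁) t ≤ ENNReal.ofReal (k.C * k.C₁ * k.D₀) := by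
  have hfin := hdata.trans_lt ENNReal.ofReal_lt_top
  have ht' := Icc_subset_Icc_right hτ ht
  rw [phaseEnergy, k.derivWithin_linSol hφm hc hfin hτ0 hτ ht]
  exact (powNormSq_add_le_totalEnergy (aemeasurable_flowField (k.coeff_continuous hc) u₀ u₁
    ⟨ht.1, ht'.2.trans k.T_le⟩) (k.U_linSol hφm hc hfin ht') (k.U_linVel hφm hc hfin ht')).trans
    (k.lam_energy_le hc hdata ht')

/-- The linear solution solves the Kirchhoff equation if the coefficient is the right one. -/
lemma isSolution_linSol {m : ℝ → ℝ} {τ : ℝ} (hτ0 : 0 < τ) (hτ : τ ≤ k.T) {c : ℝ → ℝ}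
    (hc : k.Coeff c) {u₀ u₁ : H} (hdata : dataEnergy S φ r₀ α u₀ u₁ < ∞)
    (hcm : ∀ t ∈ Icc 0 τ, c t = m (halfSq S (linSol S c u₀ u₁) t)) :
    IsSolution S m u₀ u₁ τ (linSol S c u₀ u₁) := by
  obtain ⟨D, hD⟩ := k.dominated_of_le_T hφm hc hdata
  have h0 : (0 : ℝ) ∈ Icc 0 τ := ⟨le_rfl, hτ0.le⟩
  refine ⟨fun t ht => (k.hasDerivWithinAt_linSol hφm hc hdata hτ ht).differentiableWithinAt,
    k.linSol_zero hφm hc hdata, ?_, fun v t ht => ?_⟩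
  · rw [k.derivWithin_linSol hφm hc hdata hτ0 hτ h0, k.linVel_zero hφm hc hdata]
  · have h := (hD.weak_equation (k.coeff_continuous hc)
      (fun ξ => one_le_gevreyWeight _ _ _ (S.lam_nonneg ξ)) k.T_le v
      (Icc_subset_Icc_right hτ ht)).mono (Icc_subset_Icc_right hτ)
    rw [hcm t ht] at h
    refine h.congr_of_mem (fun s hs => ?_) ht
    rw [k.derivWithin_linSol hφm hc hdata hτ0 hτ hs]

/-! ### Convergence of solutions of linear problems -/

/-- By linearity in the data, the difference splits into the flow of the data difference and the
change of coefficient for fixed data. The first is small by the uniform scale bound, the second by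
dominated convergence over the frequencies. -/
lemma tendsto_flowField_sub {R τ : ℝ} (hR : k.κ + 1 ≤ R) (hτ : 0 < τ) (hτ1 : τ ≤ 1)
    (hRτ : R * τ ≤ r₀) {c : ℕ → ℝ → ℝ} {c₀ : ℝ → ℝ} (hc : ∀ n, k.Coeff (c n)) (hc₀ : k.Coeff c₀)
    (hlim : TendstoUniformlyOn c c₀ atTop (Icc 0 1)) {u₀n u₁n : ℕ → H} {u₀ u₁ : H}
    (hdata : dataEnergy S φ r₀ α u₀ u₁ < ∞)
    (hdlim : Tendsto (fun n => dataEnergy S φ r₀ α (u₀n n - u₀) (u₁n n - u₁)) atTop (𝓝 0))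
    {t : ℕ → ℝ} (ht : ∀ n, t n ∈ Icc 0 τ) :
    Tendsto (fun n => totalEnergy S (fun ξ => gevreyWeight φ (r₀ - R * τ) α (S.lam ξ))
      (fun ξ => flowField S (c n) (u₀n n) (u₁n n) (t n) ξ - flowField S c₀ u₀ u₁ (t n) ξ))
      atTop (𝓝 0) := by
  obtain ⟨C, hC, hb⟩ := k.exists_scale_bound (S := S) hR hτ hτ1 hRτ
  set W : M → ℝ := fun ξ => gevreyWeight φ (r₀ - R * τ) α (S.lam ξ) with hWdef
  have hW := aemeasurable_gevreyWeight hφm (r₀ - R * τ) α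
  have hW0 := gevreyWeight_nonneg (S := S) φ (r₀ - R * τ) α
  have ht1 : ∀ n, t n ∈ Icc (0 : ℝ) 1 := fun n => ⟨(ht n).1, (ht n).2.trans hτ1⟩
  have hcc := fun n => k.coeff_continuous (hc n)
  have hcc₀ := k.coeff_continuous hc₀
  have h1 : Tendsto (fun n => totalEnergy S W
      (flowField S (c n) (u₀n n - u₀) (u₁n n - u₁) (t n))) atTop (𝓝 0) := by
    have h := ENNReal.Tendsto.const_mul (a := ENNReal.ofReal C) hdlim (Or.inr ENNReal.ofReal_ne_top)
    rw [mul_zero] at h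
    refine tendsto_of_tendsto_of_tendsto_of_le_of_le tendsto_const_nhds h (fun _ => zero_le)
      fun n => ?_
    exact totalEnergy_le hC fun ξ => hb (c n) (hc n) _ _ (t n) (ht n) ξ
  have h2 : Tendsto (fun n => totalEnergy S W (fun ξ => flowField S (c n) u₀ u₁ (t n) ξ -
      flowField S c₀ u₀ u₁ (t n) ξ)) atTop (𝓝 0) := by
    have hint := (integrable_of_totalEnergy (aemeasurable_gevreyWeight hφm r₀ α)
      (gevreyWeight_nonneg φ r₀ α) (aemeasurable_data u₀ u₁) hdata).const_mul (4 * C)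
    refine tendsto_totalEnergy_zero hW hint (Eventually.of_forall fun n =>
      (aemeasurable_flowField (hcc n) u₀ u₁ (ht1 n)).sub
        (aemeasurable_flowField hcc₀ u₀ u₁ (ht1 n)))
      (Eventually.of_forall fun n ξ => ?_) fun ξ => ?_
    · have a1 := hb (c n) (hc n) u₀ u₁ (t n) (ht n) ξ
      have a2 := hb c₀ hc₀ u₀ u₁ (t n) (ht n) ξ
      have a3 := mul_le_mul_of_nonneg_left (freqEnergy_sub_le (S.lam ξ)
        (flowField S (c n) u₀ u₁ (t n) ξ) (flowField S c₀ u₀ u₁ (t n) ξ)) (hW0 ξ)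
      linarith
    · refine tendsto_oscFlow (b := fun n s => c n s * S.lam ξ ^ 2)
        (b₀ := fun s => c₀ s * S.lam ξ ^ 2) (fun n => by have := hcc n; fun_prop) (by fun_prop)
        ?_ tendsto_const_nhds ht1
      rw [Metric.tendstoUniformlyOn_iff] at hlim ⊢
      intro ε hε
      have hl0 : 0 < S.lam ξ ^ 2 + 1 := by positivity
      filter_upwards [hlim (ε / (S.lam ξ ^ 2 + 1)) (by positivity)] with n hn s hs
      have h3 := hn s hs
      rw [Real.dist_eq] at h3 ⊢
      rw [← sub_mul, abs_mul, abs_of_nonneg (sq_nonneg (S.lam ξ))]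
      rw [lt_div_iff₀ hl0] at h3
      nlinarith [abs_nonneg (c₀ s - c n s)]
  have h3 := (ENNReal.Tendsto.const_mul (a := 2) h1 (Or.inr (by simp))).add
    (ENNReal.Tendsto.const_mul (a := 2) h2 (Or.inr (by simp)))
  simp only [mul_zero, add_zero] at h3
  refine tendsto_of_tendsto_of_tendsto_of_le_of_le tendsto_const_nhds h3 (fun _ => zero_le)
    fun n => ?_
  refine le_trans (le_of_eq ?_) (totalEnergy_add_le hW hW0 (aemeasurable_flowField (hcc n) _ _
    (ht1 n)))
  refine totalEnergy_congr ?_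
  filter_upwards [U_sub_ae S (u₀n n) u₀, U_sub_ae S (u₁n n) u₁] with ξ e1 e2
  have hcn := hcc n
  have : flowField S (c n) (u₀n n - u₀) (u₁n n - u₁) (t n) ξ =
      flowField S (c n) (u₀n n) (u₁n n) (t n) ξ - flowField S (c n) u₀ u₁ (t n) ξ := by
    rw [flowField, flowField, flowField, e1, e2, ← oscFlow_sub (by fun_prop) _ _ (ht1 n)]
    rfl
  rw [this, sub_add_sub_cancel]

/-- Continuous dependence for the linear problem, in the scale of Gevrey spaces. -/
theorem tendstoInScale_linSol {R T : ℝ} (hR : k.κ + 1 ≤ R) (hT : T ≤ k.T)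
    (hRT : R * T ≤ r₀) {c : ℕ → ℝ → ℝ} {c₀ : ℝ → ℝ} (hc : ∀ n, k.Coeff (c n)) (hc₀ : k.Coeff c₀)
    (hlim : TendstoUniformlyOn c c₀ atTop (Icc 0 1)) {u₀n u₁n : ℕ → H} {u₀ u₁ : H}
    (hdatan : ∀ n, dataEnergy S φ r₀ α (u₀n n) (u₁n n) < ∞)
    (hdata : dataEnergy S φ r₀ α u₀ u₁ < ∞)
    (hdlim : Tendsto (fun n => dataEnergy S φ r₀ α (u₀n n - u₀) (u₁n n - u₁)) atTop (𝓝 0)) :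
    TendstoInScale S φ r₀ R α T (fun n => linSol S (c n) (u₀n n) (u₁n n)) (linSol S c₀ u₀ u₁) := by
  intro τ hτ
  have hR0 : 0 ≤ R := by linarith [k.κ_nonneg]
  have hτT : τ ≤ k.T := hτ.2.trans hT
  have hτ1 : τ ≤ 1 := hτT.trans k.T_le
  have hRτ : R * τ ≤ r₀ := (mul_le_mul_of_nonneg_left hτ.2 hR0).trans hRT
  have hne : (Icc 0 τ).Nonempty := ⟨0, le_rfl, hτ.1.le⟩
  have hW0 := gevreyWeight_nonneg (S := S) φ (r₀ - R * τ) α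
  have hsol : ∀ n, ∀ s ∈ Icc 0 τ,
      S.U (linSol S (c n) (u₀n n) (u₁n n) s - linSol S c₀ u₀ u₁ s) =ᵐ[μ]
      fun ξ => (flowField S (c n) (u₀n n) (u₁n n) s ξ - flowField S c₀ u₀ u₁ s ξ).1 :=
    fun n s hs => by
      have hs' := Icc_subset_Icc_right hτT hs
      filter_upwards [U_sub_ae S (linSol S (c n) (u₀n n) (u₁n n) s) (linSol S c₀ u₀ u₁ s),
        k.U_linSol hφm (hc n) (hdatan n) hs', k.U_linSol hφm hc₀ hdata hs'] with ξ e1 e2 e3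
      rw [e1, e2, e3, Prod.fst_sub]
  have hvel : ∀ n, ∀ s ∈ Icc 0 τ,
      S.U (linVel S (c n) (u₀n n) (u₁n n) s - linVel S c₀ u₀ u₁ s) =ᵐ[μ]
      fun ξ => (flowField S (c n) (u₀n n) (u₁n n) s ξ - flowField S c₀ u₀ u₁ s ξ).2 :=
    fun n s hs => by
      have hs' := Icc_subset_Icc_right hτT hs
      filter_upwards [U_sub_ae S (linVel S (c n) (u₀n n) (u₁n n) s) (linVel S c₀ u₀ u₁ s),
        k.U_linVel hφm (hc n) (hdatan n) hs', k.U_linVel hφm hc₀ hdata hs'] with ξ e1 e2 e3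
      rw [e1, e2, e3, Prod.snd_sub]
  refine ⟨tendsto_biSup_zero hne fun t ht => ?_, tendsto_biSup_zero hne fun t ht => ?_,
    tendsto_biSup_zero hne fun t ht => ?_⟩ <;> rw [tendsto_gevreyNorm_iff] <;>
    refine tendsto_of_tendsto_of_tendsto_of_le_of_le tendsto_const_nhds
      (k.tendsto_flowField_sub hφm hR hτ.1 hτ1 hRτ hc hc₀ hlim hdata hdlim ht)
      (fun _ => zero_le) fun n => ?_
  · simp only
    rw [wInt_congr (hsol n (t n) (ht n))]
    exact wInt_fst_le (fun ξ => gevreyWeight_add_half_le φ _ k.α_pos (S.lam_nonneg ξ)) hW0 _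
  · simp only
    rw [wInt_congr (hsol n (t n) (ht n))]
    exact wInt_fst_le (fun ξ => by nlinarith [hW0 ξ, sq_nonneg (S.lam ξ)]) hW0 _
  · simp only
    rw [k.derivWithin_linSol hφm (hc n) (hdatan n) hτ.1 hτT (ht n),
      k.derivWithin_linSol hφm hc₀ hdata hτ.1 hτT (ht n), wInt_congr (hvel n (t n) (ht n))]
    exact wInt_snd_le hW0 _

end EnergyConstants

end

/-! ### The coefficient of a solution and the continuity argument -/

/-- The projection of the real line onto `[0, τ]`. -/
def timeClamp (τ t : ℝ) : ℝ := max 0 (min τ t)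

lemma timeClamp_mem {τ : ℝ} (hτ : 0 ≤ τ) (t : ℝ) : timeClamp τ t ∈ Icc 0 τ :=
  ⟨le_max_left _ _, max_le hτ (min_le_left _ _)⟩

lemma timeClamp_of_mem {τ t : ℝ} (ht : t ∈ Icc 0 τ) : timeClamp τ t = t := by
  rw [timeClamp, min_eq_right ht.2, max_eq_right ht.1]

lemma abs_timeClamp_sub_le (τ s t : ℝ) : |timeClamp τ s - timeClamp τ t| ≤ |s - t| := by
  refine (abs_max_sub_max_le_max _ _ _ _).trans ?_
  rw [sub_self, abs_zero]
  refine max_le (abs_nonneg _) ((abs_min_sub_min_le_max _ _ _ _).trans ?_)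
  rw [sub_self, abs_zero]
  exact max_le (abs_nonneg _) le_rfl

lemma continuous_timeClamp (τ : ℝ) : Continuous (timeClamp τ) :=
  continuous_const.max (continuous_const.min continuous_id)

section

variable {H : Type*} [NormedAddCommGroup H] [InnerProductSpace ℝ H] {A : H →ₗ.[ℝ] H}
  {M : Type*} [MeasurableSpace M] {μ : Measure M} {S : SpectralRep A μ}

lemma halfSq_nonneg (u : ℝ → H) (t : ℝ) : 0 ≤ halfSq S u t := ENNReal.toReal_nonneg

lemma flowField_congr {c c' : ℝ → ℝ} (hc : Continuous c) (hc' : Continuous c') {τ : ℝ}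
    (hτ : τ ≤ 1) (h : EqOn c c' (Icc 0 τ)) (u₀ u₁ : H) {t : ℝ} (ht : t ∈ Icc 0 τ) (ξ : M) :
    flowField S c u₀ u₁ t ξ = flowField S c' u₀ u₁ t ξ :=
  oscFlow_congr (by fun_prop) (by fun_prop) hτ (fun s hs => by simp only [h hs]) _ ht

lemma linSol_congr {c c' : ℝ → ℝ} (hc : Continuous c) (hc' : Continuous c') {τ : ℝ}
    (hτ : τ ≤ 1) (h : EqOn c c' (Icc 0 τ)) (u₀ u₁ : H) {t : ℝ} (ht : t ∈ Icc 0 τ) :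
    linSol S c u₀ u₁ t = linSol S c' u₀ u₁ t := by
  rw [linSol, linSol]
  congr 1
  funext ξ
  rw [flowField_congr hc hc' hτ h u₀ u₁ ht]

namespace EnergyConstants

variable {ω φ : ℝ → ℝ} {ν L r₀ α : ℝ} (k : EnergyConstants ω φ ν L r₀ α)

/-- An element of the class, needed to start the iteration for the delayed equation. -/
lemma coeff_const : k.Coeff fun _ => k.cmax :=
  ⟨fun _ => k.ν_le, fun _ => le_rfl, fun s t => by
    rw [sub_self, abs_zero]
    exact mul_nonneg ((mul_nonneg (abs_nonneg L) (by linarith [k.K_pos])).trans k.le_L')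
      (k.hω.nonneg (abs_nonneg _))⟩

-- The Lipschitz constant 2K turns ω into (2K + 1)ω, which is what the constant L' was chosen to
-- contain.
variable {k} in
lemma Admits.coeff_comp {m : ℝ → ℝ} (hm : k.Admits m) {g : ℝ → ℝ}
    (hg : ∀ t, g t ∈ Icc 0 k.B) (hlip : ∀ s t, |g s - g t| ≤ 2 * k.K * |s - t|) :
    k.Coeff fun t => m (g t) := by
  refine ⟨fun t => hm.lower _ (hg t), fun t => hm.upper _ (hg t), fun s t => ?_⟩
  have hK := k.K_pos
  have h0 : 0 ≤ ω |s - t| := k.hω.nonneg (abs_nonneg _)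
  calc |m (g s) - m (g t)| ≤ L * ω |g s - g t| := hm.modulus _ _ (hg s).1 (hg t).1
    _ ≤ |L| * ω (2 * k.K * |s - t|) := by
        refine mul_le_mul (le_abs_self L) (k.hω.mono (abs_nonneg _) (hlip s t))
          (k.hω.nonneg (abs_nonneg _)) (abs_nonneg _)
    _ ≤ |L| * ((2 * k.K + 1) * ω |s - t|) :=
        mul_le_mul_of_nonneg_left (k.hω.mul_le (by positivity) (abs_nonneg _)) (abs_nonneg _)
    _ = |L| * (2 * k.K + 1) * ω |s - t| := by ring
    _ ≤ k.L' * ω |s - t| := mul_le_mul_of_nonneg_right k.le_L' h0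

-- An energy bound K makes the argument of m Lipschitz with constant 2K, so starting below D₀ it
-- stays in [0, B]. The map p covers both freezing of the coefficient outside [0, τ] and delays.
variable {k} in
lemma Admits.coeff_halfSq {m : ℝ → ℝ} (hm : k.Admits m) {T τ : ℝ} (hT0 : 0 < T) (hT : T ≤ k.T)
    (hτ : τ ≤ T) {u : ℝ → H} (hu : InPhaseSpace S T u)
    (hE : ∀ t ∈ Icc 0 τ, phaseEnergy S T u t ≤ ENNReal.ofReal k.K)
    (h0 : halfSq S u 0 ≤ k.D₀) {p : ℝ → ℝ} (hp : ∀ t, p t ∈ Icc 0 τ)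
    (hlip : ∀ s t, |p s - p t| ≤ |s - t|) :
    k.Coeff fun t => m (halfSq S u (p t)) := by
  have hK := k.K_pos
  have hbd := fun s (hs : s ∈ Icc 0 τ) t (ht : t ∈ Icc 0 τ) =>
    hu.abs_halfSq_sub_le hT0 hτ k.K_pos.le hE hs ht
  refine hm.coeff_comp (fun t => ⟨halfSq_nonneg u _, ?_⟩) fun s t => ?_
  · have h := (le_abs_self _).trans (hbd (p t) (hp t) 0 ⟨le_rfl, (hp t).1.trans (hp t).2⟩)
    rw [sub_zero, abs_of_nonneg (hp t).1] at h
    have h2 : 2 * k.K * p t ≤ 2 * k.K * k.T :=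
      mul_le_mul_of_nonneg_left ((hp t).2.trans (hτ.trans hT)) (by positivity)
    linarith [k.B_ge]
  · exact (hbd _ (hp s) _ (hp t)).trans (mul_le_mul_of_nonneg_left (hlip s t) (by positivity))

lemma halfSq_zero_le {u₀ u₁ : H} (hdata : dataEnergy S φ r₀ α u₀ u₁ ≤ ENNReal.ofReal k.D₀)
    {u : ℝ → H} (hu : u 0 = u₀) : halfSq S u 0 ≤ k.D₀ := by
  rw [halfSq, hu]
  exact ENNReal.toReal_le_of_le_ofReal k.D₀_nonneg
    ((powNormSq_half_le_dataEnergy r₀ α u₀ u₁).trans hdata)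

variable {k} in
/-- Every solution in the phase space is the solution of a linear problem whose coefficient is
controlled. -/
theorem Admits.exists_coeff (hφm : AEMeasurable (fun ξ => φ (S.lam ξ)) μ)
    {m : ℝ → ℝ} (hm : k.Admits m) {T : ℝ} (hT0 : 0 < T)
    (hT : T ≤ k.T) {u₀ u₁ : H} (hdata : dataEnergy S φ r₀ α u₀ u₁ ≤ ENNReal.ofReal k.D₀)
    {u : ℝ → H} (hu : InPhaseSpace S T u) (hsol : IsSolution S m u₀ u₁ T u) :
    ∃ c, k.Coeff c ∧ ∀ t ∈ Icc 0 T, c t = m (halfSq S u t) ∧ u t = linSol S c u₀ u₁ t ∧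
      phaseEnergy S T u t ≤ ENNReal.ofReal k.K := by
  obtain ⟨hdiff, hu0, hu1, hweak⟩ := hsol
  have hT1 : T ≤ 1 := hT.trans k.T_le
  set c : ℝ → ℝ := fun t => m (halfSq S u (timeClamp T t)) with hc_def
  have hg : ContinuousOn (fun t => m (halfSq S u t)) (Icc 0 T) :=
    (OmegaContinuousWith.continuousOn k.hω hm.modulus).comp (hu.continuousOn_halfSq hT0)
      fun t _ => halfSq_nonneg u t
  have hc : Continuous c := hg.comp_continuous (continuous_timeClamp T) (timeClamp_mem hT0.le)
  have hc0 : ∀ t, 0 ≤ c t := fun t => hm.nonneg _ (halfSq_nonneg u _)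
  -- At this stage only a qualitative bound on the coefficient is available, which suffices for the
  -- representation by the flow.
  obtain ⟨B, hB⟩ := isCompact_Icc.bddAbove_image hg
  have hcB : ∀ t, c t ≤ B := fun t => hB ⟨_, timeClamp_mem hT0.le t, rfl⟩
  have hrep : ∀ t ∈ Icc 0 T, ∀ᵐ ξ ∂μ, flowField S c u₀ u₁ t ξ =
      (S.U (u t) ξ, S.U (derivWithin u (Icc 0 T) t) ξ) := fun t ht => by
    have h := weak_solution_eq_flow (S := S) hc hc0 hcB hT0 hT1
      (fun t ht => (hdiff t ht).hasDerivWithinAt) (hu.1.derivWithin_spec hT0).2.1.continuousOn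
      (fun v t ht => by
        simp only [hc_def, timeClamp_of_mem ht]
        exact hweak v t ht) ht
    rwa [hu0, hu1] at h
  have hD := k.halfSq_zero_le (S := S) hdata hu0
  have hlt : ENNReal.ofReal (k.C * k.C₁ * k.D₀) < ENNReal.ofReal k.K :=
    (ENNReal.ofReal_lt_ofReal_iff k.K_pos).2 k.K_gt
  -- The energy at t depends only on the coefficient on [0, t], and the linear estimate gives C C₁
  -- D₀, strictly less than K. This strict gain closes the continuity argument.
  have hen : ∀ c', k.Coeff c' → ∀ t ∈ Icc 0 T, EqOn c c' (Icc 0 t) →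
      phaseEnergy S T u t < ENNReal.ofReal k.K := fun c' hc' t ht heq => by
    have hae : flowField S c' u₀ u₁ t =ᵐ[μ] fun ξ =>
        (S.U (u t) ξ, S.U (derivWithin u (Icc 0 T) t) ξ) := by
      filter_upwards [hrep t ht] with ξ hξ
      rw [← flowField_congr hc (k.coeff_continuous hc') (ht.2.trans hT1) heq u₀ u₁
        ⟨ht.1, le_rfl⟩, hξ]
    have hmeas := aemeasurable_flowField (S := S) (k.coeff_continuous hc') u₀ u₁
      (t := t) ⟨ht.1, ht.2.trans hT1⟩
    refine (powNormSq_add_le_totalEnergy hmeas ?_ ?_).trans_lt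
      ((k.lam_energy_le hc' hdata ⟨ht.1, ht.2.trans hT⟩).trans_lt hlt)
    · filter_upwards [hae] with ξ hξ using by rw [hξ]
    · filter_upwards [hae] with ξ hξ using by rw [hξ]
  have hstep : ∀ τ ∈ Icc 0 T, (∀ t ∈ Icc 0 τ, phaseEnergy S T u t ≤ ENNReal.ofReal k.K) →
      phaseEnergy S T u τ < ENNReal.ofReal k.K := fun τ hτ hE => by
    refine hen _ (hm.coeff_halfSq hT0 hT hτ.2 hu hE hD (timeClamp_mem hτ.1) (abs_timeClamp_sub_le τ)) τ hτ
      fun t ht => ?_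
    simp only [hc_def]
    rw [timeClamp_of_mem ht, timeClamp_of_mem (Icc_subset_Icc_right hτ.2 ht)]
  have hEc := hu.continuousOn_phaseEnergy hT0
  have hE : ∀ t ∈ Icc 0 T, phaseEnergy S T u t < ENNReal.ofReal k.K := by
    by_contra! hcon
    obtain ⟨t₁, ht₁, hbad₁⟩ := hcon
    -- If the bound K is ever reached, closedness provides a first such time a.
    have hcl : IsClosed (Icc 0 T ∩ phaseEnergy S T u ⁻¹' Ici (ENNReal.ofReal k.K)) :=
      hEc.preimage_isClosed_of_isClosed isClosed_Icc isClosed_Ici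
    obtain ⟨a, ⟨haT, haE⟩, hmin⟩ := (isCompact_Icc.of_isClosed_subset hcl
      inter_subset_left).exists_isLeast ⟨t₁, ht₁, hbad₁⟩
    refine absurd (show ENNReal.ofReal k.K ≤ phaseEnergy S T u a from haE) (not_le.2 ?_)
    rcases haT.1.eq_or_lt with h0 | h0
    · rw [← h0]
      have h00 : (0 : ℝ) ∈ Icc 0 T := ⟨le_rfl, hT0.le⟩
      -- At time 0 no energy bound is available to produce a modulus, but a constant coefficient is
      -- admissible and agrees with c there.
      refine hen (fun _ => c 0) ?_ 0 h00 fun t ht => ?_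
      · have hc00 : c 0 = m (halfSq S u 0) := by simp only [hc_def, timeClamp_of_mem h00]
        rw [hc00]
        refine hm.coeff_comp (g := fun _ => halfSq S u 0)
          (fun _ => ⟨halfSq_nonneg u 0, hD.trans ?_⟩) fun s t => ?_
        · have := k.B_ge
          have := mul_pos k.K_pos k.T_pos
          linarith
        · rw [sub_self, abs_zero]
          have := k.K_pos
          positivity
      · rw [Icc_self] at ht
        rw [mem_singleton_iff.1 ht]
    · refine hstep a haT fun t ht => ?_
      have hlt' : ∀ s ∈ Ico 0 a, phaseEnergy S T u s ≤ ENNReal.ofReal k.K := fun s hs => by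
        by_contra! h
        exact absurd (hmin ⟨⟨hs.1, hs.2.le.trans haT.2⟩, h.le⟩) (not_le.2 hs.2)
      -- At the first time itself the bound by K is the limit from the left.
      rcases ht.2.eq_or_lt with rfl | hta
      · have : (𝓝[Ico 0 t] t).NeBot := right_nhdsWithin_Ico_neBot h0
        exact le_of_tendsto ((hEc t haT).mono_left (nhdsWithin_mono t
          (Ico_subset_Icc_self.trans (Icc_subset_Icc_right haT.2))))
          (eventually_nhdsWithin_of_forall hlt')
      · exact hlt' t ⟨ht.1, hta⟩
  refine ⟨c, hm.coeff_halfSq hT0 hT le_rfl hu (fun t ht => (hE t ht).le) hD (timeClamp_mem hT0.le)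
    (abs_timeClamp_sub_le T), fun t ht => ⟨?_, ?_, (hE t ht).le⟩⟩
  · simp only [hc_def, timeClamp_of_mem ht]
  · refine eq_of_U_ae S ?_
    filter_upwards [hrep t ht, k.U_linSol hφm (hm.coeff_halfSq hT0 hT le_rfl hu
      (fun t ht => (hE t ht).le) hD (timeClamp_mem hT0.le) (abs_timeClamp_sub_le T))
      (hdata.trans_lt ENNReal.ofReal_lt_top) (Icc_subset_Icc_right hT ht)] with ξ h1 h2
    rw [h2, ← hc_def, h1]

end EnergyConstants
end

/-! ### Compactness of the class of coefficients -/

/-- Arzelà–Ascoli on [0,1]: the common modulus gives equicontinuity, and both bounds and modulus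
pass to the limit. -/
lemma exists_subseq_coeffClass {ω : ℝ → ℝ} (hω : IsContinuityModulus ω) {ν B L : ℝ} (hL : 0 ≤ L)
    {c : ℕ → ℝ → ℝ} (hc : ∀ n, CoeffClass ω ν B L (c n)) :
    ∃ ι : ℕ → ℕ, StrictMono ι ∧ ∃ c₀, CoeffClass ω ν B L c₀ ∧
      TendstoUniformlyOn (fun n => c (ι n)) c₀ atTop (Icc 0 1) := by
  let F : ℕ → BoundedContinuousFunction (Icc (0 : ℝ) 1) ℝ := fun n =>
    BoundedContinuousFunction.mkOfCompact
      ⟨fun x => c n x, ((hc n).continuous hω).comp continuous_subtype_val⟩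
  have hF : ∀ n x, F n x = c n x := fun n x => rfl
  have hcomp : IsCompact (closure (range F)) := by
    refine BoundedContinuousFunction.arzela_ascoli (Icc ν B) isCompact_Icc _ ?_ ?_
    · rintro _ x ⟨n, rfl⟩
      exact ⟨(hc n).lower x, (hc n).upper x⟩
    · refine Metric.equicontinuous_of_continuity_modulus (fun x => L * ω |x|) ?_ _ ?_
      · have h := (hω.tendsto_abs_sub 0).const_mul L
        simpa using h
      · rintro x y ⟨_, n, rfl⟩
        have h := (hc n).modulus x y
        simpa [hF, Subtype.dist_eq, Real.dist_eq] using h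
  obtain ⟨a, -, ι, hι, ha⟩ := hcomp.tendsto_subseq fun n => subset_closure (mem_range_self (f := F) n)
  rw [BoundedContinuousFunction.tendsto_iff_tendstoUniformly] at ha
  -- The limit is extended by its endpoint values; projecting time does not increase distances, so
  -- the modulus survives on the whole line.
  let c₀ : ℝ → ℝ := fun t => a ⟨timeClamp 1 t, timeClamp_mem zero_le_one t⟩
  have hpt : ∀ t, Tendsto (fun n => c (ι n) (timeClamp 1 t)) atTop (𝓝 (c₀ t)) := fun t =>
    ha.tendsto_at ⟨timeClamp 1 t, timeClamp_mem zero_le_one t⟩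
  refine ⟨ι, hι, c₀, ⟨fun t => ge_of_tendsto' (hpt t) fun n => (hc _).lower _,
    fun t => le_of_tendsto' (hpt t) fun n => (hc _).upper _, fun s t => ?_⟩, ?_⟩
  · refine le_of_tendsto' ((hpt s).sub (hpt t)).abs fun n => ((hc _).modulus _ _).trans ?_
    exact mul_le_mul_of_nonneg_left (hω.mono (abs_nonneg _) (abs_timeClamp_sub_le 1 s t)) hL
  · rw [tendstoUniformlyOn_iff_tendstoUniformly_comp_coe]
    have h : c₀ ∘ ((↑) : Icc (0 : ℝ) 1 → ℝ) = a := by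
      funext x
      simp only [c₀, Function.comp_apply, timeClamp_of_mem x.2]
    rw [h]
    exact ha

/-! ### Local existence through delayed equations -/

section

variable {H : Type*} [NormedAddCommGroup H] [InnerProductSpace ℝ H] {A : H →ₗ.[ℝ] H}
  {M : Type*} [MeasurableSpace M] {μ : Measure M} {S : SpectralRep A μ}

lemma tendsto_powLift {φ : ℝ → ℝ} {β : ℝ} {u : ℕ → H} {w : H} (hu : ∀ n, powNormSq S β (u n) < ∞)
    (hw : powNormSq S β w < ∞) (h : Tendsto (fun n => gevreyNorm S φ 0 β (u n - w)) atTop (𝓝 0)) :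
    Tendsto (fun n => powLift S β (u n)) atTop (𝓝 (powLift S β w)) := by
  rw [tendsto_iff_edist_tendsto_0]
  refine tendsto_of_tendsto_of_tendsto_of_le_of_le tendsto_const_nhds h (fun _ => zero_le)
    fun n => ?_
  obtain ⟨h1, h2⟩ := powLift_sub (hu n) hw
  simp only
  rw [edist_eq_enorm_sub, ← h2]
  exact enorm_powLift_le h1

lemma TendstoInScale.tendsto_gevreyNorm {φ : ℝ → ℝ} {r₀ R α T : ℝ} (hT : 0 < T) {u : ℕ → ℝ → H}
    {w : ℝ → H} (h : TendstoInScale S φ r₀ R α T u w) {t : ℝ} (ht : t ∈ Icc 0 T) :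
    Tendsto (fun n => gevreyNorm S φ (r₀ - R * T) (α + 1 / 2) (u n t - w t)) atTop (𝓝 0) ∧
    Tendsto (fun n => gevreyNorm S φ (r₀ - R * T) α (u n t - w t)) atTop (𝓝 0) := by
  obtain ⟨h1, h2, -⟩ := h T ⟨hT, le_rfl⟩
  exact ⟨tendsto_of_tendsto_of_tendsto_of_le_of_le tendsto_const_nhds h1 (fun _ => zero_le)
    fun n => le_iSup₂_of_le t ht le_rfl, tendsto_of_tendsto_of_tendsto_of_le_of_le
    tendsto_const_nhds h2 (fun _ => zero_le) fun n => le_iSup₂_of_le t ht le_rfl⟩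

lemma TendstoInScale.tendsto {φ : ℝ → ℝ} {r₀ R α T : ℝ} (hT : 0 < T) {u : ℕ → ℝ → H}
    {w : ℝ → H} (h : TendstoInScale S φ r₀ R α T u w) {t : ℝ} (ht : t ∈ Icc 0 T) :
    Tendsto (fun n => u n t) atTop (𝓝 (w t)) :=
  tendsto_of_gevreyNorm S (h.tendsto_gevreyNorm hT ht).2

lemma TendstoInScale.tendsto_halfSq {φ : ℝ → ℝ} (hφ : ∀ σ : ℝ, 0 ≤ σ → 1 ≤ φ σ) {r₀ R α T : ℝ}
    (hα : 1 / 4 ≤ α) (hT : 0 < T) (hr : R * T ≤ r₀) {u : ℕ → ℝ → H} {w : ℝ → H}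
    (h : TendstoInScale S φ r₀ R α T u w) (hu : ∀ n, InPhaseSpace S T (u n))
    (hw : InPhaseSpace S T w) {t : ℝ} (ht : t ∈ Icc 0 T) :
    Tendsto (fun n => halfSq S (u n) t) atTop (𝓝 (halfSq S w t)) := by
  obtain ⟨h3, h1⟩ := h.tendsto_gevreyNorm hT ht
  have h1' := tendsto_powLift (fun n => (hu n).quarter_lt_top ht) (hw.quarter_lt_top ht)
    (tendsto_gevreyNorm_mono zero_le_two (fun lam hlam =>
      gevreyWeight_quarter_le hφ hα (sub_nonneg.2 hr) hlam) h1)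
  have h3' := tendsto_powLift (fun n => (hu n).three_quarter_lt_top ht)
    (hw.three_quarter_lt_top ht) (tendsto_gevreyNorm_mono zero_le_two (fun lam hlam =>
      gevreyWeight_three_quarter_le hφ hα (sub_nonneg.2 hr) hlam) h3)
  rw [hw.halfSq_eq ht]
  exact (h1'.inner h3').congr fun n => ((hu n).halfSq_eq ht).symm

lemma dataEnergy_sub_self (φ : ℝ → ℝ) (r α : ℝ) (u₀ u₁ : H) :
    dataEnergy S φ r α (u₀ - u₀) (u₁ - u₁) = 0 := by
  have h : (fun ξ => (S.U (u₀ - u₀) ξ, S.U (u₁ - u₁) ξ)) =ᵐ[μ] fun _ => (0, 0) := by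
    filter_upwards [U_sub_ae S u₀ u₀, U_sub_ae S u₁ u₁] with ξ e1 e2
    rw [e1, e2, sub_self, sub_self]
  rw [dataEnergy, totalEnergy_congr h]
  simp [totalEnergy, freqEnergy]

namespace EnergyConstants

variable {ω φ : ℝ → ℝ} {ν L r₀ α : ℝ} {k : EnergyConstants ω φ ν L r₀ α}
  (hφm : AEMeasurable (fun ξ => φ (S.lam ξ)) μ) {m : ℝ → ℝ} (hm : k.Admits m) {u₀ u₁ : H}
  (hdata : dataEnergy S φ r₀ α u₀ u₁ ≤ ENNReal.ofReal k.D₀)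
include hφm hm hdata

/-- The map from a coefficient to the coefficient generated by its linear solution preserves the
class, also after a time shift. -/
lemma Admits.coeff_linSol {c : ℝ → ℝ} (hc : k.Coeff c) {p : ℝ → ℝ}
    (hp : ∀ t, p t ∈ Icc 0 k.T) (hlip : ∀ s t, |p s - p t| ≤ |s - t|) :
    k.Coeff fun t => m (halfSq S (linSol S c u₀ u₁) (p t)) := by
  have hfin := hdata.trans_lt ENNReal.ofReal_lt_top
  exact hm.coeff_halfSq k.T_pos le_rfl le_rfl (k.inPhaseSpace_linSol hφm k.T_pos le_rfl hc hfin)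
    (fun t ht => (k.phaseEnergy_linSol_le hφm k.T_pos le_rfl hc hdata ht).trans
      (ENNReal.ofReal_le_ofReal k.K_gt.le))
    (k.halfSq_zero_le hdata (k.linSol_zero hφm hc hfin)) hp hlip

/-- The equation with a delay. -/
lemma Admits.exists_delay {h : ℝ} (hh : 0 < h) :
    ∃ c, k.Coeff c ∧ ∀ t ∈ Icc (0 : ℝ) 1,
      c t = m (halfSq S (linSol S c u₀ u₁) (timeClamp k.T (t - h))) := by
  have hfin := hdata.trans_lt ENNReal.ofReal_lt_top
  let Φ : (ℝ → ℝ) → ℝ → ℝ := fun c t => m (halfSq S (linSol S c u₀ u₁) (timeClamp k.T (t - h)))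
  have hΦ : ∀ c, k.Coeff c → k.Coeff (Φ c) := fun c hc =>
    hm.coeff_linSol hφm hdata hc (fun t => timeClamp_mem k.T_pos.le _) fun s t => by
      simpa using abs_timeClamp_sub_le k.T (s - h) (t - h)
  -- Successive iterates agree on longer and longer intervals, so finitely many steps reach an exact
  -- solution of the delayed equation.
  let c : ℕ → ℝ → ℝ := fun j => Φ^[j + 1] fun _ => k.cmax
  have hsucc : ∀ j, c (j + 1) = Φ (c j) := fun j => Function.iterate_succ_apply' Φ (j + 1) _
  have hc : ∀ j, k.Coeff (c j) := fun j => by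
    induction j with
    | zero => exact hΦ _ k.coeff_const
    | succ j ih => rw [hsucc]; exact hΦ _ ih
  -- Causality: the linear solution at a time depends only on earlier values of the coefficient, so
  -- each application of Φ extends agreement by h.
  have hcaus : ∀ c c', k.Coeff c → k.Coeff c' → ∀ a, 0 ≤ a → (∀ t ∈ Icc (0 : ℝ) 1, t ≤ a → c t = c' t) →
      ∀ t ∈ Icc (0 : ℝ) 1, t ≤ a + h → Φ c t = Φ c' t := fun c c' hc hc' a ha heq t ht hta => by
    have hs := timeClamp_mem k.T_pos.le (t - h)
    have hsa : timeClamp k.T (t - h) ≤ a :=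
      max_le ha ((min_le_right _ _).trans (by linarith))
    simp only [Φ, halfSq]
    rw [linSol_congr (k.coeff_continuous hc) (k.coeff_continuous hc') (hs.2.trans k.T_le)
      (fun r hr => heq r ⟨hr.1, hr.2.trans (hs.2.trans k.T_le)⟩ (hr.2.trans hsa)) u₀ u₁
      ⟨hs.1, le_rfl⟩]
  have hstab : ∀ j : ℕ, ∀ t ∈ Icc (0 : ℝ) 1, t ≤ j * h → c j t = c (j + 1) t := fun j => by
    induction j with
    | zero =>
      intro t ht h0
      have ht0 : t = 0 := le_antisymm (by simpa using h0) ht.1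
      have h1 : timeClamp k.T (t - h) = 0 :=
        max_eq_left ((min_le_right _ _).trans (by linarith))
      have hz : ∀ c', k.Coeff c' → Φ c' t = m (powNormSq S (1 / 2) u₀).toReal := fun c' hc' => by
        simp only [Φ, halfSq, h1]
        rw [k.linSol_zero hφm hc' hfin]
      rw [hsucc, hz _ (hc 0)]
      exact hz _ k.coeff_const
    | succ j ih =>
      intro t ht htj
      rw [hsucc (j + 1), hsucc j]
      refine hcaus _ _ (hc j) (by rw [← hsucc]; exact hc (j + 1)) (j * h) (by positivity)
        (by rwa [← hsucc]) t ht ?_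
      push_cast at htj
      linarith
  obtain ⟨j, hj⟩ := exists_nat_ge (1 / h)
  refine ⟨c j, hc j, fun t ht => ?_⟩
  rw [hstab j t ht (ht.2.trans ((div_le_iff₀ hh).1 hj)), hsucc]

/-- Local existence of a solution, as a fixed point for the coefficient. -/
theorem Admits.exists_fixed_coeff :
    ∃ c, k.Coeff c ∧ ∀ t ∈ Icc 0 k.T, c t = m (halfSq S (linSol S c u₀ u₁) t) := by
  have hfin := hdata.trans_lt ENNReal.ofReal_lt_top
  have hL' : 0 ≤ k.L' := (mul_nonneg (abs_nonneg L) (by linarith [k.K_pos])).trans k.le_L'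
  choose c hc hceq using fun n : ℕ =>
    hm.exists_delay hφm hdata (h := 1 / ((n : ℝ) + 1)) Nat.one_div_pos_of_nat
  obtain ⟨ι, hι, c₀, hc₀, hlim⟩ := exists_subseq_coeffClass k.hω hL' hc
  refine ⟨c₀, hc₀, fun t ht => ?_⟩
  have hscale := k.tendstoInScale_linSol hφm le_rfl le_rfl k.R_mul_T.le (fun n => hc (ι n)) hc₀
    hlim (fun _ => hfin) hfin (u₀n := fun _ => u₀) (u₁n := fun _ => u₁)
    (by simp only [dataEnergy_sub_self]; exact tendsto_const_nhds)
  have hps := fun n => k.inPhaseSpace_linSol hφm k.T_pos le_rfl (hc (ι n)) hfin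
  have hhalf := hscale.tendsto_halfSq k.hφ k.hα k.T_pos k.R_mul_T.le hps
    (k.inPhaseSpace_linSol hφm k.T_pos le_rfl hc₀ hfin) ht
  -- The delay changes |A^{1/2}u|² by at most 2K times the delay, uniformly in n, so the delayed and
  -- undelayed values have the same limit.
  have hdelay : Tendsto (fun n => halfSq S (linSol S (c (ι n)) u₀ u₁)
      (timeClamp k.T (t - 1 / ((ι n : ℝ) + 1)))) atTop
      (𝓝 (halfSq S (linSol S c₀ u₀ u₁) t)) := by
    have hz : Tendsto (fun n => 2 * k.K * (1 / ((ι n : ℝ) + 1))) atTop (𝓝 0) := by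
      have := ((tendsto_one_div_add_atTop_nhds_zero_nat (𝕜 := ℝ)).comp
        hι.tendsto_atTop).const_mul (2 * k.K)
      simpa using this
    refine tendsto_of_tendsto_of_dist hhalf (squeeze_zero (fun _ => dist_nonneg) (fun n => ?_) hz)
    rw [Real.dist_eq]
    have hE := fun s (hs : s ∈ Icc 0 k.T) =>
      (k.phaseEnergy_linSol_le hφm k.T_pos le_rfl (hc (ι n)) hdata hs).trans
        (ENNReal.ofReal_le_ofReal k.K_gt.le)
    refine ((hps n).abs_halfSq_sub_le k.T_pos le_rfl k.K_pos.le hE ht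
      (timeClamp_mem k.T_pos.le _)).trans ?_
    have h1 := abs_timeClamp_sub_le k.T t (t - 1 / ((ι n : ℝ) + 1))
    rw [timeClamp_of_mem ht, sub_sub_cancel, abs_of_nonneg (a := 1 / _) (by positivity)] at h1
    exact mul_le_mul_of_nonneg_left h1 (by linarith [k.K_pos])
  have ht1 : t ∈ Icc (0 : ℝ) 1 := ⟨ht.1, ht.2.trans k.T_le⟩
  refine tendsto_nhds_unique (hlim.tendsto_at ht1) ?_
  have hmc := OmegaContinuousWith.continuousOn k.hω hm.modulus _
    (mem_Ici.2 (halfSq_nonneg (S := S) (linSol S c₀ u₀ u₁) t))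
  have := hmc.tendsto.comp (tendsto_nhdsWithin_iff.2
    ⟨hdelay, Eventually.of_forall fun n => halfSq_nonneg _ _⟩)
  exact this.congr fun n => (hceq (ι n) t ht1).symm

end EnergyConstants

end

/-! ### Choice of the constants -/

/-- The order of choice avoids circularity: ν and the upper bound of the coefficient give C, then
come C₁ and K, then the modulus constant |L|(2K + 1), then κ, and T is taken last. The tolerance δ
makes the same constants valid for all nonlinearities close to m on [0, B]. -/
lemma exists_energyConstants {ω m φ : ℝ → ℝ} {L Λ r₀ α : ℝ} (E : ℝ) (hE : 0 ≤ E)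
    (hω : IsContinuityModulus ω) (hm_nonneg : ∀ σ : ℝ, 0 ≤ σ → 0 ≤ m σ)
    (hm : OmegaContinuousWith ω m L) (hφ : ∀ σ : ℝ, 0 ≤ σ → 1 ≤ φ σ)
    (hφ_bdd : ∃ δ : ℝ, 0 < δ ∧ ∃ C : ℝ, ∀ σ ∈ Icc 0 δ, φ σ ≤ C)
    (hcomp : Compatible ω m φ Λ) (hr₀ : 0 < r₀) (hα : 1 / 4 ≤ α) :
    ∃ ν, ∃ k : EnergyConstants ω φ ν L r₀ α, k.D₀ = E ∧ ∃ δ, 0 < δ ∧ ∀ m' : ℝ → ℝ,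
      (∀ σ : ℝ, 0 ≤ σ → 0 ≤ m' σ) → OmegaContinuousWith ω m' L →
      (∀ σ ∈ Icc 0 k.B, |m' σ - m σ| ≤ δ) → k.Admits m' := by
  have hinf : ∀ σ, 0 ≤ σ → infVal m ≤ m σ := fun σ hσ =>
    csInf_le ⟨0, by rintro _ ⟨x, hx, rfl⟩; exact hm_nonneg x hx⟩ ⟨σ, hσ, rfl⟩
  obtain ⟨ν, δ, hν, hδ, hδ1, hνδ⟩ : ∃ ν δ, CompatibleBound ω φ Λ ν ∧ 0 < δ ∧ δ ≤ 1 ∧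
      ((∀ σ, 0 ≤ σ → ν + δ ≤ m σ) ∨ ν = 0) := by
    rcases hcomp with ⟨h1, h2⟩ | ⟨-, h2⟩
    -- Half of the infimum is kept as a lower bound for the perturbed nonlinearities, the other half
    -- is their tolerance. In the degenerate case nonnegativity suffices.
    · refine ⟨infVal m / 2, min 1 (infVal m / 2), Or.inl ⟨by linarith, h2⟩,
        lt_min one_pos (by linarith), min_le_left _ _, Or.inl fun σ hσ => ?_⟩
      linarith [hinf σ hσ, min_le_right 1 (infVal m / 2)]
    · exact ⟨0, 1, Or.inr ⟨rfl, h2⟩, one_pos, le_rfl, Or.inr rfl⟩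
  have hνm : ν ≤ m 0 := by
    rcases hνδ with h | h
    · linarith [h 0 le_rfl]
    · rw [h]; exact hm_nonneg 0 le_rfl
  have hωB : 0 ≤ |L| * ω (E + 1) := mul_nonneg (abs_nonneg _) (hω.nonneg (by linarith))
  -- On [0, B] with B = E + 1, the modulus bounds m by the first two terms; the last 1 leaves room
  -- for a perturbation δ ≤ 1.
  set cmax := m 0 + |L| * ω (E + 1) + 1 with hcmax
  have hcmax0 : 0 ≤ cmax := by linarith [hm_nonneg 0 le_rfl]
  obtain ⟨C, hC, hen⟩ := energy_estimate hω hφ hν hcmax0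
  obtain ⟨C₁, hC₁, hphase⟩ := exists_phase_weight hφ hφ_bdd hr₀ hα
  set K := C * C₁ * E + 1 with hKdef
  have hK : 0 < K := by positivity
  obtain ⟨κ, hκ, henergy⟩ := hen (|L| * (2 * K + 1)) (by positivity)
  -- The three bounds give unit time for the linear estimate, 2KT ≤ 1 for B = E + 1, and (κ + 1)T ≤
  -- r₀/2 for the loss of radius.
  set T := min 1 (min (1 / (2 * K)) (r₀ / (2 * (κ + 1)))) with hTdef
  have hT : 0 < T := lt_min one_pos (lt_min (by positivity) (by positivity))
  have hT1 : T ≤ 1 / (2 * K) := (min_le_right _ _).trans (min_le_left _ _)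
  have hT2 : T ≤ r₀ / (2 * (κ + 1)) := (min_le_right _ _).trans (min_le_right _ _)
  rw [le_div_iff₀ (by positivity)] at hT1 hT2
  refine ⟨ν, ⟨cmax, E, E + 1, C, C₁, K, |L| * (2 * K + 1), κ, T, hω, hφ, hφ_bdd, hα,
    by linarith, hE, hC, hC₁, by linarith, le_rfl, hκ, hT, min_le_left _ _, by nlinarith,
    by nlinarith, by nlinarith, henergy, hphase⟩, rfl, δ, hδ, fun m' h0 h1 h2 => ⟨h0, h1, ?_, ?_⟩⟩
  · intro σ hσ
    rcases hνδ with h | h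
    · linarith [h σ hσ.1, (abs_le.1 (h2 σ hσ)).1]
    · rw [h]; exact h0 σ hσ.1
  · intro σ hσ
    have a := (abs_le.1 (h2 σ hσ)).2
    have b := (le_abs_self _).trans (hm σ 0 hσ.1 le_rfl)
    rw [sub_zero, abs_of_nonneg hσ.1] at b
    have c : L * ω σ ≤ |L| * ω (E + 1) :=
      mul_le_mul (le_abs_self L) (hω.mono hσ.1 hσ.2) (hω.nonneg hσ.1) (abs_nonneg _)
    simp only [hcmax]
    linarith

/-! ### Compactness of solutions in the scale -/

section

variable {H : Type*} [NormedAddCommGroup H] [InnerProductSpace ℝ H] {A : H →ₗ.[ℝ] H}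
  {M : Type*} [MeasurableSpace M] {μ : Measure M} {S : SpectralRep A μ}

lemma dataEnergy_le {φ : ℝ → ℝ} (hφm : AEMeasurable (fun ξ => φ (S.lam ξ)) μ) {r α C : ℝ}
    (hC : 0 ≤ C) (hw : ∀ lam, 0 ≤ lam →
      gevreyWeight φ r α lam * (1 + lam ^ 2) ≤ C * gevreyWeight φ r (α + 1 / 2) lam) (u₀ u₁ : H) :
    dataEnergy S φ r α u₀ u₁ ≤
      ENNReal.ofReal C * wInt μ (fun ξ => gevreyWeight φ r (α + 1 / 2) (S.lam ξ)) (S.U u₀) +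
        wInt μ (fun ξ => gevreyWeight φ r α (S.lam ξ)) (S.U u₁) := by
  refine le_trans ?_ (add_le_add_left (wInt_le (fun ξ => hw _ (S.lam_nonneg ξ)) hC) _)
  have hm : AEMeasurable (fun ξ => ENNReal.ofReal (gevreyWeight φ r α (S.lam ξ) *
      (1 + S.lam ξ ^ 2) * S.U u₀ ξ ^ 2)) μ :=
    (((aemeasurable_gevreyWeight hφm r α).mul
      ((S.measurable_lam.pow_const 2).const_add 1).aemeasurable).mul
      ((aestronglyMeasurable_U S u₀).aemeasurable.pow_const 2)).ennreal_ofReal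
  rw [dataEnergy, totalEnergy, wInt, wInt, ← lintegral_add_left' hm]
  refine lintegral_mono fun ξ => ?_
  have h0 := gevreyWeight_nonneg (S := S) φ r α ξ
  rw [← ENNReal.ofReal_add (by positivity) (by positivity)]
  refine ENNReal.ofReal_le_ofReal (le_of_eq ?_)
  simp only [freqEnergy]
  ring

lemma dataEnergy_le_add {φ : ℝ → ℝ} (hφm : AEMeasurable (fun ξ => φ (S.lam ξ)) μ) (r α : ℝ)
    (u₀ u₁ v₀ v₁ : H) : dataEnergy S φ r α u₀ u₁ ≤
      2 * dataEnergy S φ r α (u₀ - v₀) (u₁ - v₁) + 2 * dataEnergy S φ r α v₀ v₁ := by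
  refine le_trans (le_of_eq (totalEnergy_congr ?_)) (totalEnergy_add_le
    (aemeasurable_gevreyWeight hφm r α) (gevreyWeight_nonneg φ r α) (aemeasurable_data _ _))
  filter_upwards [U_sub_ae S u₀ v₀, U_sub_ae S u₁ v₁] with ξ e1 e2
  rw [e1, e2, Prod.mk_add_mk, sub_add_cancel, sub_add_cancel]

lemma wInt_le_sq {φ : ℝ → ℝ} {r α N : ℝ} {u : H}
    (h : gevreyNorm S φ r α u ≤ ENNReal.ofReal N) :
    wInt μ (fun ξ => gevreyWeight φ r α (S.lam ξ)) (S.U u) ≤ ENNReal.ofReal (max N 0 ^ 2) := by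
  rw [gevreyNorm_eq] at h
  rw [ENNReal.ofReal_pow (le_max_right _ _)]
  calc _ = (wInt μ (fun ξ => gevreyWeight φ r α (S.lam ξ)) (S.U u) ^ (1 / 2 : ℝ)) ^ 2 := by
        rw [← ENNReal.rpow_natCast, ← ENNReal.rpow_mul]; norm_num
    _ ≤ _ := by
        gcongr
        exact h.trans (ENNReal.ofReal_le_ofReal (le_max_left _ _))

lemma InScale.congr {φ : ℝ → ℝ} {r₀ R α T : ℝ} {u v : ℝ → H} (h : InScale S φ r₀ R α T u)
    (hv : EqOn v u (Icc 0 T)) : InScale S φ r₀ R α T v := fun τ hτ =>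
  have hv' := hv.mono (Icc_subset_Icc_right hτ.2)
  ⟨(h τ hτ).1.congr hv', (h τ hτ).2.congr hv'⟩

lemma TendstoInScale.congr {φ : ℝ → ℝ} {r₀ R α T : ℝ} {u v : ℕ → ℝ → H} {w : ℝ → H}
    (h : TendstoInScale S φ r₀ R α T u w) (hv : ∀ n, EqOn (v n) (u n) (Icc 0 T)) :
    TendstoInScale S φ r₀ R α T v w := by
  intro τ hτ
  have hv' := fun n => (hv n).mono (Icc_subset_Icc_right hτ.2)
  obtain ⟨h1, h2, h3⟩ := h τ hτ
  refine ⟨h1.congr fun n => ?_, h2.congr fun n => ?_, h3.congr fun n => ?_⟩ <;>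
    refine iSup_congr fun t => iSup_congr fun ht => ?_
  · rw [hv' n ht]
  · rw [hv' n ht]
  · rw [derivWithin_congr (hv' n) (hv' n ht)]

lemma IsSolution.congr {m : ℝ → ℝ} {u₀ u₁ : H} {T : ℝ} (hT : 0 ≤ T) {u v : ℝ → H}
    (h : IsSolution S m u₀ u₁ T u) (hv : EqOn v u (Icc 0 T)) : IsSolution S m u₀ u₁ T v := by
  have h0 : (0 : ℝ) ∈ Icc 0 T := ⟨le_rfl, hT⟩
  have hd : ∀ t ∈ Icc 0 T, derivWithin v (Icc 0 T) t = derivWithin u (Icc 0 T) t :=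
    fun t ht => derivWithin_congr hv (hv ht)
  obtain ⟨h1, h2, h3, h4⟩ := h
  refine ⟨h1.congr hv, by rw [hv h0, h2], by rw [hd 0 h0, h3], fun w t ht => ?_⟩
  rw [hv ht]
  exact (h4 w t ht).congr_of_mem (fun s hs => by rw [hd s hs]) ht

namespace EnergyConstants

variable {ω φ : ℝ → ℝ} {ν L r₀ α : ℝ} (k : EnergyConstants ω φ ν L r₀ α)
  (hφm : AEMeasurable (fun ξ => φ (S.lam ξ)) μ)
include hφm

/-- Compactness of the solutions. -/
theorem exists_subseq_solution {m : ℝ → ℝ} (hm : OmegaContinuousWith ω m L) {mn : ℕ → ℝ → ℝ}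
    (hmn : ∀ n, k.Admits (mn n)) (hlim : ∀ b : ℝ, TendstoUniformlyOn mn m atTop (Icc 0 b))
    {u₀ u₁ : H} (hdata : dataEnergy S φ r₀ α u₀ u₁ < ∞) {u₀n u₁n : ℕ → H}
    (hdatan : ∀ n, dataEnergy S φ r₀ α (u₀n n) (u₁n n) ≤ ENNReal.ofReal k.D₀)
    (hdlim : Tendsto (fun n => dataEnergy S φ r₀ α (u₀n n - u₀) (u₁n n - u₁)) atTop (𝓝 0))
    {R T : ℝ} (hR : k.κ + 1 ≤ R) (hT0 : 0 < T) (hT : T ≤ k.T) (hRT : R * T ≤ r₀)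
    {u : ℕ → ℝ → H} (hu : ∀ n, InPhaseSpace S T (u n))
    (hsol : ∀ n, IsSolution S (mn n) (u₀n n) (u₁n n) T (u n)) :
    ∃ ι : ℕ → ℕ, StrictMono ι ∧ ∃ w : ℝ → H, InScale S φ r₀ R α T w ∧
      TendstoInScale S φ r₀ R α T (fun j => u (ι j)) w ∧ IsSolution S m u₀ u₁ T w := by
  have hL' : 0 ≤ k.L' := (mul_nonneg (abs_nonneg L) (by linarith [k.K_pos])).trans k.le_L'
  choose c hc hcu using fun n => (hmn n).exists_coeff hφm hT0 hT (hdatan n) (hu n) (hsol n)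
  obtain ⟨ι, hι, c₀, hc₀, hclim⟩ := exists_subseq_coeffClass k.hω hL' hc
  have hscale : TendstoInScale S φ r₀ R α T (fun j => u (ι j)) (linSol S c₀ u₀ u₁) :=
    (k.tendstoInScale_linSol hφm hR hT hRT (fun n => hc (ι n)) hc₀ hclim
      (fun n => (hdatan (ι n)).trans_lt ENNReal.ofReal_lt_top) hdata
      (hdlim.comp hι.tendsto_atTop)).congr fun n t ht => (hcu (ι n) t ht).2.1
  refine ⟨ι, hι, _, k.inScale_linSol hφm hR (hT.trans k.T_le) hRT hc₀ hdata, hscale,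
    k.isSolution_linSol hφm hT0 hT hc₀ hdata fun t ht => ?_⟩
  have hhalf := hscale.tendsto_halfSq k.hφ k.hα hT0 hRT (fun n => hu (ι n))
    (k.inPhaseSpace_linSol hφm hT0 hT hc₀ hdata) ht
  set x := halfSq S (linSol S c₀ u₀ u₁) t with hx
  have hx0 : 0 ≤ x := halfSq_nonneg _ _
  have hxn : Tendsto (fun n => halfSq S (u (ι n)) t) atTop (𝓝[Icc 0 (x + 1)] x) :=
    tendsto_nhdsWithin_iff.2 ⟨hhalf, by
      filter_upwards [hhalf.eventually_le_const (lt_add_one x)] with n hn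
      exact ⟨halfSq_nonneg _ _, hn⟩⟩
  have hmι : TendstoUniformlyOn (fun n => mn (ι n)) m atTop (Icc 0 (x + 1)) := fun V hV =>
    hι.tendsto_atTop.eventually (hlim (x + 1) V hV)
  have hmx : ContinuousWithinAt m (Icc 0 (x + 1)) x :=
    (OmegaContinuousWith.continuousOn k.hω hm x hx0).mono fun _ h => h.1
  -- The limit coefficient is m at the limit argument: uniform convergence of the nonlinearities is
  -- evaluated along the converging arguments.
  refine tendsto_nhds_unique (hclim.tendsto_at ⟨ht.1, ht.2.trans (hT.trans k.T_le)⟩)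
    ((hmι.tendsto_comp hmx hxn).congr fun n => ((hcu (ι n) t ht).1).symm)

theorem aprioriEstimate {m : ℝ → ℝ} (hm : k.Admits m) {u₀ u₁ : H}
    (hdata : dataEnergy S φ r₀ α u₀ u₁ ≤ ENNReal.ofReal k.D₀) :
    AprioriEstimate S m φ r₀ α k.T k.K (k.κ + 1) u₀ u₁ := by
  intro u hu hsol
  obtain ⟨c, hc, h⟩ := hm.exists_coeff hφm k.T_pos le_rfl hdata hu hsol
  exact ⟨fun t ht => (h t ht).2.2, (k.inScale_linSol hφm le_rfl k.T_le k.R_mul_T.le hc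
    (hdata.trans_lt ENNReal.ofReal_lt_top)).congr fun t ht => (h t ht).2.1⟩

theorem exists_solution {m : ℝ → ℝ} (hm : k.Admits m) {u₀ u₁ : H}
    (hdata : dataEnergy S φ r₀ α u₀ u₁ ≤ ENNReal.ofReal k.D₀)
    {R T : ℝ} (hR : k.κ + 1 ≤ R) (hT0 : 0 < T) (hT : T ≤ k.T) (hRT : R * T ≤ r₀) :
    ∃ u : ℝ → H, InScale S φ r₀ R α T u ∧ IsSolution S m u₀ u₁ T u := by
  obtain ⟨c, hc, h⟩ := hm.exists_fixed_coeff hφm hdata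
  have hfin := hdata.trans_lt ENNReal.ofReal_lt_top
  exact ⟨_, k.inScale_linSol hφm hR (hT.trans k.T_le) hRT hc hfin,
    k.isSolution_linSol hφm hT0 hT hc hfin fun t ht => h t (Icc_subset_Icc_right hT ht)⟩

end EnergyConstants

end

end Kirchhoff

/-! ### Assembly of the theorem -/

theorem mainTheorem7
    (ω m φ : ℝ → ℝ) (L Λ r₀ α N : ℝ)
    (hω : Kirchhoff.IsContinuityModulus ω)
    (hm_nonneg : ∀ σ : ℝ, 0 ≤ σ → 0 ≤ m σ)
    (hm : Kirchhoff.OmegaContinuousWith ω m L)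
    (hφ : ∀ σ : ℝ, 0 ≤ σ → 1 ≤ φ σ)
    (hφ_bdd : ∃ δ : ℝ, 0 < δ ∧ ∃ C : ℝ, ∀ σ ∈ Icc 0 δ, φ σ ≤ C)
    (hcomp : Kirchhoff.Compatible ω m φ Λ)
    (hr₀ : 0 < r₀) (hα : 1 / 4 ≤ α) :
    ∃ T K R : ℝ, 0 < T ∧ 0 < K ∧ 0 < R ∧ R * T < r₀ ∧
      ∀ (H : Type*) [NormedAddCommGroup H] [InnerProductSpace ℝ H] [CompleteSpace H]
        [TopologicalSpace.SeparableSpace H]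
        (A : H →ₗ.[ℝ] H) (_ : Dense (A.domain : Set H)) (_ : IsSelfAdjoint A)
        (_ : ∀ x : A.domain, 0 ≤ inner ℝ (A x) (x : H))
        (M : Type*) [MeasurableSpace M] (μ : Measure M) (S : Kirchhoff.SpectralRep A μ)
        (_ : AEMeasurable (fun ξ => φ (S.lam ξ)) μ)
        (u₀ u₁ : H)
        (_ : Kirchhoff.gevreyNorm S φ r₀ (α + 1 / 2) u₀ ≤ ENNReal.ofReal N)
        (_ : Kirchhoff.gevreyNorm S φ r₀ α u₁ ≤ ENNReal.ofReal N),
        Kirchhoff.AprioriEstimate S m φ r₀ α T K R u₀ u₁ ∧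
        ∀ (mn : ℕ → ℝ → ℝ) (u₀n u₁n : ℕ → H) (T₁ R₁ : ℝ),
          (∀ n, ∀ σ : ℝ, 0 ≤ σ → 0 ≤ mn n σ) →
          (∀ n, Kirchhoff.OmegaContinuousWith ω (mn n) L) →
          (∀ b : ℝ, TendstoUniformlyOn mn m atTop (Icc 0 b)) →
          (∀ n, Kirchhoff.MemGevrey S φ r₀ (α + 1 / 2) (u₀n n)) →
          (∀ n, Kirchhoff.MemGevrey S φ r₀ α (u₁n n)) →
          Tendsto (fun n => Kirchhoff.gevreyNorm S φ r₀ (α + 1 / 2) (u₀n n - u₀)) atTop (𝓝 0) →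
          Tendsto (fun n => Kirchhoff.gevreyNorm S φ r₀ α (u₁n n - u₁)) atTop (𝓝 0) →
          0 < T₁ → T₁ < T → R < R₁ → R₁ * T₁ < r₀ →
          ∃ n₀ : ℕ,
            (∀ n, n₀ ≤ n → ∃ u : ℝ → H, Kirchhoff.InScale S φ r₀ R₁ α T₁ u ∧
              Kirchhoff.IsSolution S (mn n) (u₀n n) (u₁n n) T₁ u) ∧
            ∀ u : ℕ → ℝ → H,
              (∀ n, n₀ ≤ n → Kirchhoff.InScale S φ r₀ R₁ α T₁ (u n) ∧
                Kirchhoff.IsSolution S (mn n) (u₀n n) (u₁n n) T₁ (u n)) →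
              (∀ κ : ℕ → ℕ, StrictMono κ → ∃ ι : ℕ → ℕ, StrictMono ι ∧
                ∃ w : ℝ → H, Kirchhoff.InScale S φ r₀ R₁ α T₁ w ∧
                  Kirchhoff.TendstoInScale S φ r₀ R₁ α T₁ (fun j => u (κ (ι j))) w) ∧
              (∀ κ : ℕ → ℕ, StrictMono κ → ∀ w : ℝ → H,
                Kirchhoff.InScale S φ r₀ R₁ α T₁ w →
                Kirchhoff.TendstoInScale S φ r₀ R₁ α T₁ (fun j => u (κ j)) w →
                Kirchhoff.IsSolution S m u₀ u₁ T₁ w) := by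
  obtain ⟨C₂, hC₂, hw⟩ := Kirchhoff.exists_weight_le_add_half hφ hφ_bdd hr₀.le
    (show 0 < α by linarith)
  have hC₂0 : 0 ≤ C₂ := zero_le_one.trans hC₂
  set E : ℝ := (C₂ + 1) * max N 0 ^ 2 with hEdef
  have hE : 0 ≤ E := by positivity
  -- The data have energy at most E. Splitting perturbed data costs a factor 2, and their distance
  -- to the limit eventually has energy at most 1, whence 2E + 2.
  obtain ⟨ν, k, hD₀, δ, hδ, hadm⟩ := Kirchhoff.exists_energyConstants (2 * E + 2) (by linarith)
    hω hm_nonneg hm hφ hφ_bdd hcomp hr₀ hα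
  have hκ := k.κ_nonneg
  refine ⟨k.T, k.K, k.κ + 1, k.T_pos, k.K_pos, by linarith, k.R_mul_T, ?_⟩
  intro H _ _ _ _ A _ _ _ M _ μ S hφm u₀ u₁ hu₀ hu₁
  have hdataE : Kirchhoff.dataEnergy S φ r₀ α u₀ u₁ ≤ ENNReal.ofReal E := by
    refine (Kirchhoff.dataEnergy_le hφm hC₂0 hw u₀ u₁).trans ?_
    rw [show E = C₂ * max N 0 ^ 2 + max N 0 ^ 2 by rw [hEdef]; ring,
      ENNReal.ofReal_add (by positivity) (by positivity), ENNReal.ofReal_mul hC₂0]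
    gcongr
    · exact Kirchhoff.wInt_le_sq hu₀
    · exact Kirchhoff.wInt_le_sq hu₁
  have hdata : Kirchhoff.dataEnergy S φ r₀ α u₀ u₁ ≤ ENNReal.ofReal k.D₀ :=
    hdataE.trans (ENNReal.ofReal_le_ofReal (by linarith))
  refine ⟨k.aprioriEstimate hφm (hadm m hm_nonneg hm fun σ _ => by simpa using hδ.le) hdata, ?_⟩
  intro mn u₀n u₁n T₁ R₁ hmn0 hmn hmlim _ _ hlim₀ hlim₁ hT₁ hT₁T hR₁ hRT
  have hdlim : Tendsto (fun n => Kirchhoff.dataEnergy S φ r₀ α (u₀n n - u₀) (u₁n n - u₁))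
      atTop (𝓝 0) := by
    have h := (ENNReal.Tendsto.const_mul (a := ENNReal.ofReal C₂)
      (Kirchhoff.tendsto_gevreyNorm_iff S |>.1 hlim₀) (Or.inr ENNReal.ofReal_ne_top)).add
      (Kirchhoff.tendsto_gevreyNorm_iff S |>.1 hlim₁)
    rw [mul_zero, add_zero] at h
    exact tendsto_of_tendsto_of_tendsto_of_le_of_le tendsto_const_nhds h (fun _ => zero_le)
      fun n => Kirchhoff.dataEnergy_le hφm hC₂0 hw _ _
  have hev : ∀ᶠ n in atTop, k.Admits (mn n) ∧
      Kirchhoff.dataEnergy S φ r₀ α (u₀n n) (u₁n n) ≤ ENNReal.ofReal k.D₀ := by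
    filter_upwards [Metric.tendstoUniformlyOn_iff.1 (hmlim k.B) δ hδ,
      (ENNReal.tendsto_nhds_zero.1 hdlim) 1 one_pos] with n h1 h2
    refine ⟨hadm _ (hmn0 n) (hmn n) fun σ hσ => ?_, ?_⟩
    · rw [abs_sub_comm, ← Real.dist_eq]
      exact (h1 σ hσ).le
    · refine (Kirchhoff.dataEnergy_le_add hφm r₀ α _ _ u₀ u₁).trans ?_
      rw [hD₀, add_comm (2 * E), ENNReal.ofReal_add zero_le_two (by linarith),
        ENNReal.ofReal_mul zero_le_two, ENNReal.ofReal_ofNat]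
      gcongr
      simpa using mul_le_mul_right h2 2
  obtain ⟨n₀, hn₀⟩ := eventually_atTop.1 hev
  refine ⟨n₀, fun n hn => k.exists_solution hφm (hn₀ n hn).1 (hn₀ n hn).2 hR₁.le hT₁ hT₁T.le
    hRT.le, fun u hu => ?_⟩
  have hsub : ∀ κ : ℕ → ℕ, StrictMono κ → ∃ ι : ℕ → ℕ, StrictMono ι ∧ ∃ w : ℝ → H,
      Kirchhoff.InScale S φ r₀ R₁ α T₁ w ∧
      Kirchhoff.TendstoInScale S φ r₀ R₁ α T₁ (fun j => u (κ (ι j))) w ∧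
      Kirchhoff.IsSolution S m u₀ u₁ T₁ w := fun κ hκ' => by
    -- Shifting the subsequence by n₀ makes every term admissible, so the compactness theorem
    -- applies without exceptional indices.
    have hge : ∀ j, n₀ ≤ κ (j + n₀) := fun j => (Nat.le_add_left _ _).trans (hκ'.le_apply)
    have htend : Tendsto (fun j => κ (j + n₀)) atTop atTop :=
      hκ'.tendsto_atTop.comp (tendsto_add_atTop_nat n₀)
    obtain ⟨ι, hι, h⟩ := k.exists_subseq_solution hφm hm (mn := fun j => mn (κ (j + n₀)))
      (fun j => (hn₀ _ (hge j)).1) (fun b V hV => htend.eventually (hmlim b V hV))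
      (hdata.trans_lt ENNReal.ofReal_lt_top) (fun j => (hn₀ _ (hge j)).2) (hdlim.comp htend)
      hR₁.le hT₁ hT₁T.le hRT.le (u := fun j => u (κ (j + n₀)))
      (fun j => (hu _ (hge j)).1.inPhaseSpace hφ hα hT₁ hRT.le) fun j => (hu _ (hge j)).2
    exact ⟨fun j => ι j + n₀, fun a b hab => Nat.add_lt_add_right (hι hab) n₀, h⟩
  refine ⟨fun κ hκ' => ?_, fun κ hκ' w hw hlim => ?_⟩
  · obtain ⟨ι, hι, w, hw1, hw2, -⟩ := hsub κ hκ'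
    exact ⟨ι, hι, w, hw1, hw2⟩
  -- A further subsequence converges to a solution v. By uniqueness of limits in H, v equals the
  -- given limit w on [0, T₁], so w is a solution too.
  · obtain ⟨ι, hι, v, -, hv2, hv3⟩ := hsub κ hκ'
    exact hv3.congr hT₁.le fun t ht => tendsto_nhds_unique
      ((hlim.tendsto hT₁ ht).comp hι.tendsto_atTop) (hv2.tendsto hT₁ ht)
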